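/- **Theorem 1.4.** Let $n\ge 2$. Write $\mathcal L^n$ for Lebesgue measure, $\mathcal H^{n-1}$ for the $(n-1)$-dimensional Hausdorff measure, $\omega_n=\mathcal L^n(B_1)$, and $\sigma$ for the surface measure on $\mathbb S^{n-1}$. For a bounded open set $\Omega\subset\mathbb R^n$ let $\Omega^\sharp$ be the ball centered at the origin with $\mathcal L^n(\Omega^\sharp)=\mathcal L^n(\Omega)$, and let $$\lambda(\Omega)=\min_{w\in H^1(\Omega),\,w\neq 0}\frac{\int_\Omega|Dw|^2\,dx+\int_\Omega w^2\,dx}{\int_{\partial\Omega}w^2\,d\mathcal H^{n-1}},\qquad V(\Omega)=\int_\Omega(|Dz|^2+z^2)\,dx,\qquad P(\Omega)=\int_{\partial\Omega}z^2\,d\mathcal H^{n-1},$$ where on $\partial\Omega$ the function $w$ is understood in the sense of traces, and $z(x)=|x|^{1-\frac n2}I_{\frac n2-1}(|x|)$, with $I_\nu$ the modified Bessel function of the first kind and order $\nu$ (and $z(0)$ defined by continuity). For $\varepsilon>0$ let $\mathcal N(n,\varepsilon)$ be the set of $v\in W^{1,\infty}(\mathbb S^{n-1})$ (identified with their continuous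 representatives) such that $\|v\|_{W^{1,\infty}}=\|v\|_{L^\infty}+\|Dv\|_{L^\infty}\le\varepsilon$, $\frac1n\int_{\mathbb S^{n-1}}(1+v)^n\,d\sigma=\omega_n$ (volume constraint) and $\int_{\mathbb S^{n-1}}(1+v(\xi))^{n+1}\,\xi\,d\sigma_\xi=0$ (barycenter constraint). For $\omega>0$, a bounded open set $\Omega\subset\mathbb R^n$ is called $(n,\omega,\varepsilon)$-nearly spherical, with polar representation $v\in\mathcal N(n,\varepsilon)$ about the point $c\in\mathbb R^n$, if $$\partial(\Omega-c)=\{\rho\,(1+v(\xi))\,\xi:\ \xi\in\mathbb S^{n-1}\},\qquad \rho=(\omega/\omega_n)^{1/n}.$$ For every $n\ge2$ and every $\omega>0$ there exist constants $\varepsilon\in(0,1]$ and $K>0$, depending only on $n$ and $\omega$, such that, whenever $\Omega$ is $(n,\omega,\varepsilon)$-nearly spherical with polar representation $v\in\mathcal N(n,\varepsilon)$ about $c$, $$\lambda(\Omega^\sharp)=\frac{V(\Omega^\sharp)}{P(\Omega^\sharp)}\ \ge\ \frac{V(\Omega-c)}{P(\Omega-c)}\left(1+K\int_{\mathbb S^{n-1}}v^2\,d\sigma\right)\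 \ge\ \lambda(\Omega)\left(1+K\int_{\mathbb S^{n-1}}v^2\,d\sigma\right).$$ -/

import Mathlib

open MeasureTheory Metric Set Filter Topology
open scoped ENNReal

noncomputable section

/-- Euclidean `n`-space. -/
abbrev Eucl (n : ℕ) : Type := EuclideanSpace ℝ (Fin n)

/-- The unit sphere `𝕊ⁿ⁻¹` of `ℝⁿ`. -/
abbrev USphere (n : ℕ) : Type := sphere (0 : Eucl n) 1

/-- The surface area measure `σ` on the unit sphere. -/
def sphereMeasure (n : ℕ) : Measure (USphere n) :=
  (volume : Measure (Eucl n)).toSphere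

/-- `ω_n`, the Lebesgue measure of the unit ball of `ℝⁿ`. -/
def unitBallVolume (n : ℕ) : ℝ := volume.real (ball (0 : Eucl n) 1)

/-- The radius `(ω / ω_n)^{1/n}` of a ball of Lebesgue measure `ω`. -/
def radiusOfVolume (n : ℕ) (ω : ℝ) : ℝ := (ω / unitBallVolume n) ^ (1 / (n : ℝ))

/-- `Ω^♯`: the (open) ball centred at the origin with the same Lebesgue measure as `Ω`. -/
def symmBall {n : ℕ} (Ω : Set (Eucl n)) : Set (Eucl n) :=
  ball 0 (radiusOfVolume n (volume.real Ω))

/-- The `(n-1)`-dimensional Hausdorff measure on the boundary of `Ω` (normalized so as to be the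
usual surface area). -/
def boundaryMeasure {n : ℕ} (Ω : Set (Eucl n)) : Measure (Eucl n) :=
  (Measure.euclideanHausdorffMeasure (n - 1)).restrict (frontier Ω)

/-! ### The trace eigenvalue -/

/-- `g` is the weak (distributional) gradient of `u` on the open set `U`. -/
def HasWeakGradient {n : ℕ} (U : Set (Eucl n)) (u : Eucl n → ℝ) (g : Eucl n → Eucl n) : Prop :=
  LocallyIntegrableOn u U volume ∧ LocallyIntegrableOn g U volume ∧
    ∀ φ : Eucl n → ℝ, ContDiff ℝ (⊤ : ℕ∞) φ → HasCompactSupport φ → tsupport φ ⊆ U →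
      ∫ x in U, u x • gradient φ x = - ∫ x in U, φ x • g x

/-- `w ∈ H¹(Ω)`, with weak gradient `g`. -/
def MemH1 {n : ℕ} (Ω : Set (Eucl n)) (w : Eucl n → ℝ) (g : Eucl n → Eucl n) : Prop :=
  MemLp w 2 (volume.restrict Ω) ∧ MemLp g 2 (volume.restrict Ω) ∧ HasWeakGradient Ω w g

/-- `t ∈ L²(∂Ω)` is the trace of the function `w ∈ H¹(Ω)` with weak gradient `g`: the trace
operator is the continuous extension to `H¹(Ω)` of the restriction to `∂Ω` of functions that are
smooth up to the boundary. -/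
def HasTrace {n : ℕ} (Ω : Set (Eucl n)) (w : Eucl n → ℝ) (g : Eucl n → Eucl n)
    (t : Eucl n → ℝ) : Prop :=
  MemLp t 2 (boundaryMeasure Ω) ∧
    ∃ φ : ℕ → Eucl n → ℝ, (∀ k, ContDiff ℝ (⊤ : ℕ∞) (φ k)) ∧
      Tendsto (fun k => eLpNorm (fun x => φ k x - w x) 2 (volume.restrict Ω)) atTop (𝓝 0) ∧
      Tendsto (fun k => eLpNorm (fun x => gradient (φ k) x - g x) 2 (volume.restrict Ω))
        atTop (𝓝 0) ∧
      Tendsto (fun k => eLpNorm (fun x => φ k x - t x) 2 (boundaryMeasure Ω)) atTop (𝓝 0)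

/-- `λ(Ω)`: the minimum of `(∫_Ω |Dw|² + ∫_Ω w²) / ∫_{∂Ω} w² dℋⁿ⁻¹` over `w ∈ H¹(Ω)`, `w ≠ 0`.
Functions with zero trace, for which the quotient is `+∞`, do not contribute. -/
def traceEigenvalue {n : ℕ} (Ω : Set (Eucl n)) : ℝ :=
  sInf {q : ℝ | ∃ (w : Eucl n → ℝ) (g : Eucl n → Eucl n) (t : Eucl n → ℝ),
    MemH1 Ω w g ∧ HasTrace Ω w g t ∧ 0 < ∫ x, t x ^ 2 ∂(boundaryMeasure Ω) ∧
    q = ((∫ x in Ω, ‖g x‖ ^ 2) + ∫ x in Ω, w x ^ 2) / ∫ x, t x ^ 2 ∂(boundaryMeasure Ω)}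

/-! ### Weighted volume and weighted perimeter -/

/-- The modified Bessel function of the first kind `I_ν(s)`, for `s > 0` and `ν > -1`. -/
def besselI (ν s : ℝ) : ℝ :=
  ∑' k : ℕ, (s / 2) ^ (2 * (k : ℝ) + ν) / ((k.factorial : ℝ) * Real.Gamma ((k : ℝ) + ν + 1))

/-- The function `z(x) = |x|^{1-n/2} I_{n/2-1}(|x|)`, extended to `x = 0` by its limit there, which
makes it analytic on all of `ℝⁿ`. -/
def besselWeight (n : ℕ) (x : Eucl n) : ℝ :=
  open Classical in
  if x = 0 then 1 / ((2 : ℝ) ^ ((n : ℝ) / 2 - 1) * Real.Gamma ((n : ℝ) / 2))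
  else ‖x‖ ^ (1 - (n : ℝ) / 2) * besselI ((n : ℝ) / 2 - 1) ‖x‖

/-- The weighted volume `V(Ω) = ∫_Ω (|Dz|² + z²) dx`. -/
def weightedVolume {n : ℕ} (Ω : Set (Eucl n)) : ℝ :=
  ∫ x in Ω, (‖gradient (besselWeight n) x‖ ^ 2 + besselWeight n x ^ 2)

/-- The weighted perimeter `P(Ω) = ∫_{∂Ω} z² dℋⁿ⁻¹`. -/
def weightedPerimeter {n : ℕ} (Ω : Set (Eucl n)) : ℝ :=
  ∫ x, besselWeight n x ^ 2 ∂(boundaryMeasure Ω)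

/-! ### Nearly spherical sets -/

/-- The extension of a function on the unit sphere that is constant along rays from the origin:
`x ↦ f(x/|x|)` for `x ≠ 0` (and `0` at the origin). -/
def radialExtension {n : ℕ} {F : Type} [Zero F] (f : USphere n → F) (x : Eucl n) : F :=
  open Classical in
  if h : x = 0 then 0 else f ⟨‖x‖⁻¹ • x, by simp [norm_smul, h]⟩

/-- `G` is the weak tangential gradient `Dv` of the function `v` on the unit sphere: the gradient
of `x ↦ v(x/|x|)` on `ℝⁿ ∖ {0}` is `x ↦ Dv(x/|x|)/|x|`. -/
def HasWeakSphereGradient {n : ℕ} (v : USphere n → ℝ) (G : USphere n → Eucl n) : Prop :=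
  HasWeakGradient ({0}ᶜ) (radialExtension v) (fun x => ‖x‖⁻¹ • radialExtension G x)

/-- The class `𝒩(n,ε)` of functions `v ∈ W^{1,∞}(𝕊ⁿ⁻¹)` with
`‖v‖_{W^{1,∞}} = ‖v‖_∞ + ‖Dv‖_∞ ≤ ε` that satisfy the volume and the barycenter constraint.
Elements of `W^{1,∞}(𝕊ⁿ⁻¹)` are identified with their continuous representatives. -/
def nearlySphericalFunctions (n : ℕ) (ε : ℝ) : Set (USphere n → ℝ) :=
  {v | Continuous v ∧
    (∃ G : USphere n → Eucl n, HasWeakSphereGradient v G ∧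
      AEStronglyMeasurable G (sphereMeasure n) ∧
      eLpNorm v ∞ (sphereMeasure n) + eLpNorm G ∞ (sphereMeasure n) ≤ ENNReal.ofReal ε) ∧
    (1 / (n : ℝ)) * (∫ ξ, (1 + v ξ) ^ n ∂(sphereMeasure n)) = unitBallVolume n ∧
    ∫ ξ, (1 + v ξ) ^ (n + 1) • (ξ : Eucl n) ∂(sphereMeasure n) = 0}

/-- The bounded open set `Ω` is `(n,ω,ε)`-nearly spherical, and this is witnessed by `v ∈ 𝒩(n,ε)`
after the translation that brings the point `c` to the origin: the boundary of `Ω - c` is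
`r(ξ) = ρ (1 + v(ξ))` in polar coordinates, where `ρ = (ω/ω_n)^{1/n}`. -/
def IsNearlySphericalWith {n : ℕ} (ω ε : ℝ) (Ω : Set (Eucl n)) (c : Eucl n)
    (v : USphere n → ℝ) : Prop :=
  IsOpen Ω ∧ Bornology.IsBounded Ω ∧ v ∈ nearlySphericalFunctions n ε ∧
    frontier ((fun x => x - c) '' Ω) =
      range (fun ξ : USphere n => (radiusOfVolume n ω * (1 + v ξ)) • (ξ : Eucl n))

end

/-!
The weight is radial, `z(x) = f(|x|)`, where `f` is a rescaled `₀F₁` series with `f'(r) = r k(r)`,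
and `Δz = z` (`mul_deriv_besselSlope`). Everything is expressed through `f` and `k`: the
eigenvalue of the ball of radius `ρ` is `h = f'(ρ)/f(ρ)`, which is `besselRatio n ρ`.

*The two outer comparisons.* On a ball, the field `φ² ∇z / z` calibrates the energy of a smooth
function `φ`, because `div (∇z / z) + |∇z / z|² = 1`; integrated along rays this gives the trace
inequality with constant `h` (`trace_inequality_ball`). Equality holds for `z`, so that `λ(Ω^♯) =
V(Ω^♯)/P(Ω^♯)` (`traceEigenvalue_ball`). In general, the translate of `z` by `c` is smooth and
hence admissible, which gives `λ(Ω) ≤ V(Ω - c)/P(Ω - c)` (`traceEigenvalue_le_weighted`).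

*Reduction to the sphere.* The weak gradient bound makes `v` Lipschitz with a constant of order
`ε`, by mollification (`bounds_of_mem_nearlySphericalFunctions`), and a bounded open set whose
boundary is the graph of `R = ρ (1 + v)` is the domain under that graph
(`isRadialDomain_of_frontier_eq`). In polar coordinates `V = ∫ f k Rⁿ dσ`, as `|∇z|² + z² = div (z
∇z)`. For the perimeter only the lower bound `P ≥ ∫ f(R)² Rⁿ⁻¹ √(1 + |∇R|²/R²) dσ` is needed
(`le_weightedPerimeter`). It is proved without the area formula: projections along an axis do not
increase Hausdorff measure, so the measure of a piece of the graph is at least the volume of the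
cylinder of height one over it (`volume_cylinder_le`). That volume is found by a change of
variables (`volume_cylinder_radialGraph`), and the supremum over a dense set of axes gives the
density (`withDensity_le_graphMeasure`). For round spheres the bound is an equality
(`graphMeasure_one`, `graphMeasure_const`).

*The quantitative estimate.* It remains to bound `P - V/h` from below by a multiple of `∫ v²`
(`exists_radial_stability`). With a Lagrange multiplier for the volume, the integrand in `v` is
stationary at `v = 0` and is at least `-(n - g + θ) v²`, up to the factor `z² ρⁿ⁻¹`
(`exists_multiplier_second_order`), where `g` is `besselGap n ρ`; the area element adds nearly
`|∇v|²/2` (`exists_area_element_bound`). The volume and barycenter constraints make the mean and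
the first moments of `v` quadratically small, so the Poincaré inequality on the sphere with its
second eigenvalue, `∫ |∇v|² ≥ 2n ∫ v²` (`sphere_poincare`), holds up to a small error
(`exists_constrained_poincare`). The gap `g` is left over, and it is positive by an analysis of
the equation for `f` (`besselProfile_second_variation_pos`).

The second eigenvalue of the sphere is obtained from polynomials. On homogeneous polynomials of
degree `k`, minus the Laplace–Beltrami operator is `k (k + n - 2)` minus the Euclidean Laplacian,
which lowers the degree. Green's formula (`integral_sphereGrad_mul_pderiv`), induction on the
degree, and the Stone–Weierstrass theorem give the inequality for Lipschitz functions.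
-/


/-! ### The radial profile of the Bessel weight -/

/-- The entire function `s ↦ ∑ sᵏ / (k! Γ(k + a))`, a rescaled hypergeometric function `₀F₁`;
`I_ν(r) = (r/2)^ν · besselSeries (ν + 1) (r²/4)`. -/
noncomputable def besselSeries (a s : ℝ) : ℝ :=
  ∑' k : ℕ, s ^ k / ((k.factorial : ℝ) * Real.Gamma ((k : ℝ) + a))

theorem exists_inv_Gamma_add_nat_le {a : ℝ} (ha : 0 < a) :
    ∃ C : ℝ, 0 < C ∧ ∀ k : ℕ, (Real.Gamma ((k : ℝ) + a))⁻¹ ≤ C := by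
  have h1 : ∀ k : ℕ, Real.Gamma (a + 1) ≤ Real.Gamma (((k + 1 : ℕ) : ℝ) + a) := by
    intro k
    induction k with
    | zero => simp [add_comm]
    | succ k ih =>
      refine ih.trans ?_
      have : (((k + 1 + 1 : ℕ) : ℝ) + a) = (((k + 1 : ℕ) : ℝ) + a) + 1 := by push_cast; ring
      rw [this, Real.Gamma_add_one (by positivity)]
      have hpos : 0 < Real.Gamma (((k + 1 : ℕ) : ℝ) + a) := Real.Gamma_pos_of_pos (by positivity)
      have : (1 : ℝ) ≤ ((k + 1 : ℕ) : ℝ) + a := by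
        push_cast
        have : (0 : ℝ) ≤ k := k.cast_nonneg
        linarith
      nlinarith
  have g0 := Real.Gamma_pos_of_pos ha
  have g1 : 0 < Real.Gamma (a + 1) := Real.Gamma_pos_of_pos (by positivity)
  refine ⟨(Real.Gamma a)⁻¹ + (Real.Gamma (a + 1))⁻¹, by positivity, fun k => ?_⟩
  rcases k with _ | k
  · simp only [Nat.cast_zero, zero_add]
    have := inv_pos.2 g1
    linarith
  · have := inv_anti₀ g1 (h1 k)
    have := inv_pos.2 g0
    linarith

theorem summable_besselSeries {a : ℝ} (ha : 0 < a) (s : ℝ) :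
    Summable fun k : ℕ => s ^ k / ((k.factorial : ℝ) * Real.Gamma ((k : ℝ) + a)) := by
  obtain ⟨C, hC, h⟩ := exists_inv_Gamma_add_nat_le ha
  refine Summable.of_norm_bounded (g := fun k : ℕ => C * (|s| ^ k / (k.factorial : ℝ)))
    ((Real.summable_pow_div_factorial |s|).mul_left C) fun k => ?_
  have g0 : 0 < Real.Gamma ((k : ℝ) + a) := Real.Gamma_pos_of_pos (by positivity)
  rw [Real.norm_eq_abs, abs_div, abs_pow, abs_of_pos (a := (k.factorial : ℝ) * _) (by positivity)]
  calc |s| ^ k / ((k.factorial : ℝ) * Real.Gamma ((k : ℝ) + a))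
      = (Real.Gamma ((k : ℝ) + a))⁻¹ * (|s| ^ k / (k.factorial : ℝ)) := by field_simp
    _ ≤ C * (|s| ^ k / (k.factorial : ℝ)) := by gcongr; exact h k

theorem besselSeries_pos {a s : ℝ} (ha : 0 < a) (hs : 0 ≤ s) : 0 < besselSeries a s := by
  have hk : ∀ k : ℕ, 0 < Real.Gamma ((k : ℝ) + a) := fun k => Real.Gamma_pos_of_pos (by positivity)
  refine (summable_besselSeries ha s).tsum_pos (fun k => ?_) 0 ?_
  · have := hk k
    positivity
  · have := hk 0
    simp only [pow_zero, Nat.factorial_zero, Nat.cast_one, one_mul]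
    positivity

theorem hasDerivAt_besselSeries {a : ℝ} (ha : 0 < a) (s : ℝ) :
    HasDerivAt (besselSeries a) (besselSeries (a + 1) s) s := by
  obtain ⟨C, hC, h⟩ := exists_inv_Gamma_add_nat_le ha
  set M : ℝ := |s| + 1 with hM
  have hM0 : 0 < M := by positivity
  have hsum : Summable fun k : ℕ => C * ((k : ℝ) * M ^ (k - 1) / (k.factorial : ℝ)) := by
    refine Summable.mul_left C ?_
    rw [← summable_nat_add_iff 1]
    refine (Real.summable_pow_div_factorial M).congr fun k => ?_
    rw [Nat.factorial_succ]
    push_cast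
    field_simp
  have hd := hasDerivAt_tsum_of_isPreconnected (t := ball (0 : ℝ) M) (y₀ := 0)
    (g := fun (k : ℕ) (x : ℝ) => x ^ k / ((k.factorial : ℝ) * Real.Gamma ((k : ℝ) + a)))
    (g' := fun (k : ℕ) (x : ℝ) =>
      (k : ℝ) * x ^ (k - 1) / ((k.factorial : ℝ) * Real.Gamma ((k : ℝ) + a)))
    hsum isOpen_ball (convex_ball _ _).isPreconnected
    (fun k x _ => (hasDerivAt_pow k x).div_const _)
    (fun k x hx => ?_) (mem_ball_self hM0) (summable_besselSeries ha 0)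
    (show s ∈ ball (0 : ℝ) M by simp [hM])
  · refine hd.congr_deriv ?_
    have hs' : Summable fun k : ℕ =>
        (k : ℝ) * s ^ (k - 1) / ((k.factorial : ℝ) * Real.Gamma ((k : ℝ) + a)) := by
      rw [← summable_nat_add_iff 1]
      refine (summable_besselSeries (a := a + 1) (by positivity) s).congr fun k => ?_
      rw [Nat.factorial_succ]
      push_cast
      rw [show (k : ℝ) + 1 + a = k + (a + 1) by ring]
      field_simp
    rw [besselSeries, hs'.tsum_eq_zero_add]
    simp only [Nat.cast_zero, zero_mul, zero_div, zero_add]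
    refine tsum_congr fun k => ?_
    rw [Nat.factorial_succ]
    push_cast
    rw [show (k : ℝ) + 1 + a = k + (a + 1) by ring]
    field_simp
  · have g0 : 0 < Real.Gamma ((k : ℝ) + a) := Real.Gamma_pos_of_pos (by positivity)
    have hx' : |x| ≤ M := by simpa using (mem_ball_zero_iff.1 hx).le
    rw [Real.norm_eq_abs, abs_div, abs_mul, abs_pow, Nat.abs_cast,
      abs_of_pos (a := (k.factorial : ℝ) * _) (by positivity)]
    calc (k : ℝ) * |x| ^ (k - 1) / ((k.factorial : ℝ) * Real.Gamma ((k : ℝ) + a))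
        = (Real.Gamma ((k : ℝ) + a))⁻¹ * ((k : ℝ) * |x| ^ (k - 1) / (k.factorial : ℝ)) := by
          field_simp
      _ ≤ C * ((k : ℝ) * M ^ (k - 1) / (k.factorial : ℝ)) := by gcongr; exact h k

theorem besselSeries_recurrence {a : ℝ} (ha : 0 < a) (s : ℝ) :
    s * besselSeries (a + 2) s + a * besselSeries (a + 1) s = besselSeries a s := by
  have h0 := summable_besselSeries ha s
  have h1 := summable_besselSeries (a := a + 1) (by positivity) s
  have h2 := summable_besselSeries (a := a + 2) (by positivity) s
  simp only [besselSeries]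
  rw [h0.tsum_eq_zero_add, h1.tsum_eq_zero_add, mul_add, ← tsum_mul_left, ← tsum_mul_left,
    add_left_comm, ← (h2.mul_left s).tsum_add (((summable_nat_add_iff 1).2 h1).mul_left a)]
  congr 1
  · have := Real.Gamma_pos_of_pos ha
    simp only [Nat.cast_zero, zero_add, pow_zero, Nat.factorial_zero, Nat.cast_one, one_mul]
    rw [Real.Gamma_add_one ha.ne']
    field_simp
  · refine tsum_congr fun k => ?_
    have hk : 0 < (k : ℝ) + 1 + a := by positivity
    have hg := Real.Gamma_pos_of_pos hk
    rw [Nat.factorial_succ]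
    push_cast
    rw [show (k : ℝ) + (a + 2) = (k + 1 + a) + 1 by ring,
      show (k : ℝ) + 1 + (a + 1) = (k + 1 + a) + 1 by ring, Real.Gamma_add_one hk.ne']
    field_simp
    ring

theorem contDiff_besselSeries {a : ℝ} (ha : 0 < a) : ContDiff ℝ (⊤ : ℕ∞) (besselSeries a) := by
  refine contDiff_infty.2 fun m => ?_
  induction m generalizing a with
  | zero =>
    exact contDiff_zero.2 (continuous_iff_continuousAt.2 fun s =>
      (hasDerivAt_besselSeries ha s).continuousAt)
  | succ m ih =>
    have hderiv : deriv (besselSeries a) = besselSeries (a + 1) :=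
      funext fun s => (hasDerivAt_besselSeries ha s).deriv
    rw [Nat.cast_succ, contDiff_succ_iff_deriv, hderiv]
    exact ⟨fun s => (hasDerivAt_besselSeries ha s).differentiableAt, by simp,
      ih (by positivity)⟩

/-- The radial profile `f` of the Bessel weight: `z(x) = f(|x|)`. -/
noncomputable def besselProfile (n : ℕ) (r : ℝ) : ℝ :=
  2 ^ (1 - (n : ℝ) / 2) * besselSeries ((n : ℝ) / 2) (r ^ 2 / 4)

/-- The even, positive function `k` with `f'(r) = r k(r)`, where `f` is the radial profile of the
Bessel weight. -/
noncomputable def besselSlope (n : ℕ) (r : ℝ) : ℝ :=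
  2 ^ (1 - (n : ℝ) / 2) * besselSeries ((n : ℝ) / 2 + 1) (r ^ 2 / 4) / 2

theorem besselWeight_eq_besselProfile {n : ℕ} (x : Eucl n) :
    besselWeight n x = besselProfile n ‖x‖ := by
  unfold besselWeight besselProfile
  split_ifs with hx
  · subst hx
    have : besselSeries ((n : ℝ) / 2) 0 = (Real.Gamma ((n : ℝ) / 2))⁻¹ := by
      rw [besselSeries, tsum_eq_single 0]
      · simp
      · intro k hk
        simp [hk]
    rw [norm_zero, zero_pow two_ne_zero, zero_div, this, one_div, mul_inv,
      ← Real.rpow_neg (by simp)]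
    congr 2
    ring
  · have hr : 0 < ‖x‖ := norm_pos_iff.2 hx
    set r := ‖x‖
    rw [besselI, besselSeries, ← tsum_mul_left, ← tsum_mul_left]
    refine tsum_congr fun k => ?_
    have h1 : (r / 2) ^ (2 * (k : ℝ) + ((n : ℝ) / 2 - 1))
        = (r ^ 2 / 4) ^ k * (r / 2) ^ ((n : ℝ) / 2 - 1) := by
      rw [Real.rpow_add (by positivity), Real.rpow_mul (by positivity), Real.rpow_two,
        Real.rpow_natCast]
      congr 2
      ring
    have h2 : r ^ (1 - (n : ℝ) / 2) * (r / 2) ^ ((n : ℝ) / 2 - 1) = 2 ^ (1 - (n : ℝ) / 2) := by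
      have : (n : ℝ) / 2 - 1 = -(1 - (n : ℝ) / 2) := by ring
      rw [this, Real.rpow_neg (by positivity), Real.div_rpow hr.le (by simp), inv_div]
      have := Real.rpow_pos_of_pos hr (1 - (n : ℝ) / 2)
      field_simp
    rw [h1, ← h2, show (k : ℝ) + ((n : ℝ) / 2 - 1) + 1 = k + (n : ℝ) / 2 by ring]
    ring

section Profile

variable {n : ℕ}

theorem hasDerivAt_besselProfile (hn : 0 < n) (r : ℝ) :
    HasDerivAt (besselProfile n) (r * besselSlope n r) r := by
  have h := ((hasDerivAt_besselSeries (a := (n : ℝ) / 2) (by positivity) (r ^ 2 / 4)).comp r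
    ((hasDerivAt_pow 2 r).div_const 4)).const_mul ((2 : ℝ) ^ (1 - (n : ℝ) / 2))
  refine h.congr_deriv ?_
  simp only [besselSlope]
  push_cast
  ring

theorem contDiff_besselProfile (hn : 0 < n) : ContDiff ℝ (⊤ : ℕ∞) (besselProfile n) :=
  contDiff_const.mul ((contDiff_besselSeries (by positivity)).comp (by fun_prop))

theorem contDiff_besselSlope : ContDiff ℝ (⊤ : ℕ∞) (besselSlope n) :=
  (contDiff_const.mul ((contDiff_besselSeries (by positivity)).comp (by fun_prop))).div_const 2

theorem contDiff_besselWeight (hn : 0 < n) : ContDiff ℝ (⊤ : ℕ∞) (besselWeight n) := by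
  have : besselWeight n = fun x : Eucl n =>
      2 ^ (1 - (n : ℝ) / 2) * besselSeries ((n : ℝ) / 2) (‖x‖ ^ 2 / 4) :=
    funext fun x => besselWeight_eq_besselProfile x
  rw [this]
  exact contDiff_const.mul ((contDiff_besselSeries (by positivity)).comp
    ((contDiff_norm_sq ℝ).div_const 4))

theorem besselProfile_pos (hn : 0 < n) (r : ℝ) : 0 < besselProfile n r :=
  mul_pos (by positivity) (besselSeries_pos (by positivity) (by positivity))

theorem besselSlope_pos (r : ℝ) : 0 < besselSlope n r :=
  half_pos (mul_pos (by positivity) (besselSeries_pos (by positivity) (by positivity)))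

/-- The radial form of the equation `Δz = z`, written for `f'(r) = r k(r)`. -/
theorem mul_deriv_besselSlope (hn : 0 < n) (r : ℝ) :
    r * deriv (besselSlope n) r = besselProfile n r - n * besselSlope n r := by
  have h := (((hasDerivAt_besselSeries (a := (n : ℝ) / 2 + 1) (by positivity) (r ^ 2 / 4)).comp r
    ((hasDerivAt_pow 2 r).div_const 4)).const_mul ((2 : ℝ) ^ (1 - (n : ℝ) / 2))).div_const 2
  have hr := besselSeries_recurrence (a := (n : ℝ) / 2) (by positivity) (r ^ 2 / 4)
  have h' : deriv (besselSlope n) r = _ := h.deriv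
  rw [h', besselProfile, besselSlope, ← hr,
    show (n : ℝ) / 2 + 1 + 1 = (n : ℝ) / 2 + 2 by ring]
  push_cast
  ring

theorem hasDerivAt_besselSlope (r : ℝ) :
    HasDerivAt (besselSlope n) (deriv (besselSlope n) r) r :=
  (contDiff_besselSlope.differentiable (by simp) r).hasDerivAt

/-- With `h = f'/f`, the inequality `r h' ≤ h` (for `r > 0`), cleared of denominators. The
expression vanishes at `0` and, by the equation for `f`, has a nonnegative derivative. -/
theorem besselProfile_sq_le (hn : 0 < n) {r : ℝ} (hr : 0 ≤ r) :
    0 ≤ r ^ n * (r ^ 2 * besselSlope n r ^ 2 + n * besselSlope n r * besselProfile n r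
      - besselProfile n r ^ 2) := by
  set F : ℝ → ℝ := fun r => r ^ n * (r ^ 2 * besselSlope n r ^ 2
    + n * besselSlope n r * besselProfile n r - besselProfile n r ^ 2) with hF
  have hd : ∀ x, HasDerivAt F (2 * x ^ (n + 1) * besselSlope n x ^ 2) x := by
    intro x
    have hk := hasDerivAt_besselSlope (n := n) x
    have hf := hasDerivAt_besselProfile hn x
    have := (hasDerivAt_pow n x).mul ((((hasDerivAt_pow 2 x).mul (hk.pow 2)).add
      ((hk.const_mul (n : ℝ)).mul hf)).sub (hf.pow 2))
    refine this.congr_deriv ?_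
    obtain ⟨m, rfl⟩ : ∃ m, n = m + 1 := ⟨n - 1, by omega⟩
    have e := mul_deriv_besselSlope hn x
    simp only [Pi.mul_apply, Pi.add_apply, Pi.sub_apply, Pi.pow_apply, Nat.add_sub_cancel,
      pow_succ, pow_zero, one_mul]
    push_cast at e ⊢
    linear_combination (x ^ m * (2 * x ^ 2 * besselSlope (m + 1) x
      + (m + 1) * besselProfile (m + 1) x)) * e
  have hmono : MonotoneOn F (Ici 0) := by
    refine monotoneOn_of_deriv_nonneg (convex_Ici 0)
      (fun x _ => (hd x).continuousAt.continuousWithinAt)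
      (fun x _ => (hd x).differentiableAt.differentiableWithinAt) fun x hx => ?_
    rw [interior_Ici] at hx
    have hx : 0 < x := hx
    rw [(hd x).deriv]
    positivity
  have := hmono self_mem_Ici hr hr
  simpa [hF, hn.ne'] using this

/-- The strict positivity of the second variation on the second eigenspace of the sphere. With
`h = f'/f` it says `2 r² h'(r) < n + 1`, here cleared of denominators. After multiplication by
`rⁿ⁻¹` the expression vanishes at `0`, and the sign of its derivative is `besselProfile_sq_le`. -/
theorem besselProfile_second_variation_pos (hn : 2 ≤ n) {r : ℝ} (hr : 0 < r) :
    0 < r ^ 4 * besselSlope n r ^ 2 + (n - 1) * r ^ 2 * besselSlope n r * besselProfile n r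
      - r ^ 2 * besselProfile n r ^ 2 + (n + 1) / 2 * besselProfile n r ^ 2 := by
  set F : ℝ → ℝ := fun r => r ^ (n - 1) * (r ^ 4 * besselSlope n r ^ 2
    + (n - 1) * r ^ 2 * besselSlope n r * besselProfile n r
      - r ^ 2 * besselProfile n r ^ 2 + (n + 1) / 2 * besselProfile n r ^ 2) with hF
  have hd : ∀ x, HasDerivAt F (2 * (x ^ n * (x ^ 2 * besselSlope n x ^ 2
      + n * besselSlope n x * besselProfile n x - besselProfile n x ^ 2))
      + (n ^ 2 - 1) / 2 * x ^ (n - 2) * besselProfile n x ^ 2) x := by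
    intro x
    have hk := hasDerivAt_besselSlope (n := n) x
    have hf := hasDerivAt_besselProfile (by omega : 0 < n) x
    have := (hasDerivAt_pow (n - 1) x).mul (((((hasDerivAt_pow 4 x).mul (hk.pow 2)).add
      ((((hasDerivAt_pow 2 x).const_mul ((n : ℝ) - 1)).mul hk).mul hf)).sub
        ((hasDerivAt_pow 2 x).mul (hf.pow 2))).add ((hf.pow 2).const_mul (((n : ℝ) + 1) / 2)))
    refine this.congr_deriv ?_
    obtain ⟨m, rfl⟩ : ∃ m, n = m + 2 := ⟨n - 2, by omega⟩
    have e := mul_deriv_besselSlope (by omega : 0 < m + 2) x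
    simp only [Pi.mul_apply, Pi.add_apply, Pi.sub_apply, Pi.pow_apply, Nat.add_sub_cancel,
      show m + 2 - 1 = m + 1 by omega, pow_succ, pow_zero, one_mul]
    push_cast at e ⊢
    linear_combination (x ^ m * (2 * x ^ 4 * besselSlope (m + 2) x
      + (m + 1) * x ^ 2 * besselProfile (m + 2) x)) * e
  have hmono : StrictMonoOn F (Ici 0) := by
    refine strictMonoOn_of_deriv_pos (convex_Ici 0)
      (fun x _ => (hd x).continuousAt.continuousWithinAt) fun x hx => ?_
    rw [interior_Ici] at hx
    have hx : 0 < x := hx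
    rw [(hd x).deriv]
    have h1 := besselProfile_sq_le (by omega : 0 < n) hx.le
    have h2 := besselProfile_pos (by omega : 0 < n) x
    have h3 : (0 : ℝ) < (n : ℝ) ^ 2 - 1 := by
      have : (2 : ℝ) ≤ n := by exact_mod_cast hn
      nlinarith
    have : 0 < ((n : ℝ) ^ 2 - 1) / 2 * x ^ (n - 2) * besselProfile n x ^ 2 := by positivity
    linarith
  have h0 := hmono self_mem_Ici hr.le hr
  have hF0 : F 0 = 0 := by simp [hF, show n - 1 ≠ 0 by omega]
  rw [hF0] at h0
  exact pos_of_mul_pos_right h0 (by positivity)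

end Profile

/-! ### Polar coordinates -/

section Polar

variable {n : ℕ}

theorem nontrivial_eucl (hn : 0 < n) : Nontrivial (Eucl n) :=
  Module.nontrivial_of_finrank_pos (R := ℝ) (by simpa using hn)

instance : IsFiniteMeasure (sphereMeasure n) := by
  unfold sphereMeasure; infer_instance

instance : (sphereMeasure n).IsOpenPosMeasure := by
  unfold sphereMeasure; infer_instance

theorem norm_sphere_coe (ξ : USphere n) : ‖(ξ : Eucl n)‖ = 1 := norm_eq_of_mem_sphere ξ

theorem sphere_coe_ne_zero (ξ : USphere n) : (ξ : Eucl n) ≠ 0 := ne_zero_of_mem_unit_sphere ξ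

theorem norm_smul_sphere_coe {r : ℝ} (hr : 0 ≤ r) (ξ : USphere n) : ‖r • (ξ : Eucl n)‖ = r := by
  rw [norm_smul, norm_sphere_coe, mul_one, Real.norm_of_nonneg hr]

/-- The direction `x/|x|` of a nonzero vector. -/
noncomputable def sphereDir (x : Eucl n) (hx : x ≠ 0) : USphere n :=
  ⟨‖x‖⁻¹ • x, by simp [norm_smul, hx]⟩

theorem sphereDir_smul (ξ : USphere n) {r : ℝ} (hr : 0 < r) (h : r • (ξ : Eucl n) ≠ 0) :
    sphereDir (r • (ξ : Eucl n)) h = ξ := by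
  ext1
  simp only [sphereDir, norm_smul_sphere_coe hr.le, smul_smul, inv_mul_cancel₀ hr.ne', one_smul]

theorem norm_smul_sphereDir (x : Eucl n) (hx : x ≠ 0) : ‖x‖ • (sphereDir x hx : Eucl n) = x := by
  simp [sphereDir, smul_smul, hx]

theorem radialExtension_of_ne {F : Type} [Zero F] (f : USphere n → F) {x : Eucl n} (hx : x ≠ 0) :
    radialExtension f x = f (sphereDir x hx) := by
  simp [radialExtension, hx, sphereDir]

theorem radialExtension_smul {F : Type} [Zero F] (f : USphere n → F) (ξ : USphere n) {r : ℝ}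
    (hr : 0 < r) : radialExtension f (r • (ξ : Eucl n)) = f ξ := by
  have h : r • (ξ : Eucl n) ≠ 0 := smul_ne_zero hr.ne' (sphere_coe_ne_zero ξ)
  rw [radialExtension_of_ne f h, sphereDir_smul ξ hr h]

theorem radialExtension_coe {F : Type} [Zero F] (f : USphere n → F) (ξ : USphere n) :
    radialExtension f (ξ : Eucl n) = f ξ := by
  simpa using radialExtension_smul f ξ one_pos

theorem radialExtension_smul_of_pos {F : Type} [Zero F] (f : USphere n → F) (x : Eucl n) {r : ℝ}
    (hr : 0 < r) : radialExtension f (r • x) = radialExtension f x := by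
  rcases eq_or_ne x 0 with rfl | hx
  · simp
  · rw [← norm_smul_sphereDir x hx, smul_smul, radialExtension_smul _ _ (by positivity),
      radialExtension_smul _ _ (by positivity)]

theorem measurePreserving_polar (n : ℕ) :
    MeasurePreserving (homeomorphUnitSphereProd (Eucl n))
      ((volume : Measure (Eucl n)).comap (↑))
      ((sphereMeasure n).prod (Measure.volumeIoiPow (n - 1))) := by
  have := (volume : Measure (Eucl n)).measurePreserving_homeomorphUnitSphereProd
  rwa [finrank_euclideanSpace_fin] at this

theorem lintegral_volumeIoiPow (m : ℕ) {g : ℝ → ℝ≥0∞} (hg : Measurable g) :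
    ∫⁻ r, g (r : ℝ) ∂(Measure.volumeIoiPow m)
      = ∫⁻ r in Ioi (0 : ℝ), ENNReal.ofReal (r ^ m) * g r := by
  rw [Measure.volumeIoiPow, lintegral_withDensity_eq_lintegral_mul _ (by fun_prop) (by fun_prop),
    ← lintegral_subtype_comap measurableSet_Ioi]
  rfl

theorem integral_volumeIoiPow (m : ℕ) (g : ℝ → ℝ) :
    ∫ r, g (r : ℝ) ∂(Measure.volumeIoiPow m) = ∫ r in Ioi (0 : ℝ), r ^ m * g r := by
  simp only [Measure.volumeIoiPow, ENNReal.ofReal]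
  rw [integral_withDensity_eq_integral_smul (by fun_prop),
    integral_subtype_comap measurableSet_Ioi fun a ↦ Real.toNNReal (a ^ m) • g a,
    setIntegral_congr_fun measurableSet_Ioi fun x hx ↦ ?_]
  rw [NNReal.smul_def, Real.coe_toNNReal _ (pow_nonneg hx.out.le _), smul_eq_mul]

theorem lintegral_polar (hn : 0 < n) {F : Eucl n → ℝ≥0∞} (hF : Measurable F) :
    ∫⁻ x, F x = ∫⁻ ξ, ∫⁻ r in Ioi (0 : ℝ), ENNReal.ofReal (r ^ (n - 1)) * F (r • (ξ : Eucl n))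
      ∂volume ∂(sphereMeasure n) := by
  have := nontrivial_eucl hn
  rw [← restrict_compl_singleton (μ := (volume : Measure (Eucl n))) 0,
    ← lintegral_subtype_comap (measurableSet_singleton _).compl]
  have h := (measurePreserving_polar n).lintegral_comp_emb (Homeomorph.measurableEmbedding _)
    fun p => F ((p.2 : ℝ) • (p.1 : Eucl n))
  have h' : ∀ a : ({0}ᶜ : Set (Eucl n)), (((homeomorphUnitSphereProd (Eucl n)) a).2 : ℝ) •
      (((homeomorphUnitSphereProd (Eucl n)) a).1 : Eucl n) = a := fun a => by
    rw [← homeomorphUnitSphereProd_symm_apply_coe, Homeomorph.symm_apply_apply]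
  simp only [h'] at h
  rw [h, lintegral_prod _ (by fun_prop)]
  refine lintegral_congr fun ξ => ?_
  exact lintegral_volumeIoiPow (n - 1) (g := fun r => F (r • (ξ : Eucl n))) (by fun_prop)

theorem integral_polar (hn : 0 < n) {F : Eucl n → ℝ} (hF : Integrable F) :
    ∫ x, F x = ∫ ξ, ∫ r in Ioi (0 : ℝ), r ^ (n - 1) * F (r • (ξ : Eucl n))
      ∂volume ∂(sphereMeasure n) := by
  have := nontrivial_eucl hn
  rw [← restrict_compl_singleton (μ := (volume : Measure (Eucl n))) 0,
    ← integral_subtype_comap (measurableSet_singleton _).compl]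
  have h' : ∀ a : ({0}ᶜ : Set (Eucl n)), (((homeomorphUnitSphereProd (Eucl n)) a).2 : ℝ) •
      (((homeomorphUnitSphereProd (Eucl n)) a).1 : Eucl n) = a := fun a => by
    rw [← homeomorphUnitSphereProd_symm_apply_coe, Homeomorph.symm_apply_apply]
  have h := (measurePreserving_polar n).integral_comp (Homeomorph.measurableEmbedding _)
    fun p => F ((p.2 : ℝ) • (p.1 : Eucl n))
  have hi := (measurePreserving_polar n).integrable_comp_emb
    (Homeomorph.measurableEmbedding _) (g := fun p => F ((p.2 : ℝ) • (p.1 : Eucl n)))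
  simp only [Function.comp_def, h'] at h hi
  have hi := hi.1 (by
    rw [← restrict_compl_singleton (μ := (volume : Measure (Eucl n))) 0, ← IntegrableOn,
      integrableOn_iff_comap_subtypeVal (measurableSet_singleton _).compl] at hF
    exact hF)
  rw [h, integral_prod _ hi]
  refine integral_congr_ae (Eventually.of_forall fun ξ => ?_)
  exact integral_volumeIoiPow (n - 1) fun r => F (r • (ξ : Eucl n))

/-- Integration of a product of a radial and a `0`-homogeneous function. -/
theorem integral_polar_mul (hn : 0 < n) (A : ℝ → ℝ) (B : USphere n → ℝ) :
    ∫ x : Eucl n, radialExtension B x * A ‖x‖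
      = (∫ ξ, B ξ ∂(sphereMeasure n)) * ∫ r in Ioi (0 : ℝ), r ^ (n - 1) * A r := by
  have := nontrivial_eucl hn
  rw [← restrict_compl_singleton (μ := (volume : Measure (Eucl n))) 0,
    ← integral_subtype_comap (measurableSet_singleton _).compl,
    ← integral_volumeIoiPow, ← integral_prod_mul,
    ← (measurePreserving_polar n).integral_comp (Homeomorph.measurableEmbedding _)]
  refine integral_congr_ae (Eventually.of_forall fun x => ?_)
  have hx : (x : Eucl n) ≠ 0 := x.2
  simp only [homeomorphUnitSphereProd_apply_snd_coe, radialExtension_of_ne B hx]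
  congr 2
  exact Subtype.ext (homeomorphUnitSphereProd_apply_fst_coe _ x).symm

/-- A property that is inherited along rays and holds almost everywhere in space holds at almost
every point of the sphere. -/
theorem ae_sphere_of_ae {p : Eucl n → Prop}
    (hp : ∀ (x : Eucl n) (r : ℝ), 0 < r → p (r • x) → p x) (h : ∀ᵐ x : Eucl n, x ≠ 0 → p x) :
    ∀ᵐ ξ : USphere n ∂(sphereMeasure n), p (ξ : Eucl n) := by
  have h0 : ∀ᵐ x : ({0}ᶜ : Set (Eucl n)) ∂((volume : Measure (Eucl n)).comap (↑)),
      p x := by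
    rw [← ae_restrict_iff_subtype (measurableSet_singleton _).compl,
      ae_restrict_iff' (measurableSet_singleton _).compl]
    exact h
  have h1 : ∀ᵐ z ∂((sphereMeasure n).prod (Measure.volumeIoiPow (n - 1))),
      p (((z.2 : ℝ)) • (z.1 : Eucl n)) := by
    rw [← (measurePreserving_polar n).map_eq, (Homeomorph.measurableEmbedding _).ae_map_iff]
    filter_upwards [h0] with x hx
    rw [← homeomorphUnitSphereProd_symm_apply_coe, Homeomorph.symm_apply_apply]
    exact hx
  have hne : NeBot (ae (Measure.volumeIoiPow (n - 1))) := by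
    refine ae_neBot.2 fun h => ?_
    have := Measure.volumeIoiPow_apply_Iio (n - 1) ⟨1, mem_Ioi.2 one_pos⟩
    rw [h] at this
    simp only [Measure.coe_zero, Pi.zero_apply, one_pow, one_div] at this
    have h2 := this.symm
    rw [ENNReal.ofReal_eq_zero, inv_nonpos] at h2
    have : (0 : ℝ) ≤ ((n - 1 : ℕ) : ℝ) := Nat.cast_nonneg _
    linarith
  filter_upwards [Measure.ae_ae_of_ae_prod h1] with ξ hξ
  obtain ⟨r, hr⟩ := hξ.exists
  exact hp _ _ r.2 hr

theorem sphereMeasure_univ_real (n : ℕ) :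
    (sphereMeasure n).real univ = n * unitBallVolume n := by
  have := (volume : Measure (Eucl n)).toSphere_real_apply_univ
  rwa [finrank_euclideanSpace_fin] at this

end Polar

/-! ### Lipschitz functions on the sphere and their tangential gradient -/

section SphereGradient

variable {n : ℕ}

theorem hasFDerivAt_norm_of_ne {x : Eucl n} (hx : x ≠ 0) :
    HasFDerivAt (fun y : Eucl n => ‖y‖) (‖x‖⁻¹ • innerSL ℝ x) x := by
  have hx' : 0 < ‖x‖ := norm_pos_iff.2 hx
  have h := (hasFDerivAt_id x).norm_sq.sqrt (by simpa using hx)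
  simp only [id, Real.sqrt_sq (norm_nonneg _)] at h
  refine h.congr_fderiv ?_
  ext w
  simp
  field_simp

theorem hasFDerivAt_inv_norm_smul (ξ : USphere n) :
    HasFDerivAt (fun y : Eucl n => ‖y‖⁻¹ • y)
      (ContinuousLinearMap.id ℝ (Eucl n)
        - (innerSL ℝ (ξ : Eucl n)).smulRight (ξ : Eucl n)) (ξ : Eucl n) := by
  have h1 := hasFDerivAt_norm_of_ne (sphere_coe_ne_zero ξ)
  have h2 := ((hasDerivAt_inv (x := ‖(ξ : Eucl n)‖) (by simp)).comp_hasFDerivAt _ h1)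
  have h3 := h2.smul (hasFDerivAt_id (ξ : Eucl n))
  refine h3.congr_fderiv ?_
  ext1 w
  simp
  abel

/-- The gradient of a function on the unit sphere, as the gradient of its `0`-homogeneous
extension; it is `0` where that extension is not differentiable. -/
noncomputable def sphereGrad (v : USphere n → ℝ) (ξ : USphere n) : Eucl n :=
  gradient (radialExtension v) (ξ : Eucl n)

theorem measurable_sphereGrad (v : USphere n → ℝ) : Measurable (sphereGrad v) := by
  unfold sphereGrad gradient
  exact (InnerProductSpace.toDual ℝ (Eucl n)).symm.continuous.measurable.comp
    ((measurable_fderiv ℝ _).comp measurable_subtype_coe)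

theorem norm_smul_sphereDir_sub_le {x y : Eucl n} (hx : x ≠ 0) (hy : y ≠ 0) :
    ‖x‖ * dist (sphereDir x hx) (sphereDir y hy) ≤ 2 * ‖x - y‖ := by
  have h : ‖x‖ • ((sphereDir x hx : Eucl n) - sphereDir y hy)
      = (x - y) + (‖y‖ - ‖x‖) • (sphereDir y hy : Eucl n) := by
    rw [smul_sub, sub_smul, norm_smul_sphereDir, norm_smul_sphereDir]
    abel
  have h2 : ‖x‖ * dist (sphereDir x hx) (sphereDir y hy)
      = ‖‖x‖ • ((sphereDir x hx : Eucl n) - sphereDir y hy)‖ := by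
    rw [norm_smul, norm_norm, Subtype.dist_eq, dist_eq_norm]
  rw [h2, h]
  refine (norm_add_le _ _).trans ?_
  rw [norm_smul, norm_sphere_coe, mul_one, Real.norm_eq_abs]
  have := abs_norm_sub_norm_le y x
  rw [norm_sub_rev] at this
  linarith

/-- The `1`-homogeneous extension of a function on the sphere. Unlike the `0`-homogeneous one, it is
Lipschitz up to the origin when the function is Lipschitz. -/
noncomputable def coneExtension (v : USphere n → ℝ) (x : Eucl n) : ℝ :=
  ‖x‖ * radialExtension v x

theorem exists_lipschitzWith_coneExtension {v : USphere n → ℝ} {L : NNReal}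
    (hv : LipschitzWith L v) : ∃ C : NNReal, LipschitzWith C (coneExtension v) := by
  obtain ⟨M, hM⟩ := (isCompact_univ (X := USphere n)).exists_bound_of_continuousOn
    hv.continuous.continuousOn
  have hM' : ∀ x, |v x| ≤ max M 0 := fun x => (hM x trivial).trans (le_max_left _ _)
  set B := max M 0
  have hB : 0 ≤ B := le_max_right _ _
  have h0 : ∀ x : Eucl n, |coneExtension v x| ≤ B * ‖x‖ := by
    intro x
    rcases eq_or_ne x 0 with rfl | hx
    · simp [coneExtension]
    · rw [coneExtension, radialExtension_of_ne v hx, abs_mul, abs_norm, mul_comm]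
      gcongr
      exact hM' _
  refine ⟨⟨B + 2 * L, by positivity⟩, LipschitzWith.of_dist_le_mul fun x y => ?_⟩
  rw [Real.dist_eq, dist_eq_norm]
  change |coneExtension v x - coneExtension v y| ≤ (B + 2 * L) * ‖x - y‖
  have hL : (0 : ℝ) ≤ L := L.2
  rcases eq_or_ne x 0 with rfl | hx
  · have := h0 y
    have h1 : coneExtension v (0 : Eucl n) = 0 := by simp [coneExtension]
    rw [h1, zero_sub, abs_neg, zero_sub, norm_neg]
    nlinarith [norm_nonneg y]
  rcases eq_or_ne y 0 with rfl | hy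
  · have := h0 x
    have h1 : coneExtension v (0 : Eucl n) = 0 := by simp [coneExtension]
    rw [h1, sub_zero, sub_zero]
    nlinarith [norm_nonneg x]
  · have e : coneExtension v x - coneExtension v y
        = ‖x‖ * (v (sphereDir x hx) - v (sphereDir y hy))
          + (‖x‖ - ‖y‖) * v (sphereDir y hy) := by
      rw [coneExtension, coneExtension, radialExtension_of_ne v hx, radialExtension_of_ne v hy]
      ring
    have h1 : ‖x‖ * |v (sphereDir x hx) - v (sphereDir y hy)| ≤ L * (2 * ‖x - y‖) := by
      have := hv.dist_le_mul (sphereDir x hx) (sphereDir y hy)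
      rw [Real.dist_eq] at this
      have h2 := norm_smul_sphereDir_sub_le hx hy
      nlinarith [norm_nonneg x]
    have h2 : |‖x‖ - ‖y‖| * |v (sphereDir y hy)| ≤ ‖x - y‖ * B := by
      gcongr
      · exact abs_norm_sub_norm_le x y
      · exact hM' _
    rw [e]
    refine (abs_add_le _ _).trans ?_
    rw [abs_mul, abs_mul, abs_norm]
    linarith

theorem DifferentiableAt.radialExtension_of_coneExtension {v : USphere n → ℝ} {x : Eucl n}
    (hx : x ≠ 0) (h : DifferentiableAt ℝ (coneExtension v) x) :
    DifferentiableAt ℝ (radialExtension v) x := by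
  have h1 : DifferentiableAt ℝ (fun y => ‖y‖⁻¹ * coneExtension v y) x :=
    ((hasFDerivAt_norm_of_ne hx).differentiableAt.inv (by simpa using hx)).mul h
  refine h1.congr_of_eventuallyEq ?_
  filter_upwards [isOpen_ne.mem_nhds hx] with y hy
  have : ‖y‖ ≠ 0 := by simpa using hy
  rw [coneExtension, inv_mul_cancel_left₀ this]

theorem hasFDerivAt_radialExtension_smul {v : USphere n → ℝ} {x : Eucl n} {r : ℝ} (hr : 0 < r)
    {f' : Eucl n →L[ℝ] ℝ} (h : HasFDerivAt (radialExtension v) f' (r • x)) :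
    HasFDerivAt (radialExtension v) (r • f') x := by
  have h1 := h.comp x ((hasFDerivAt_id x).const_smul r)
  have h2 : radialExtension v ∘ (HSMul.hSMul r) = radialExtension v :=
    funext fun y => radialExtension_smul_of_pos v y hr
  rw [h2] at h1
  refine h1.congr_fderiv ?_
  ext w
  simp

theorem ae_differentiableAt_radialExtension {v : USphere n → ℝ} {L : NNReal}
    (hv : LipschitzWith L v) :
    ∀ᵐ x : Eucl n, x ≠ 0 → DifferentiableAt ℝ (radialExtension v) x := by
  obtain ⟨C, hC⟩ := exists_lipschitzWith_coneExtension hv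
  filter_upwards [hC.ae_differentiableAt] with x hx h0
  exact hx.radialExtension_of_coneExtension h0

theorem ae_sphere_differentiableAt {v : USphere n → ℝ} {L : NNReal} (hv : LipschitzWith L v) :
    ∀ᵐ ξ : USphere n ∂(sphereMeasure n),
      DifferentiableAt ℝ (radialExtension v) (ξ : Eucl n) :=
  ae_sphere_of_ae (p := fun x => DifferentiableAt ℝ (radialExtension v) x)
    (fun _ _ hr h => (hasFDerivAt_radialExtension_smul hr h.hasFDerivAt).differentiableAt)
    (ae_differentiableAt_radialExtension hv)

theorem inner_sphereGrad {v : USphere n → ℝ} (ξ : USphere n) (w : Eucl n) :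
    inner ℝ (sphereGrad v ξ) w = fderiv ℝ (radialExtension v) (ξ : Eucl n) w := by
  simp [sphereGrad, gradient]

/-- The gradient is tangential: the extension is constant along rays. -/
theorem inner_sphereGrad_self {v : USphere n → ℝ} (ξ : USphere n) :
    inner ℝ (sphereGrad v ξ) (ξ : Eucl n) = 0 := by
  rw [inner_sphereGrad]
  by_cases h : DifferentiableAt ℝ (radialExtension v) (ξ : Eucl n)
  · have hc : HasDerivAt (fun t : ℝ => t • (ξ : Eucl n)) (ξ : Eucl n) 1 := by
      simpa using (hasDerivAt_id (1 : ℝ)).smul_const (ξ : Eucl n)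
    have h1 : HasDerivAt (fun t : ℝ => radialExtension v (t • (ξ : Eucl n)))
        (fderiv ℝ (radialExtension v) (ξ : Eucl n) (ξ : Eucl n)) 1 := by
      have h' : HasFDerivAt (radialExtension v) (fderiv ℝ (radialExtension v) (ξ : Eucl n))
          ((1 : ℝ) • (ξ : Eucl n)) := by
        rw [one_smul]
        exact h.hasFDerivAt
      exact h'.comp_hasDerivAt (1 : ℝ) hc
    have h2 : HasDerivAt (fun t : ℝ => radialExtension v (t • (ξ : Eucl n))) 0 1 := by
      refine (hasDerivAt_const (1 : ℝ) (v ξ)).congr_of_eventuallyEq ?_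
      filter_upwards [lt_mem_nhds (zero_lt_one' ℝ)] with t ht
      exact radialExtension_smul v ξ ht
    exact h1.unique h2
  · simp [fderiv_zero_of_not_differentiableAt h]

theorem norm_sphereGrad_le {v : USphere n → ℝ} {L : NNReal} (hv : LipschitzWith L v)
    (ξ : USphere n) : ‖sphereGrad v ξ‖ ≤ 2 * L := by
  have : ‖sphereGrad v ξ‖ = ‖fderiv ℝ (radialExtension v) (ξ : Eucl n)‖ := by
    simp [sphereGrad, gradient]
  rw [this]
  refine norm_fderiv_le_of_lip' ℝ (by positivity) ?_
  filter_upwards [isOpen_ne.mem_nhds (sphere_coe_ne_zero ξ)] with y hy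
  rw [radialExtension_of_ne v hy, radialExtension_of_ne v (sphere_coe_ne_zero ξ)]
  have h1 := hv.dist_le_mul (sphereDir y hy) (sphereDir (ξ : Eucl n) (sphere_coe_ne_zero ξ))
  have h2 := norm_smul_sphereDir_sub_le (sphere_coe_ne_zero ξ) hy
  rw [norm_sphere_coe, one_mul, norm_sub_rev, dist_comm] at h2
  have hL : (0 : ℝ) ≤ L := L.2
  rw [← dist_eq_norm]
  nlinarith

/-- At a point of differentiability, the derivative of the extension at any positive multiple. -/
theorem fderiv_radialExtension_smul {v : USphere n → ℝ} (ξ : USphere n) {r : ℝ} (hr : 0 < r)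
    (h : DifferentiableAt ℝ (radialExtension v) (r • (ξ : Eucl n))) (w : Eucl n) :
    fderiv ℝ (radialExtension v) (r • (ξ : Eucl n)) w = r⁻¹ * inner ℝ (sphereGrad v ξ) w := by
  have h1 := (hasFDerivAt_radialExtension_smul hr h.hasFDerivAt).fderiv
  rw [inner_sphereGrad, h1]
  simp [hr.ne']

end SphereGradient

/-! ### Integration by parts on the sphere against polynomials -/

section SpherePolynomials

variable {n : ℕ}

/-- The polynomial function on Euclidean space defined by `p`. -/
noncomputable def polyFun (p : MvPolynomial (Fin n) ℝ) (x : Eucl n) : ℝ :=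
  MvPolynomial.eval (fun i => x i) p

@[simp] theorem polyFun_add (p q : MvPolynomial (Fin n) ℝ) (x : Eucl n) :
    polyFun (p + q) x = polyFun p x + polyFun q x := by simp [polyFun]

@[simp] theorem polyFun_sub (p q : MvPolynomial (Fin n) ℝ) (x : Eucl n) :
    polyFun (p - q) x = polyFun p x - polyFun q x := by simp [polyFun]

@[simp] theorem polyFun_mul (p q : MvPolynomial (Fin n) ℝ) (x : Eucl n) :
    polyFun (p * q) x = polyFun p x * polyFun q x := by simp [polyFun]

@[simp] theorem polyFun_smul (c : ℝ) (p : MvPolynomial (Fin n) ℝ) (x : Eucl n) :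
    polyFun (c • p) x = c * polyFun p x := by simp [polyFun]

@[simp] theorem polyFun_C (c : ℝ) (x : Eucl n) : polyFun (MvPolynomial.C c) x = c := by
  simp [polyFun]

@[simp] theorem polyFun_one (x : Eucl n) : polyFun (1 : MvPolynomial (Fin n) ℝ) x = 1 := by
  simp [polyFun]

@[simp] theorem polyFun_X (i : Fin n) (x : Eucl n) : polyFun (MvPolynomial.X i) x = x i := by
  simp [polyFun]

@[simp] theorem polyFun_sum {ι : Type*} (s : Finset ι) (p : ι → MvPolynomial (Fin n) ℝ)
    (x : Eucl n) : polyFun (∑ i ∈ s, p i) x = ∑ i ∈ s, polyFun (p i) x := by simp [polyFun]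

theorem polyFun_smul_arg {p : MvPolynomial (Fin n) ℝ} {d : ℕ} (hp : p.IsHomogeneous d) (r : ℝ)
    (x : Eucl n) : polyFun p (r • x) = r ^ d * polyFun p x := by
  simp only [polyFun, MvPolynomial.eval_eq, Finset.mul_sum]
  refine Finset.sum_congr rfl fun s hs => ?_
  simp only [PiLp.smul_apply, smul_eq_mul, mul_pow, Finset.prod_mul_distrib,
    Finset.prod_pow_eq_pow_sum, ← hp.degree_eq_sum_deg_support hs]
  ring

theorem contDiff_polyFun (p : MvPolynomial (Fin n) ℝ) {m : WithTop ℕ∞} :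
    ContDiff ℝ m (polyFun p) := by
  induction p using MvPolynomial.induction_on with
  | C a => simpa [funext (polyFun_C a)] using contDiff_const
  | add p q hp hq =>
    rw [show polyFun (p + q) = fun x => polyFun p x + polyFun q x from funext (polyFun_add p q)]
    exact hp.add hq
  | mul_X p i hp =>
    rw [show polyFun (p * MvPolynomial.X i) = fun x => polyFun p x * x i from
      funext fun x => by simp]
    exact hp.mul (EuclideanSpace.proj (𝕜 := ℝ) i).contDiff

theorem continuous_polyFun (p : MvPolynomial (Fin n) ℝ) : Continuous (polyFun p) :=
  (contDiff_polyFun p (m := 0)).continuous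

theorem hasFDerivAt_polyFun (p : MvPolynomial (Fin n) ℝ) (x : Eucl n) :
    HasFDerivAt (polyFun p) (∑ i, polyFun (MvPolynomial.pderiv i p) x •
      (EuclideanSpace.proj i : Eucl n →L[ℝ] ℝ)) x := by
  induction p using MvPolynomial.induction_on with
  | C a =>
    rw [show polyFun (MvPolynomial.C a) = fun _ : Eucl n => a from funext (polyFun_C a)]
    refine (hasFDerivAt_const a x).congr_fderiv ?_
    simp [polyFun]
  | add p q hp hq =>
    rw [show polyFun (p + q) = fun x => polyFun p x + polyFun q x from funext (polyFun_add p q)]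
    refine (hp.add hq).congr_fderiv ?_
    simp [add_smul, Finset.sum_add_distrib]
  | mul_X p j hp =>
    rw [show polyFun (p * MvPolynomial.X j) = fun x => polyFun p x * x j from
      funext fun x => by simp]
    refine (hp.mul (EuclideanSpace.proj (𝕜 := ℝ) j).hasFDerivAt).congr_fderiv ?_
    ext w
    have h1 : ∀ i, polyFun (MvPolynomial.pderiv i (p * MvPolynomial.X j)) x * w i
        = x j * (polyFun (MvPolynomial.pderiv i p) x * w i)
          + if i = j then polyFun p x * w j else 0 := fun i => by
      rcases eq_or_ne i j with rfl | hij
      · simp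
        ring
      · simp [MvPolynomial.pderiv_X_of_ne hij.symm, hij]
        ring
    have hproj : ∀ (i : Fin n) (y : Eucl n), (EuclideanSpace.proj i : Eucl n →L[ℝ] ℝ) y = y i :=
      fun _ _ => rfl
    simp only [add_apply, smul_apply, sum_apply, hproj, smul_eq_mul, h1, Finset.sum_add_distrib,
      Finset.mul_sum, Finset.sum_ite_eq', Finset.mem_univ, if_true]
    rw [add_comm]

/-- Divergence theorem on the sphere for a tangential vector field with homogeneous polynomial
components, against a Lipschitz function. It is obtained by integrating by parts in the whole
space, with a radial cutoff: as the field is tangential, the cutoff is not differentiated. -/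
theorem integral_sphereGrad_mul_polyFun (hn : 0 < n) {v : USphere n → ℝ} {L : NNReal}
    (hv : LipschitzWith L v) {d : ℕ} (P : Fin n → MvPolynomial (Fin n) ℝ)
    (hP : ∀ i, (P i).IsHomogeneous (d + 1)) (hX : ∑ i, MvPolynomial.X i * P i = 0) :
    ∫ ξ, ∑ i, sphereGrad v ξ i * polyFun (P i) (ξ : Eucl n) ∂(sphereMeasure n)
      = - ∫ ξ, v ξ * polyFun (∑ i, MvPolynomial.pderiv i (P i)) (ξ : Eucl n)
        ∂(sphereMeasure n) := by
  obtain ⟨C, hC⟩ := exists_lipschitzWith_coneExtension hv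
  set χ : ℝ → ℝ := fun s => Real.smoothTransition (2 - s) with hχ
  have hχs : ContDiff ℝ (⊤ : ℕ∞) χ := Real.smoothTransition.contDiff.comp (by fun_prop)
  have hX' : ∀ x : Eucl n, ∑ i, x i * polyFun (P i) x = 0 := fun x => by
    have := congrArg (fun q => polyFun q x) hX
    simpa [polyFun] using this
  set g : Fin n → Eucl n → ℝ := fun i x => χ (‖x‖ ^ 2) * polyFun (P i) x with hg
  have hgs : ∀ i, ContDiff ℝ (⊤ : ℕ∞) (g i) := fun i =>
    (hχs.comp (contDiff_norm_sq ℝ)).mul (contDiff_polyFun _)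
  have hgc : ∀ i, HasCompactSupport (g i) := fun i => by
    refine HasCompactSupport.intro (isCompact_closedBall (0 : Eucl n) 2) fun x hx => ?_
    have hx : 2 < ‖x‖ := by simpa using hx
    have : χ (‖x‖ ^ 2) = 0 := Real.smoothTransition.zero_of_nonpos (by nlinarith)
    simp [hg, this]
  have key : ∀ i, ∫ x, lineDeriv ℝ (coneExtension v) x (EuclideanSpace.single i 1) * g i x
      = ∫ x, lineDeriv ℝ (g i) x (-EuclideanSpace.single i 1) * coneExtension v x := fun i => by
    obtain ⟨D, hD⟩ := (hgs i).lipschitzWith_of_hasCompactSupport (hgc i) (by simp)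
    exact hC.integral_lineDeriv_mul_eq hD (hgc i) _
  have int1 : ∀ i, Integrable fun x =>
      lineDeriv ℝ (coneExtension v) x (EuclideanSpace.single i 1) * g i x := fun i => by
    have hgi : Integrable (g i) := (hgs i).continuous.integrable_of_hasCompactSupport (hgc i)
    refine hgi.bdd_mul (c := C * ‖(EuclideanSpace.single i 1 : Eucl n)‖)
      (measurable_lineDeriv hC.continuous).aestronglyMeasurable
      (Eventually.of_forall fun x => norm_lineDeriv_le_of_lipschitz ℝ hC)
  have dg : ∀ i x, lineDeriv ℝ (g i) x (-EuclideanSpace.single i 1)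
      = -(χ (‖x‖ ^ 2) * polyFun (MvPolynomial.pderiv i (P i)) x
        + 2 * deriv χ (‖x‖ ^ 2) * (x i * polyFun (P i) x)) := fun i x => by
    have h0 : HasDerivAt χ (deriv χ (‖x‖ ^ 2)) (‖x‖ ^ 2) :=
      (hχs.differentiable (by simp) (‖x‖ ^ 2)).hasDerivAt
    have h1 := h0.comp_hasFDerivAt (f := fun y : Eucl n => ‖y‖ ^ 2) x (hasFDerivAt_id x).norm_sq
    have h2 : HasFDerivAt (g i) _ x := h1.mul (hasFDerivAt_polyFun (P i) x)
    rw [h2.hasLineDerivAt _ |>.lineDeriv]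
    simp [EuclideanSpace.inner_single_right]
    ring
  have int2 : ∀ i, Integrable fun x =>
      lineDeriv ℝ (g i) x (-EuclideanSpace.single i 1) * coneExtension v x := fun i => by
    refine Continuous.integrable_of_hasCompactSupport ?_ ?_
    · refine Continuous.mul ?_ hC.continuous
      simp only [dg]
      have c1 : Continuous χ := hχs.continuous
      have c2 : Continuous (deriv χ) := hχs.continuous_deriv (by simp)
      have c3 := continuous_polyFun (MvPolynomial.pderiv i (P i))
      have c4 := continuous_polyFun (P i)
      fun_prop
    · refine HasCompactSupport.mul_right ?_
      refine (hgc i).mono' fun x hx => ?_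
      by_contra h
      refine hx ?_
      have : g i =ᶠ[𝓝 x] 0 := notMem_tsupport_iff_eventuallyEq.1 h
      have h3 : HasLineDerivAt ℝ (g i) 0 x (-EuclideanSpace.single i 1) :=
        ((hasFDerivAt_const (0 : ℝ) x).congr_of_eventuallyEq this).hasLineDerivAt _
      exact h3.lineDeriv
  have hsum := Finset.sum_congr (rfl : (Finset.univ : Finset (Fin n)) = _) fun i _ => key i
  rw [← integral_finsetSum _ fun i _ => int1 i, ← integral_finsetSum _ fun i _ => int2 i] at hsum
  have hne : ∀ᵐ x : Eucl n, x ≠ 0 := by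
    have := nontrivial_eucl hn
    exact volume.ae_ne 0
  have e1 : ∫ x, ∑ i, lineDeriv ℝ (coneExtension v) x (EuclideanSpace.single i 1) * g i x
      = ∫ x : Eucl n, radialExtension
        (fun ξ => ∑ i, sphereGrad v ξ i * polyFun (P i) (ξ : Eucl n)) x
        * (fun r => χ (r ^ 2) * r ^ (d + 1)) ‖x‖ := by
    refine integral_congr_ae ?_
    filter_upwards [hne, ae_differentiableAt_radialExtension hv] with x hx hdiff
    have hd := hdiff hx
    have hr : 0 < ‖x‖ := norm_pos_iff.2 hx
    set ξ := sphereDir x hx with hξ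
    have hxξ : ‖x‖ • (ξ : Eucl n) = x := norm_smul_sphereDir x hx
    have h1 : HasFDerivAt (coneExtension v) _ x :=
      (hasFDerivAt_norm_of_ne hx).mul hd.hasFDerivAt
    have h2 : ∀ i, lineDeriv ℝ (coneExtension v) x (EuclideanSpace.single i 1)
        = sphereGrad v ξ i + radialExtension v x * ‖x‖⁻¹ * x i := fun i => by
      have h3 := fderiv_radialExtension_smul ξ hr (by rw [hxξ]; exact hd)
        (EuclideanSpace.single i 1)
      rw [hxξ] at h3
      rw [(h1.hasLineDerivAt _).lineDeriv]
      simp [h3, EuclideanSpace.inner_single_right, hr.ne']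
      ring
    have h4 : ∀ i, polyFun (P i) x = ‖x‖ ^ (d + 1) * polyFun (P i) (ξ : Eucl n) := fun i => by
      conv_lhs => rw [← hxξ]
      exact polyFun_smul_arg (hP i) _ _
    rw [radialExtension_of_ne _ hx]
    calc ∑ i, lineDeriv ℝ (coneExtension v) x (EuclideanSpace.single i 1) * g i x
        = ∑ i, (sphereGrad v ξ i * polyFun (P i) (ξ : Eucl n) * (χ (‖x‖ ^ 2) * ‖x‖ ^ (d + 1))
          + χ (‖x‖ ^ 2) * radialExtension v x * ‖x‖⁻¹ * (x i * polyFun (P i) x)) := by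
          refine Finset.sum_congr rfl fun i _ => ?_
          simp only [h2, hg]
          rw [add_mul, h4]
          ring
      _ = _ := by
          rw [Finset.sum_add_distrib, ← Finset.mul_sum, hX', ← Finset.sum_mul]
          ring
  have e2 : ∫ x, ∑ i, lineDeriv ℝ (g i) x (-EuclideanSpace.single i 1) * coneExtension v x
      = ∫ x : Eucl n, radialExtension (fun ξ => -(v ξ *
          polyFun (∑ i, MvPolynomial.pderiv i (P i)) (ξ : Eucl n))) x
        * (fun r => χ (r ^ 2) * r ^ (d + 1)) ‖x‖ := by
    refine integral_congr_ae ?_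
    filter_upwards [hne] with x hx
    set ξ := sphereDir x hx with hξ
    have hxξ : ‖x‖ • (ξ : Eucl n) = x := norm_smul_sphereDir x hx
    have h4 : ∀ i, polyFun (MvPolynomial.pderiv i (P i)) x
        = ‖x‖ ^ d * polyFun (MvPolynomial.pderiv i (P i)) (ξ : Eucl n) := fun i => by
      conv_lhs => rw [← hxξ]
      exact polyFun_smul_arg (by simpa using (hP i).pderiv (i := i)) _ _
    rw [radialExtension_of_ne _ hx]
    calc ∑ i, lineDeriv ℝ (g i) x (-EuclideanSpace.single i 1) * coneExtension v x
        = ∑ i, (-(v ξ * polyFun (MvPolynomial.pderiv i (P i)) (ξ : Eucl n))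
            * (χ (‖x‖ ^ 2) * ‖x‖ ^ (d + 1))
          + -(2 * deriv χ (‖x‖ ^ 2) * coneExtension v x) * (x i * polyFun (P i) x)) := by
          refine Finset.sum_congr rfl fun i _ => ?_
          rw [dg, h4, coneExtension, radialExtension_of_ne _ hx]
          ring
      _ = _ := by
          rw [Finset.sum_add_distrib, ← Finset.mul_sum, hX', ← Finset.sum_mul, polyFun_sum,
            Finset.sum_neg_distrib, ← Finset.mul_sum]
          ring
  have h := integral_polar_mul hn (fun r => χ (r ^ 2) * r ^ (d + 1))
  rw [e1, e2, h, h, integral_neg] at hsum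
  refine mul_right_cancel₀ (ne_of_gt ?_) hsum
  have hc : Continuous fun r : ℝ => r ^ (n - 1) * (χ (r ^ 2) * r ^ (d + 1)) := by
    have := hχs.continuous
    fun_prop
  have hχ0 : ∀ s, 0 ≤ χ s := fun s => Real.smoothTransition.nonneg _
  rw [setIntegral_pos_iff_support_of_nonneg_ae]
  · refine lt_of_lt_of_le ?_ (measure_mono (s := Ioo 0 1) fun r hr => ⟨?_, hr.1⟩)
    · simp
    · have h1 : 0 < χ (r ^ 2) := Real.smoothTransition.pos_of_pos (by nlinarith [hr.1, hr.2])
      have h2 := hr.1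
      exact (by positivity : 0 < r ^ (n - 1) * (χ (r ^ 2) * r ^ (d + 1))).ne'
  · filter_upwards [ae_restrict_mem measurableSet_Ioi] with r hr
    have h2 : 0 < r := hr
    have := hχ0 (r ^ 2)
    simp only [Pi.zero_apply]
    positivity
  · refine (hc.integrable_of_hasCompactSupport ?_).integrableOn
    refine HasCompactSupport.intro (isCompact_closedBall (0 : ℝ) 2) fun r hr => ?_
    have hr : 2 < |r| := by simpa using hr
    have : χ (r ^ 2) = 0 := Real.smoothTransition.zero_of_nonpos (by
      rw [← sq_abs]; nlinarith)
    simp [this]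

end SpherePolynomials

/-! ### The second eigenvalue of the sphere -/

section SpherePoincare

open MvPolynomial

variable {n : ℕ}

/-- The Euler operator `∑ xᵢ ∂ᵢ` on polynomials. -/
noncomputable def eulerOp (n : ℕ) : MvPolynomial (Fin n) ℝ →ₗ[ℝ] MvPolynomial (Fin n) ℝ :=
  ∑ i, LinearMap.mulLeft ℝ (X i) ∘ₗ (pderiv i : Derivation ℝ _ _).toLinearMap

/-- The Laplacian on polynomials. -/
noncomputable def laplaceOp (n : ℕ) : MvPolynomial (Fin n) ℝ →ₗ[ℝ] MvPolynomial (Fin n) ℝ :=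
  ∑ i, (pderiv i : Derivation ℝ (MvPolynomial (Fin n) ℝ) _).toLinearMap
    ∘ₗ (pderiv i : Derivation ℝ _ _).toLinearMap

/-- Minus the Laplace–Beltrami operator of the unit sphere, acting on polynomials: the restriction
to the sphere of `sphereOp n p` is `-Δ` of the restriction of `p`. -/
noncomputable def sphereOp (n : ℕ) : MvPolynomial (Fin n) ℝ →ₗ[ℝ] MvPolynomial (Fin n) ℝ :=
  eulerOp n ∘ₗ eulerOp n + ((n : ℝ) - 2) • eulerOp n - laplaceOp n

theorem eulerOp_apply (p : MvPolynomial (Fin n) ℝ) :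
    eulerOp n p = ∑ i, X i * pderiv i p := by simp [eulerOp]

theorem laplaceOp_apply (p : MvPolynomial (Fin n) ℝ) :
    laplaceOp n p = ∑ i, pderiv i (pderiv i p) := by simp [laplaceOp]

theorem sphereOp_of_isHomogeneous {p : MvPolynomial (Fin n) ℝ} {k : ℕ} (hp : p.IsHomogeneous k) :
    sphereOp n p = ((k : ℝ) * (k + n - 2)) • p - laplaceOp n p := by
  have h : eulerOp n p = (k : ℝ) • p := by
    rw [eulerOp_apply, hp.sum_X_mul_pderiv, Nat.cast_smul_eq_nsmul]
  simp only [sphereOp, LinearMap.sub_apply, LinearMap.add_apply, LinearMap.comp_apply,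
    LinearMap.smul_apply, h, map_smul, smul_smul, ← add_smul]
  congr 2
  ring

theorem IsHomogeneous.laplaceOp_mem {p : MvPolynomial (Fin n) ℝ} {k : ℕ}
    (hp : p.IsHomogeneous k) : laplaceOp n p ∈ restrictTotalDegree (Fin n) ℝ (k - 1) := by
  rw [laplaceOp_apply]
  refine Submodule.sum_mem _ fun i _ => ?_
  rw [mem_restrictTotalDegree]
  exact ((hp.pderiv (i := i)).pderiv (i := i)).totalDegree_le.trans (by omega)

theorem restrictTotalDegree_mono {M N : ℕ} (h : M ≤ N) :
    restrictTotalDegree (Fin n) ℝ M ≤ restrictTotalDegree (Fin n) ℝ N := fun p hp => by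
  rw [mem_restrictTotalDegree] at hp ⊢
  omega

/-- An induction principle: a property of the polynomials of degree at most `N` can be checked on
homogeneous polynomials. -/
theorem restrictTotalDegree_induction {N : ℕ} {M : Type*} [AddCommGroup M] [Module ℝ M]
    (S : Submodule ℝ M) (f : MvPolynomial (Fin n) ℝ →ₗ[ℝ] M)
    (h : ∀ k ≤ N, ∀ p : MvPolynomial (Fin n) ℝ, p.IsHomogeneous k → f p ∈ S)
    {p : MvPolynomial (Fin n) ℝ} (hp : p ∈ restrictTotalDegree (Fin n) ℝ N) : f p ∈ S := by
  rw [mem_restrictTotalDegree] at hp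
  rw [← sum_homogeneousComponent p, map_sum]
  refine Submodule.sum_mem _ fun k hk => h k ?_ _ (homogeneousComponent_isHomogeneous k p)
  rw [Finset.mem_range] at hk
  omega

theorem sphereOp_mem {N : ℕ} {p : MvPolynomial (Fin n) ℝ}
    (hp : p ∈ restrictTotalDegree (Fin n) ℝ N) :
    sphereOp n p ∈ restrictTotalDegree (Fin n) ℝ N := by
  refine restrictTotalDegree_induction _ (sphereOp n) (fun k hk q hq => ?_) hp
  rw [sphereOp_of_isHomogeneous hq]
  refine Submodule.sub_mem _ (Submodule.smul_mem _ _ ?_)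
    (restrictTotalDegree_mono (by omega) (IsHomogeneous.laplaceOp_mem hq))
  rw [mem_restrictTotalDegree]
  exact hq.totalDegree_le.trans hk

/-- Modulo polynomials of lower degree, the operator is multiplication by the eigenvalue. -/
theorem sphereOp_sub_smul_mem {N : ℕ} {p : MvPolynomial (Fin n) ℝ}
    (hp : p ∈ restrictTotalDegree (Fin n) ℝ (N + 1)) :
    sphereOp n p - (((N + 1 : ℕ) : ℝ) * ((N + 1 : ℕ) + n - 2)) • p
      ∈ restrictTotalDegree (Fin n) ℝ N := by
  refine restrictTotalDegree_induction _
    (sphereOp n - (((N + 1 : ℕ) : ℝ) * ((N + 1 : ℕ) + n - 2)) • LinearMap.id)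
    (fun k hk q hq => ?_) hp
  simp only [LinearMap.sub_apply, LinearMap.smul_apply, LinearMap.id_apply]
  rcases hk.lt_or_eq with hk | rfl
  · have hq' : q ∈ restrictTotalDegree (Fin n) ℝ N := by
      rw [mem_restrictTotalDegree]
      exact hq.totalDegree_le.trans (by omega)
    exact Submodule.sub_mem _ (sphereOp_mem hq') (Submodule.smul_mem _ _ hq')
  · rw [sphereOp_of_isHomogeneous hq, sub_sub_cancel_left]
    exact Submodule.neg_mem _ (IsHomogeneous.laplaceOp_mem hq)

/-- A linear map that vanishes at `1` and at the coordinates vanishes on affine polynomials. -/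
theorem map_eq_zero_of_mem_restrictTotalDegree_one {M : Type*} [AddCommGroup M] [Module ℝ M]
    (f : MvPolynomial (Fin n) ℝ →ₗ[ℝ] M) (h1 : f 1 = 0) (hX : ∀ i, f (X i) = 0)
    {p : MvPolynomial (Fin n) ℝ} (hp : p ∈ restrictTotalDegree (Fin n) ℝ 1) : f p = 0 := by
  rw [mem_restrictTotalDegree] at hp
  rw [p.as_sum, map_sum]
  refine Finset.sum_eq_zero fun s hs => ?_
  have hdeg : (s.sum fun _ e => e) ≤ 1 := (le_totalDegree hs).trans hp
  have hm : monomial s (coeff s p) = coeff s p • monomial s (1 : ℝ) := by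
    rw [smul_monomial, smul_eq_mul, mul_one]
  rw [hm, map_smul]
  rcases Nat.le_one_iff_eq_zero_or_eq_one.1 hdeg with h0 | h0
  · have : s = 0 := by
      ext i
      by_contra hi
      have := Finset.single_le_sum (f := fun i => s i) (fun _ _ => Nat.zero_le _)
        (Finsupp.mem_support_iff.2 hi)
      rw [Finsupp.sum] at h0
      have h3 : s i ≠ 0 := hi
      omega
    rw [this, show monomial (0 : Fin n →₀ ℕ) (1 : ℝ) = 1 from rfl, h1, smul_zero]
  · obtain ⟨i, rfl⟩ := (Finsupp.sum_eq_one_iff s).1 h0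
    rw [show monomial (Finsupp.single i 1) (1 : ℝ) = X i from rfl, hX, smul_zero]

theorem integrable_sphereGrad_mul {v : USphere n → ℝ} {L : NNReal} (hv : LipschitzWith L v)
    (i : Fin n) {g : USphere n → ℝ} (hg : Continuous g) :
    Integrable (fun ξ => sphereGrad v ξ i * g ξ) (sphereMeasure n) := by
  have hgi : Integrable g (sphereMeasure n) :=
    hg.integrable_of_hasCompactSupport (HasCompactSupport.of_compactSpace g)
  refine hgi.bdd_mul (c := 2 * L) ?_ (Eventually.of_forall fun ξ => ?_)
  · exact ((EuclideanSpace.proj (𝕜 := ℝ) i).continuous.measurable.comp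
      (measurable_sphereGrad v)).aestronglyMeasurable
  · exact (PiLp.norm_apply_le _ i).trans (norm_sphereGrad_le hv ξ)

/-- Green's formula on the sphere, between a Lipschitz function and a polynomial. -/
theorem integral_sphereGrad_mul_pderiv (hn : 0 < n) {v : USphere n → ℝ} {L : NNReal}
    (hv : LipschitzWith L v) (p : MvPolynomial (Fin n) ℝ) :
    ∫ ξ, ∑ i, sphereGrad v ξ i * polyFun (pderiv i p) (ξ : Eucl n) ∂(sphereMeasure n)
      = ∫ ξ, v ξ * polyFun (sphereOp n p) (ξ : Eucl n) ∂(sphereMeasure n) := by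
  have hc : ∀ q : MvPolynomial (Fin n) ℝ, Continuous fun ξ : USphere n => polyFun q (ξ : Eucl n) :=
    fun q => (continuous_polyFun q).comp continuous_subtype_val
  have hi1 : ∀ q : MvPolynomial (Fin n) ℝ, Integrable
      (fun ξ => ∑ i, sphereGrad v ξ i * polyFun (pderiv i q) (ξ : Eucl n)) (sphereMeasure n) :=
    fun q => integrable_finsetSum _ fun i _ => integrable_sphereGrad_mul hv i (hc _)
  have hi2 : ∀ q : MvPolynomial (Fin n) ℝ, Integrable
      (fun ξ => v ξ * polyFun q (ξ : Eucl n)) (sphereMeasure n) := fun q =>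
    (hv.continuous.mul (hc q)).integrable_of_hasCompactSupport (HasCompactSupport.of_compactSpace _)
  let Φ : MvPolynomial (Fin n) ℝ →ₗ[ℝ] ℝ :=
    { toFun := fun q =>
        ∫ ξ, ∑ i, sphereGrad v ξ i * polyFun (pderiv i q) (ξ : Eucl n) ∂(sphereMeasure n)
          - ∫ ξ, v ξ * polyFun (sphereOp n q) (ξ : Eucl n) ∂(sphereMeasure n)
      map_add' := fun q r => by
        simp only [map_add, polyFun_add, mul_add, Finset.sum_add_distrib]
        rw [integral_add (hi1 q) (hi1 r), integral_add (hi2 _) (hi2 _)]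
        ring
      map_smul' := fun c q => by
        simp only [Derivation.map_smul, map_smul, polyFun_smul, mul_left_comm _ c, ← Finset.mul_sum,
          integral_const_mul, RingHom.id_apply, smul_eq_mul]
        ring }
  suffices h : Φ p = 0 from sub_eq_zero.1 h
  have := restrictTotalDegree_induction (N := p.totalDegree) (⊥ : Submodule ℝ ℝ) Φ
    (fun k _ q hq => ?_) (p := p) ((mem_restrictTotalDegree _ _ _).2 le_rfl)
  · simpa using this
  rw [Submodule.mem_bot]
  refine sub_eq_zero.2 ?_
  set N2 : MvPolynomial (Fin n) ℝ := ∑ i, X i ^ 2 with hN2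
  have hN2h : N2.IsHomogeneous 2 := by
    refine IsHomogeneous.sum _ _ _ fun i _ => ?_
    simpa using (isHomogeneous_X ℝ i).pow 2
  have heul := hq.sum_X_mul_pderiv
  have hN2s : ∀ ξ : USphere n, polyFun N2 (ξ : Eucl n) = 1 := fun ξ => by
    have h1 := EuclideanSpace.real_norm_sq_eq (ξ : Eucl n)
    rw [norm_sphere_coe] at h1
    rw [hN2, polyFun_sum]
    refine Eq.trans ?_ ((one_pow 2).symm.trans h1).symm
    simp [pow_two]
  have hdiv := integral_sphereGrad_mul_polyFun hn hv (d := k)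
    (fun i => N2 * pderiv i q - (k : ℝ) • (q * X i)) (fun i => ?_) ?_
  · have e1 : ∀ ξ : USphere n, ∑ i, sphereGrad v ξ i * polyFun (pderiv i q) (ξ : Eucl n)
        = ∑ i, sphereGrad v ξ i * polyFun (N2 * pderiv i q - (k : ℝ) • (q * X i)) (ξ : Eucl n) :=
      fun ξ => by
        have h0 := inner_sphereGrad_self (v := v) ξ
        rw [PiLp.inner_apply] at h0
        have h0' : ∑ i, sphereGrad v ξ i * (ξ : Eucl n) i = 0 := by
          rw [← h0]
          exact Finset.sum_congr rfl fun i _ => by simp [mul_comm]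
        have : ∀ i, sphereGrad v ξ i * polyFun (N2 * pderiv i q - (k : ℝ) • (q * X i)) (ξ : Eucl n)
            = sphereGrad v ξ i * polyFun (pderiv i q) (ξ : Eucl n)
              - k * polyFun q (ξ : Eucl n) * (sphereGrad v ξ i * (ξ : Eucl n) i) := fun i => by
          simp [hN2s]
          ring
        simp only [this, Finset.sum_sub_distrib, ← Finset.mul_sum, h0', mul_zero, sub_zero]
    simp only [e1]
    rw [hdiv, ← integral_neg]
    refine integral_congr_ae (Eventually.of_forall fun ξ => ?_)
    have e2 : ∑ i, pderiv i (N2 * pderiv i q - (k : ℝ) • (q * X i))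
        = N2 * laplaceOp n q - ((k : ℝ) * (k + n - 2)) • q := by
      have h1 : ∀ i, pderiv i N2 = 2 * X i := fun i => by
        simp only [hN2, map_sum, Derivation.leibniz_pow, pderiv_X]
        rw [Finset.sum_eq_single i]
        · simp
        · intro j _ hj
          simp [hj.symm]
        · simp
      have h2 : ∀ i, pderiv i (N2 * pderiv i q - (k : ℝ) • (q * X i))
          = N2 * pderiv i (pderiv i q) + 2 * (X i * pderiv i q)
            - (k : ℝ) • (X i * pderiv i q) - (k : ℝ) • q := fun i => by
        rw [map_sub, Derivation.map_smul, Derivation.leibniz, Derivation.leibniz, h1, pderiv_X_self]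
        simp only [smul_eq_mul, mul_one, smul_eq_C_mul]
        ring
      simp only [h2, Finset.sum_sub_distrib, Finset.sum_add_distrib, ← Finset.mul_sum,
        ← Finset.smul_sum, heul, laplaceOp_apply, Finset.sum_const, Finset.card_univ,
        Fintype.card_fin]
      simp only [← Nat.cast_smul_eq_nsmul ℝ, smul_smul, mul_smul_comm, two_mul]
      module
    simp only [e2, sphereOp_of_isHomogeneous hq, polyFun_sub, polyFun_mul, hN2s, polyFun_smul]
    ring
  · refine IsHomogeneous.sub ?_ ?_
    · rcases k with _ | k
      · have : pderiv i q = 0 := by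
          rw [totalDegree_eq_zero_iff_eq_C.1 (Nat.le_zero.1 hq.totalDegree_le), pderiv_C]
        rw [this, mul_zero]
        exact isHomogeneous_zero _ _ _
      · have := hN2h.mul (hq.pderiv (i := i))
        rwa [show 2 + (k + 1 - 1) = k + 1 + 1 by omega] at this
    · rw [smul_eq_C_mul]
      exact (hq.mul (isHomogeneous_X ℝ i)).C_mul _
  · have : ∀ i, X i * (N2 * pderiv i q - (k : ℝ) • (q * X i))
        = N2 * (X i * pderiv i q) - (k : ℝ) • (X i ^ 2 * q) := fun i => by
      rw [mul_sub, mul_smul_comm]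
      ring_nf
    simp only [this, Finset.sum_sub_distrib, ← Finset.mul_sum, heul, ← Finset.smul_sum,
      ← Finset.sum_mul]
    rw [← hN2, ← Nat.cast_smul_eq_nsmul ℝ, mul_smul_comm, sub_self]

end SpherePoincare

/-! ### The Poincaré inequality on the sphere -/

section SpherePoincareInequality

open MvPolynomial

variable {n : ℕ}

theorem continuous_polyFun_sphere (p : MvPolynomial (Fin n) ℝ) :
    Continuous fun ξ : USphere n => polyFun p (ξ : Eucl n) :=
  (continuous_polyFun p).comp continuous_subtype_val

/-- Restriction of polynomials to the unit sphere, as an algebra homomorphism to the continuous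
functions. -/
noncomputable def polySphere (n : ℕ) : MvPolynomial (Fin n) ℝ →ₐ[ℝ] C(USphere n, ℝ) where
  toFun p := ⟨fun ξ => polyFun p (ξ : Eucl n), continuous_polyFun_sphere p⟩
  map_one' := by ext; simp
  map_mul' p q := by ext; simp
  map_zero' := by ext; simp [polyFun]
  map_add' p q := by ext; simp
  commutes' c := by ext; simp [algebraMap_eq]

theorem polySphere_apply (p : MvPolynomial (Fin n) ℝ) (ξ : USphere n) :
    polySphere n p ξ = polyFun p (ξ : Eucl n) := rfl

/-- Restriction of polynomials to the unit sphere, as elements of `L²(σ)`. -/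
noncomputable def polyL2 (n : ℕ) : MvPolynomial (Fin n) ℝ →ₗ[ℝ] Lp ℝ 2 (sphereMeasure n) :=
  (ContinuousMap.toLp 2 (sphereMeasure n) ℝ).toLinearMap ∘ₗ (polySphere n).toLinearMap

theorem inner_toLp_polyL2 (v : C(USphere n, ℝ)) (p : MvPolynomial (Fin n) ℝ) :
    inner ℝ (ContinuousMap.toLp 2 (sphereMeasure n) ℝ v) (polyL2 n p)
      = ∫ ξ, v ξ * polyFun p (ξ : Eucl n) ∂(sphereMeasure n) := by
  refine (ContinuousMap.inner_toLp (sphereMeasure n) v (polySphere n p)).trans ?_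
  simp [polySphere_apply, mul_comm]

theorem inner_polyL2 (p q : MvPolynomial (Fin n) ℝ) :
    inner ℝ (polyL2 n p) (polyL2 n q)
      = ∫ ξ : USphere n, polyFun p (ξ : Eucl n) * polyFun q (ξ : Eucl n) ∂(sphereMeasure n) :=
  inner_toLp_polyL2 (polySphere n p) q

theorem exists_lipschitzWith_polyFun (p : MvPolynomial (Fin n) ℝ) :
    ∃ L, LipschitzWith L fun ξ : USphere n => polyFun p (ξ : Eucl n) := by
  obtain ⟨L, hL⟩ := (contDiff_polyFun p (m := 1)).contDiffOn.exists_lipschitzOnWith one_ne_zero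
    (convex_closedBall (0 : Eucl n) 1) (isCompact_closedBall 0 1)
  refine ⟨L, fun ξ η => hL ?_ ?_⟩ <;> simp

/-- Pairing a tangential vector with the gradient of a polynomial on the sphere. -/
theorem inner_sphereGrad_polyFun (p : MvPolynomial (Fin n) ℝ) (ξ : USphere n) {w : Eucl n}
    (hw : inner ℝ (ξ : Eucl n) w = 0) :
    inner ℝ (sphereGrad (fun η : USphere n => polyFun p (η : Eucl n)) ξ) w
      = ∑ i, w i * polyFun (pderiv i p) (ξ : Eucl n) := by
  have h1 : HasFDerivAt (polyFun p) _ (‖(ξ : Eucl n)‖⁻¹ • (ξ : Eucl n)) :=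
    hasFDerivAt_polyFun p _
  have h2 : HasFDerivAt (polyFun p ∘ fun y : Eucl n => ‖y‖⁻¹ • y) _ (ξ : Eucl n) :=
    HasFDerivAt.comp (ξ : Eucl n) h1 (hasFDerivAt_inv_norm_smul ξ)
  have h3 := h2.congr_of_eventuallyEq
      (f₁ := radialExtension fun η : USphere n => polyFun p (η : Eucl n)) (by
        filter_upwards [isOpen_ne.mem_nhds (sphere_coe_ne_zero ξ)] with y hy
        rw [radialExtension_of_ne _ hy]
        rfl)
  rw [inner_sphereGrad, h3.fderiv]
  have hproj : ∀ (i : Fin n) (y : Eucl n), (EuclideanSpace.proj i : Eucl n →L[ℝ] ℝ) y = y i :=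
    fun _ _ => rfl
  simp [hw, hproj, mul_comm]

theorem integral_inner_sphereGrad_polyFun (hn : 0 < n) {v : USphere n → ℝ} {L : NNReal}
    (hv : LipschitzWith L v) (p : MvPolynomial (Fin n) ℝ) :
    ∫ ξ, inner ℝ (sphereGrad v ξ) (sphereGrad (fun η : USphere n => polyFun p (η : Eucl n)) ξ)
        ∂(sphereMeasure n)
      = inner ℝ (ContinuousMap.toLp 2 (sphereMeasure n) ℝ ⟨v, hv.continuous⟩)
        (polyL2 n (sphereOp n p)) := by
  rw [inner_toLp_polyL2]
  refine Eq.trans ?_ (integral_sphereGrad_mul_pderiv hn hv p)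
  refine integral_congr_ae (Eventually.of_forall fun ξ => ?_)
  have h := inner_sphereGrad_self (v := v) ξ
  rw [real_inner_comm] at h
  simp only
  rw [real_inner_comm, inner_sphereGrad_polyFun p ξ h]

/-- The operator is symmetric in `L²(σ)`. -/
theorem inner_sphereOp_comm (hn : 0 < n) (p q : MvPolynomial (Fin n) ℝ) :
    inner ℝ (polyL2 n p) (polyL2 n (sphereOp n q))
      = inner ℝ (polyL2 n (sphereOp n p)) (polyL2 n q) := by
  obtain ⟨L, hL⟩ := exists_lipschitzWith_polyFun p
  obtain ⟨L', hL'⟩ := exists_lipschitzWith_polyFun q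
  have h1 := integral_inner_sphereGrad_polyFun hn hL q
  have h2 := integral_inner_sphereGrad_polyFun hn hL' p
  rw [real_inner_comm (polyL2 n q)]
  refine h1.symm.trans (Eq.trans ?_ h2)
  simp only [real_inner_comm]

/-- Orthogonal projection in `L²(σ)` onto the polynomials of degree at most `N`. -/
theorem exists_polyL2_projection (N : ℕ) (u : Lp ℝ 2 (sphereMeasure n)) :
    ∃ p ∈ restrictTotalDegree (Fin n) ℝ N, ∀ q ∈ restrictTotalDegree (Fin n) ℝ N,
      inner ℝ (u - polyL2 n p) (polyL2 n q) = 0 := by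
  set W := (restrictTotalDegree (Fin n) ℝ N).map (polyL2 n) with hW
  obtain ⟨p, hp, hpu⟩ := (W.starProjection_apply_mem u)
  refine ⟨p, hp, fun q hq => ?_⟩
  rw [hpu]
  exact W.starProjection_inner_eq_zero u _ ⟨q, hq, rfl⟩

/-- The spectral gap for polynomials orthogonal to the affine ones, by induction on the degree:
the component orthogonal to lower degree is an eigenfunction, with eigenvalue `k (k + n - 2)`, which
is at least `2n` in degree `k ≥ 2`. -/
theorem two_mul_inner_le_inner_sphereOp (hn : 0 < n) (N : ℕ) :
    ∀ p ∈ restrictTotalDegree (Fin n) ℝ (N + 1),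
      (∀ q ∈ restrictTotalDegree (Fin n) ℝ 1, inner ℝ (polyL2 n p) (polyL2 n q) = 0) →
      2 * n * inner ℝ (polyL2 n p) (polyL2 n p)
        ≤ inner ℝ (polyL2 n p) (polyL2 n (sphereOp n p)) := by
  induction N with
  | zero =>
    intro p hp h
    have h0 : polyL2 n p = 0 := inner_self_eq_zero.1 (h p hp)
    simp [h0]
  | succ N ih =>
    intro p hp h
    obtain ⟨p', hp', horth⟩ := exists_polyL2_projection (N + 1) (polyL2 n p)
    set e := p - p' with he
    have hJe : polyL2 n p - polyL2 n p' = polyL2 n e := (map_sub _ _ _).symm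
    have hJp : polyL2 n p = polyL2 n p' + polyL2 n e := by rw [← hJe]; abel
    rw [hJe] at horth
    have hemem : e ∈ restrictTotalDegree (Fin n) ℝ (N + 1 + 1) :=
      Submodule.sub_mem _ hp (restrictTotalDegree_mono (by omega) hp')
    have hp'1 : ∀ q ∈ restrictTotalDegree (Fin n) ℝ 1,
        inner ℝ (polyL2 n p') (polyL2 n q) = 0 := fun q hq => by
      have h1 := h q hq
      rw [hJp, inner_add_left, horth q (restrictTotalDegree_mono (by omega) hq), add_zero] at h1
      exact h1
    have h1 := ih p' hp' hp'1
    have h2 : inner ℝ (polyL2 n e) (polyL2 n (sphereOp n p')) = 0 := horth _ (sphereOp_mem hp')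
    have h3 : inner ℝ (polyL2 n p') (polyL2 n (sphereOp n e)) = 0 := by
      rw [inner_sphereOp_comm hn, real_inner_comm, h2]
    have h4 : inner ℝ (polyL2 n e) (polyL2 n p') = 0 := horth _ hp'
    have h4' : inner ℝ (polyL2 n p') (polyL2 n e) = 0 := by rw [real_inner_comm, h4]
    set lam : ℝ := ((N + 1 + 1 : ℕ) : ℝ) * ((N + 1 + 1 : ℕ) + n - 2) with hlam
    have h5 : inner ℝ (polyL2 n e) (polyL2 n (sphereOp n e))
        = lam * inner ℝ (polyL2 n e) (polyL2 n e) := by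
      have h6 := horth _ (sphereOp_sub_smul_mem hemem)
      have h7 : polyL2 n (sphereOp n e - lam • e) = polyL2 n (sphereOp n e) - lam • polyL2 n e := by
        rw [map_sub, map_smul]
      rw [h7, inner_sub_right, inner_smul_right] at h6
      linarith
    have hlam2 : 2 * (n : ℝ) ≤ lam := by
      rw [hlam]
      push_cast
      have h7 : (0 : ℝ) ≤ N := N.cast_nonneg
      have h8 : (1 : ℝ) ≤ n := by exact_mod_cast hn
      nlinarith
    have h9 : sphereOp n p = sphereOp n p' + sphereOp n e := by
      rw [← map_add, he, add_sub_cancel]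
    rw [h9, map_add, hJp]
    simp only [inner_add_left, inner_add_right, h2, h3, h4, h4', h5]
    have h10 : 0 ≤ inner ℝ (polyL2 n e) (polyL2 n e) := real_inner_self_nonneg
    nlinarith

/-- Polynomials are dense in `L²(σ)`, by the Stone–Weierstrass theorem. -/
theorem exists_polyL2_near (v : C(USphere n, ℝ)) {δ : ℝ} (hδ : 0 < δ) :
    ∃ p, ‖ContinuousMap.toLp 2 (sphereMeasure n) ℝ v - polyL2 n p‖ < δ := by
  have hsep : (polySphere n).range.SeparatesPoints := by
    intro ξ η hne
    have : ∃ i, (ξ : Eucl n) i ≠ (η : Eucl n) i := by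
      by_contra! h
      exact hne (Subtype.ext (PiLp.ext h))
    obtain ⟨i, hi⟩ := this
    exact ⟨polySphere n (X i), ⟨polySphere n (X i), ⟨X i, rfl⟩, rfl⟩, by
      simpa [polySphere_apply] using hi⟩
  have htop := ContinuousMap.subalgebra_topologicalClosure_eq_top_of_separatesPoints _ hsep
  have hv : v ∈ closure ((polySphere n).range : Set C(USphere n, ℝ)) := by
    rw [← Subalgebra.topologicalClosure_coe, htop]
    trivial
  have hmem : ContinuousMap.toLp 2 (sphereMeasure n) ℝ v ∈
      closure (range (polyL2 n)) := by
    have := image_closure_subset_closure_image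
      (ContinuousMap.toLp 2 (sphereMeasure n) ℝ : C(USphere n, ℝ) →L[ℝ] _).continuous
      ⟨v, hv, rfl⟩
    refine closure_mono ?_ this
    rintro _ ⟨_, ⟨p, rfl⟩, rfl⟩
    exact ⟨p, rfl⟩
  obtain ⟨_, ⟨p, rfl⟩, hp⟩ := Metric.mem_closure_iff.1 hmem δ hδ
  exact ⟨p, by rwa [← dist_eq_norm]⟩

theorem integrable_of_continuous_sphere {F : Type*} [NormedAddCommGroup F] {g : USphere n → F}
    (hg : Continuous g) : Integrable g (sphereMeasure n) :=
  hg.integrable_of_hasCompactSupport (HasCompactSupport.of_compactSpace g)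

theorem integrable_inner_sphereGrad {v w : USphere n → ℝ} {L L' : NNReal}
    (hv : LipschitzWith L v) (hw : LipschitzWith L' w) :
    Integrable (fun ξ => inner ℝ (sphereGrad v ξ) (sphereGrad w ξ)) (sphereMeasure n) := by
  refine Integrable.of_bound (C := 2 * L * (2 * L'))
    ((measurable_sphereGrad v).inner (measurable_sphereGrad w)).aestronglyMeasurable
    (Eventually.of_forall fun ξ => (norm_inner_le_norm _ _).trans ?_)
  gcongr
  · exact norm_sphereGrad_le hv ξ
  · exact norm_sphereGrad_le hw ξ

/-- The Poincaré inequality with the second eigenvalue `2n`, for the part of a Lipschitz function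
orthogonal to a polynomial `p₁` of degree at most one. -/
theorem two_mul_sub_le_integral_norm_sphereGrad_sq (hn : 0 < n) {v : USphere n → ℝ} {L : NNReal}
    (hv : LipschitzWith L v) {p₁ : MvPolynomial (Fin n) ℝ}
    (hp₁ : p₁ ∈ restrictTotalDegree (Fin n) ℝ 1)
    (horth : ∀ q ∈ restrictTotalDegree (Fin n) ℝ 1,
      inner ℝ (ContinuousMap.toLp 2 (sphereMeasure n) ℝ ⟨v, hv.continuous⟩ - polyL2 n p₁)
        (polyL2 n q) = 0) :
    2 * n * ((∫ ξ, v ξ ^ 2 ∂(sphereMeasure n)) - inner ℝ (polyL2 n p₁) (polyL2 n p₁))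
      ≤ ∫ ξ, ‖sphereGrad v ξ‖ ^ 2 ∂(sphereMeasure n) := by
  set u := ContinuousMap.toLp 2 (sphereMeasure n) ℝ (⟨v, hv.continuous⟩ : C(USphere n, ℝ)) with hu
  have huu : ∫ ξ, v ξ ^ 2 ∂(sphereMeasure n) = inner ℝ u u := by
    rw [hu, ContinuousMap.inner_toLp]
    simp [pow_two]
  rw [huu]
  refine le_of_forall_pos_le_add fun δ hδ => ?_
  obtain ⟨η, hη, hηδ⟩ : ∃ η : ℝ, 0 < η ∧ 2 * n * η ^ 2 ≤ δ := by
    have hn' : (0 : ℝ) < n := by exact_mod_cast hn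
    refine ⟨Real.sqrt (δ / (2 * n)), Real.sqrt_pos.2 (by positivity), ?_⟩
    rw [Real.sq_sqrt (by positivity)]
    field_simp
    exact le_rfl
  obtain ⟨q, hq⟩ := exists_polyL2_near (⟨v, hv.continuous⟩ : C(USphere n, ℝ)) hη
  set N := q.totalDegree with hN
  obtain ⟨p, hp, hpo⟩ := exists_polyL2_projection (N + 1) u
  set w := p - p₁ with hw
  have hJw : polyL2 n w = polyL2 n p - polyL2 n p₁ := map_sub _ _ _
  have hp₁' : p₁ ∈ restrictTotalDegree (Fin n) ℝ (N + 1) :=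
    restrictTotalDegree_mono (by omega) hp₁
  have hwm : w ∈ restrictTotalDegree (Fin n) ℝ (N + 1) := Submodule.sub_mem _ hp hp₁'
  have hw1 : ∀ r ∈ restrictTotalDegree (Fin n) ℝ 1, inner ℝ (polyL2 n w) (polyL2 n r) = 0 := by
    intro r hr
    have h1 := horth r hr
    have h2 := hpo r (restrictTotalDegree_mono (by omega) hr)
    rw [inner_sub_left] at h1 h2
    rw [hJw, inner_sub_left]
    linarith
  have hgap := two_mul_inner_le_inner_sphereOp hn N w hwm hw1
  -- the Dirichlet integral dominates that of the polynomial part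
  obtain ⟨L', hL'⟩ := exists_lipschitzWith_polyFun w
  have hD1 := integral_inner_sphereGrad_polyFun hn hv w
  have hD2 := integral_inner_sphereGrad_polyFun hn hL' w
  have hD2' : ∫ ξ, inner ℝ (sphereGrad (fun η : USphere n => polyFun w (η : Eucl n)) ξ)
      (sphereGrad (fun η : USphere n => polyFun w (η : Eucl n)) ξ) ∂(sphereMeasure n)
      = inner ℝ (polyL2 n w) (polyL2 n (sphereOp n w)) := hD2
  have hcross : inner ℝ u (polyL2 n (sphereOp n w))
      = inner ℝ (polyL2 n w) (polyL2 n (sphereOp n w)) := by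
    have h1 := hpo _ (sphereOp_mem hwm)
    have h2 : inner ℝ (polyL2 n p₁) (polyL2 n (sphereOp n w)) = 0 := by
      rw [inner_sphereOp_comm hn, real_inner_comm]
      exact hw1 _ (sphereOp_mem hp₁)
    rw [inner_sub_left] at h1
    rw [hJw, inner_sub_left, h2]
    linarith
  have hD : inner ℝ (polyL2 n w) (polyL2 n (sphereOp n w))
      ≤ ∫ ξ, ‖sphereGrad v ξ‖ ^ 2 ∂(sphereMeasure n) := by
    set W := fun η : USphere n => polyFun w (η : Eucl n)
    have i1 := integrable_inner_sphereGrad hv hL'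
    have i2 := integrable_inner_sphereGrad hL' hL'
    have i3 := integrable_inner_sphereGrad hv hv
    have h1 : 2 * ∫ ξ, inner ℝ (sphereGrad v ξ) (sphereGrad W ξ) ∂(sphereMeasure n)
        - ∫ ξ, inner ℝ (sphereGrad W ξ) (sphereGrad W ξ) ∂(sphereMeasure n)
        ≤ ∫ ξ, inner ℝ (sphereGrad v ξ) (sphereGrad v ξ) ∂(sphereMeasure n) := by
      rw [← integral_const_mul, ← integral_sub (i1.const_mul 2) i2]
      refine integral_mono ((i1.const_mul 2).sub i2) i3 fun ξ => ?_
      have h2 := real_inner_self_nonneg (x := sphereGrad v ξ - sphereGrad W ξ)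
      have h3 := real_inner_comm (sphereGrad v ξ) (sphereGrad W ξ)
      rw [inner_sub_sub_self] at h2
      simp only
      linarith
    simp only [real_inner_self_eq_norm_sq] at h1 ⊢
    rw [hD1, hcross] at h1
    have h3 := hD2'
    simp only [real_inner_self_eq_norm_sq] at h3
    rw [h3] at h1
    linarith
  -- Pythagoras and density
  have hqp : ‖u - polyL2 n p‖ ^ 2 ≤ η ^ 2 := by
    have h1 : inner ℝ (u - polyL2 n p) (polyL2 n p - polyL2 n q) = 0 := by
      rw [← map_sub]
      refine hpo _ (Submodule.sub_mem _ hp ?_)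
      exact (mem_restrictTotalDegree _ _ _).2 (Nat.le_succ _)
    have h2 : u - polyL2 n q = (u - polyL2 n p) + (polyL2 n p - polyL2 n q) := by abel
    have h3 : ‖u - polyL2 n q‖ ^ 2 < η ^ 2 := by
      gcongr
    rw [h2, norm_add_sq_real, h1] at h3
    nlinarith [sq_nonneg ‖polyL2 n p - polyL2 n q‖]
  have hpyth1 : inner ℝ u u = ‖u - polyL2 n p‖ ^ 2 + inner ℝ (polyL2 n p) (polyL2 n p) := by
    have h1 := hpo p hp
    rw [← real_inner_self_eq_norm_sq, inner_sub_right, h1, sub_zero]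
    rw [inner_sub_left] at h1 ⊢
    have := real_inner_comm u (polyL2 n p)
    linarith
  have hpyth2 : inner ℝ (polyL2 n p) (polyL2 n p)
      = inner ℝ (polyL2 n w) (polyL2 n w) + inner ℝ (polyL2 n p₁) (polyL2 n p₁) := by
    have h1 := hw1 p₁ hp₁
    have h2 : polyL2 n p = polyL2 n w + polyL2 n p₁ := by rw [hJw]; abel
    have h3 := real_inner_comm (polyL2 n w) (polyL2 n p₁)
    rw [h2]
    simp only [inner_add_left, inner_add_right]
    linarith
  rw [hpyth1, hpyth2]
  have h2n : (0 : ℝ) ≤ 2 * n := by positivity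
  have := mul_le_mul_of_nonneg_left hqp h2n
  linarith

theorem sphereOp_one : sphereOp n 1 = 0 := by
  rw [sphereOp_of_isHomogeneous (isHomogeneous_one (Fin n) ℝ), laplaceOp_apply]
  simp

/-- The image of the operator has mean zero, as the operator is symmetric and annihilates
constants. -/
theorem integral_sphereOp (hn : 0 < n) (p : MvPolynomial (Fin n) ℝ) :
    ∫ ξ : USphere n, polyFun (sphereOp n p) (ξ : Eucl n) ∂(sphereMeasure n) = 0 := by
  have h := inner_sphereOp_comm hn 1 p
  rw [sphereOp_one, map_zero, inner_zero_left, inner_polyL2] at h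
  simpa using h

theorem integral_coord_sphere (hn : 2 ≤ n) (i : Fin n) :
    ∫ ξ : USphere n, (ξ : Eucl n) i ∂(sphereMeasure n) = 0 := by
  have h := integral_sphereOp (by omega : 0 < n) (X i)
  rw [sphereOp_of_isHomogeneous (isHomogeneous_X ℝ i), laplaceOp_apply] at h
  have h0 : ∑ j, pderiv j (pderiv j (X i : MvPolynomial (Fin n) ℝ)) = 0 :=
    Finset.sum_eq_zero fun j _ => by
      rcases eq_or_ne j i with rfl | hj
      · simp
      · simp [pderiv_X_of_ne hj.symm]
  rw [h0] at h
  simp only [sub_zero, polyFun_smul, polyFun_X, integral_const_mul] at h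
  have hn' : (2 : ℝ) ≤ n := by exact_mod_cast hn
  refine (mul_eq_zero.1 h).resolve_left (ne_of_gt ?_)
  push_cast
  linarith

theorem integral_coord_mul_coord_sphere (hn : 0 < n) (i j : Fin n) :
    ∫ ξ : USphere n, (ξ : Eucl n) i * (ξ : Eucl n) j ∂(sphereMeasure n)
      = if i = j then (sphereMeasure n).real univ / n else 0 := by
  have h := integral_sphereOp hn (X i * X j)
  rw [sphereOp_of_isHomogeneous ((isHomogeneous_X ℝ i).mul (isHomogeneous_X ℝ j)),
    laplaceOp_apply] at h
  have h0 : ∑ k, pderiv k (pderiv k (X i * X j : MvPolynomial (Fin n) ℝ))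
      = C (if i = j then 2 else 0) := by
    have h1 : ∀ k, pderiv k (pderiv k (X i * X j : MvPolynomial (Fin n) ℝ))
        = if k = i then (if i = j then C 2 else 0) else 0 := fun k => by
      have hC : (C 2 : MvPolynomial (Fin n) ℝ) = 2 := map_ofNat C 2
      rcases eq_or_ne k i with rfl | hi <;> rcases eq_or_ne k j with rfl | hj
      · simp [hC]; ring
      · simp [pderiv_X_of_ne hj.symm, hj]
      · simp [pderiv_X_of_ne hi.symm, hi]
      · simp [pderiv_X_of_ne hi.symm, pderiv_X_of_ne hj.symm, hi]
    simp only [h1, Finset.sum_ite_eq', Finset.mem_univ, if_true]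
    split_ifs <;> simp
  rw [h0] at h
  have hc : Integrable (fun ξ : USphere n => (ξ : Eucl n) i * (ξ : Eucl n) j)
      (sphereMeasure n) := integrable_of_continuous_sphere (by fun_prop)
  simp only [polyFun_sub, polyFun_smul, polyFun_mul, polyFun_X, polyFun_C] at h
  rw [integral_sub (hc.const_mul _) (integrable_const _), integral_const_mul, integral_const,
    smul_eq_mul] at h
  have hn' : (0 : ℝ) < n := by exact_mod_cast hn
  push_cast at h
  split_ifs at h ⊢
  · field_simp
    linarith
  · have h2 : (2 * (n : ℝ)) * ∫ ξ : USphere n, (ξ : Eucl n) i * (ξ : Eucl n) j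
        ∂(sphereMeasure n) = 0 := by linarith
    exact (mul_eq_zero.1 h2).resolve_left (by positivity)

theorem sphereMeasure_univ_real_pos (hn : 0 < n) : 0 < (sphereMeasure n).real univ := by
  have := nontrivial_eucl hn
  have : Nonempty (USphere n) := (NormedSpace.sphere_nonempty.2 zero_le_one).to_subtype
  exact measureReal_univ_pos

/-- **Poincaré inequality on the sphere** with the second eigenvalue `2n` of the Laplacian: the mean
and the first moments of the function are subtracted. -/
theorem sphere_poincare (hn : 2 ≤ n) {v : USphere n → ℝ} {L : NNReal} (hv : LipschitzWith L v) :
    2 * n * ((∫ ξ, v ξ ^ 2 ∂(sphereMeasure n))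
        - (∫ ξ, v ξ ∂(sphereMeasure n)) ^ 2 / (sphereMeasure n).real univ
        - n / (sphereMeasure n).real univ
          * ∑ i, (∫ ξ, v ξ * (ξ : Eucl n) i ∂(sphereMeasure n)) ^ 2)
      ≤ ∫ ξ, ‖sphereGrad v ξ‖ ^ 2 ∂(sphereMeasure n) := by
  have hn0 : 0 < n := by omega
  have hn' : (0 : ℝ) < n := by exact_mod_cast hn0
  have hS := sphereMeasure_univ_real_pos hn0
  set S := (sphereMeasure n).real univ with hSdef
  set u := ContinuousMap.toLp 2 (sphereMeasure n) ℝ (⟨v, hv.continuous⟩ : C(USphere n, ℝ)) with hu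
  set m := ∫ ξ, v ξ ∂(sphereMeasure n) with hm
  set b : Fin n → ℝ := fun i => ∫ ξ, v ξ * (ξ : Eucl n) i ∂(sphereMeasure n) with hb
  set p₁ : MvPolynomial (Fin n) ℝ := (m / S) • 1 + ∑ i, (n / S * b i) • X i with hp₁
  have hu1 : inner ℝ u (polyL2 n 1) = m := by
    rw [hu, inner_toLp_polyL2]
    simp [hm]
  have huX : ∀ i, inner ℝ u (polyL2 n (X i)) = b i := fun i => by
    rw [hu, inner_toLp_polyL2]
    simp [hb]
  have h11 : inner ℝ (polyL2 n 1) (polyL2 n 1) = S := by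
    rw [inner_polyL2]
    simp [hSdef]
  have h1X : ∀ i, inner ℝ (polyL2 n 1) (polyL2 n (X i)) = 0 := fun i => by
    rw [inner_polyL2]
    simpa using integral_coord_sphere hn i
  have hX1 : ∀ i, inner ℝ (polyL2 n (X i)) (polyL2 n 1) = 0 := fun i => by
    rw [real_inner_comm, h1X]
  have hXX : ∀ i j, inner ℝ (polyL2 n (X i)) (polyL2 n (X j)) = if i = j then S / n else 0 :=
    fun i j => by
      rw [inner_polyL2]
      simpa using integral_coord_mul_coord_sphere hn0 i j
  have hJ : polyL2 n p₁ = (m / S) • polyL2 n 1 + ∑ i, (n / S * b i) • polyL2 n (X i) := by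
    simp [hp₁]
  have hp1 : inner ℝ (polyL2 n p₁) (polyL2 n 1) = m := by
    rw [hJ, inner_add_left, sum_inner]
    simp only [inner_smul_left, h11, hX1]
    simp [hS.ne']
  have hpX : ∀ i, inner ℝ (polyL2 n p₁) (polyL2 n (X i)) = b i := fun i => by
    rw [hJ, inner_add_left, sum_inner]
    simp only [inner_smul_left, h1X, hXX]
    simp
    field_simp
  have hmem : p₁ ∈ restrictTotalDegree (Fin n) ℝ 1 := by
    refine Submodule.add_mem _ (Submodule.smul_mem _ _ ?_)
      (Submodule.sum_mem _ fun i _ => Submodule.smul_mem _ _ ?_)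
    · rw [mem_restrictTotalDegree]
      simp
    · rw [mem_restrictTotalDegree]
      exact (isHomogeneous_X ℝ i).totalDegree_le
  have horth : ∀ q ∈ restrictTotalDegree (Fin n) ℝ 1,
      inner ℝ (u - polyL2 n p₁) (polyL2 n q) = 0 := fun q hq =>
    map_eq_zero_of_mem_restrictTotalDegree_one
      ((innerSL ℝ (u - polyL2 n p₁)).toLinearMap ∘ₗ polyL2 n)
      (by simp [hu1, hp1]) (fun i => by simp [huX, hpX]) hq
  have h := two_mul_sub_le_integral_norm_sphereGrad_sq hn0 hv hmem horth
  have hpp : inner ℝ (polyL2 n p₁) (polyL2 n p₁) = m ^ 2 / S + n / S * ∑ i, b i ^ 2 := by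
    conv_lhs => rw [hJ, ← hJ]
    nth_rewrite 2 [hJ]
    rw [inner_add_right, inner_sum]
    simp only [inner_smul_right, hp1, hpX, Finset.mul_sum]
    congr 1
    · ring
    · exact Finset.sum_congr rfl fun i _ => by ring
  rw [hpp, ← sub_sub] at h
  exact h

end SpherePoincareInequality

/-! ### Hausdorff measure and volumes of cylinders -/

section Cylinder

variable {n : ℕ}

/-- Fubini's theorem for the lines parallel to a unit vector. -/
theorem volume_eq_lintegral_lines {τ : Eucl n} (hτ : ‖τ‖ = 1) {T : Set (Eucl n)}
    (hT : MeasurableSet T) :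
    Measurable (fun y : ((ℝ ∙ τ)ᗮ : Submodule ℝ (Eucl n)) =>
        volume {t : ℝ | t • τ + (y : Eucl n) ∈ T}) ∧
    volume T = ∫⁻ y : ((ℝ ∙ τ)ᗮ : Submodule ℝ (Eucl n)),
      volume {t : ℝ | t • τ + (y : Eucl n) ∈ T} := by
  set e := (ℝ ∙ τ : Submodule ℝ (Eucl n)).measurableEquivProd (0 : Eucl n) with he
  have hmp : MeasurePreserving e volume volume := by
    have := (ℝ ∙ τ : Submodule ℝ (Eucl n)).measurePreserving_measurableEquivProd (0 : Eucl n)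
    rwa [InnerProductSpace.euclideanHausdorffMeasure_eq_volume] at this
  have hT' : MeasurableSet (e.symm ⁻¹' T) := e.symm.measurable hT
  have hsl : ∀ y : ((ℝ ∙ τ)ᗮ : Submodule ℝ (Eucl n)),
      volume ((fun a : (ℝ ∙ τ : Submodule ℝ (Eucl n)) => (a, y)) ⁻¹' (e.symm ⁻¹' T))
        = volume {t : ℝ | t • τ + (y : Eucl n) ∈ T} := by
    intro y
    have h1 := (LinearIsometryEquiv.toSpanUnitSingleton (𝕜 := ℝ) τ hτ).measurePreserving
    rw [← h1.measure_preimage (measurable_prodMk_right hT').nullMeasurableSet]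
    congr 1
    ext t
    simp [he]
  constructor
  · have := measurable_measure_prodMk_right (μ := (volume : Measure (ℝ ∙ τ : Submodule ℝ (Eucl n))))
      hT'
    simpa only [hsl] using this
  · have h1 := hmp.symm.measure_preimage hT.nullMeasurableSet
    rw [← h1, Measure.volume_eq_prod, Measure.prod_apply_symm hT']
    simp only [hsl]

theorem finrank_orthogonal_span_unit {τ : Eucl n} (hτ : ‖τ‖ = 1) :
    Module.finrank ℝ ((ℝ ∙ τ)ᗮ : Submodule ℝ (Eucl n)) = n - 1 := by
  have h1 := (ℝ ∙ τ : Submodule ℝ (Eucl n)).finrank_add_finrank_orthogonal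
  have h0 : τ ≠ 0 := fun h => by simp [h] at hτ
  rw [finrank_span_singleton h0, finrank_euclideanSpace_fin] at h1
  omega

theorem euclideanHausdorffMeasure_orthogonal_span_unit {τ : Eucl n} (hτ : ‖τ‖ = 1) :
    (Measure.euclideanHausdorffMeasure (n - 1) :
      Measure ((ℝ ∙ τ)ᗮ : Submodule ℝ (Eucl n))) = volume := by
  rw [← finrank_orthogonal_span_unit hτ, InnerProductSpace.euclideanHausdorffMeasure_eq_volume]

theorem euclideanHausdorffMeasure_image_le {X Y : Type*} [EMetricSpace X] [MeasurableSpace X]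
    [BorelSpace X] [EMetricSpace Y] [MeasurableSpace Y] [BorelSpace Y] {K : NNReal} {f : X → Y}
    (hf : LipschitzWith K f) (d : ℕ) (s : Set X) :
    (Measure.euclideanHausdorffMeasure d) (f '' s)
      ≤ (K : ℝ≥0∞) ^ d * Measure.euclideanHausdorffMeasure d s := by
  simp only [Measure.euclideanHausdorffMeasure_def, Measure.smul_apply, ENNReal.smul_def,
    smul_eq_mul]
  rw [mul_left_comm]
  gcongr
  simpa using hf.hausdorffMeasure_image_le (d := (d : ℝ)) (by positivity) s

theorem le_euclideanHausdorffMeasure_image {X Y : Type*} [EMetricSpace X] [MeasurableSpace X]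
    [BorelSpace X] [EMetricSpace Y] [MeasurableSpace Y] [BorelSpace Y] {K : NNReal} {f : X → Y}
    (hf : AntilipschitzWith K f) (d : ℕ) (s : Set X) :
    Measure.euclideanHausdorffMeasure d s
      ≤ (K : ℝ≥0∞) ^ d * (Measure.euclideanHausdorffMeasure d) (f '' s) := by
  simp only [Measure.euclideanHausdorffMeasure_def, Measure.smul_apply, ENNReal.smul_def,
    smul_eq_mul]
  rw [mul_left_comm]
  gcongr
  simpa using hf.le_hausdorffMeasure_image (d := (d : ℝ)) (by positivity) s

theorem orthogonalProjection_smul_add {τ : Eucl n} (t : ℝ)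
    (y : ((ℝ ∙ τ)ᗮ : Submodule ℝ (Eucl n))) :
    ((ℝ ∙ τ)ᗮ : Submodule ℝ (Eucl n)).orthogonalProjectionOnto (t • τ + (y : Eucl n)) = y := by
  rw [map_add, Submodule.orthogonalProjectionOnto_mem_subspace_eq_self,
    Submodule.orthogonalProjectionOnto_orthogonal_apply_eq_zero, zero_add]
  exact Submodule.smul_mem _ _ (Submodule.mem_span_singleton_self τ)

theorem exists_eq_smul_add_orthogonalProjection {τ : Eucl n} (hτ : ‖τ‖ = 1) (z : Eucl n) :
    z = (inner ℝ τ z : ℝ) • τ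
      + (((ℝ ∙ τ)ᗮ : Submodule ℝ (Eucl n)).orthogonalProjectionOnto z : Eucl n) := by
  have h := Submodule.starProjection_add_starProjection_orthogonal
    (K := (ℝ ∙ τ : Submodule ℝ (Eucl n))) z
  rw [Submodule.starProjection_unit_singleton ℝ hτ] at h
  exact h.symm

/-- The volume of a cylinder of height one over a set whose projection along the axis is injective
is at most the Hausdorff measure of the set, as the projection does not increase distances. -/
theorem volume_cylinder_le {τ : Eucl n} (hτ : ‖τ‖ = 1) {T E : Set (Eucl n)}
    (hT : MeasurableSet T)
    (hTE : ∀ x ∈ T, ∃ y ∈ E, ∃ t ∈ Ioo (0 : ℝ) 1, x = y + t • τ)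
    (hinj : ∀ y ∈ E, ∀ y' ∈ E, ∀ t : ℝ, y - y' = t • τ → y = y') :
    volume T ≤ Measure.euclideanHausdorffMeasure (n - 1) E := by
  set P := ((ℝ ∙ τ)ᗮ : Submodule ℝ (Eucl n)).orthogonalProjectionOnto with hP
  rw [(volume_eq_lintegral_lines hτ hT).2]
  set G := toMeasurable volume (P '' E) with hG
  calc ∫⁻ y : ((ℝ ∙ τ)ᗮ : Submodule ℝ (Eucl n)), volume {t : ℝ | t • τ + (y : Eucl n) ∈ T}
      ≤ ∫⁻ y : ((ℝ ∙ τ)ᗮ : Submodule ℝ (Eucl n)), G.indicator 1 y := by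
        refine lintegral_mono fun y => ?_
        by_cases hne : ∃ t₀ : ℝ, t₀ • τ + (y : Eucl n) ∈ T
        · obtain ⟨t₀, ht₀⟩ := hne
          obtain ⟨z, hz, s, hs, hzs⟩ := hTE _ ht₀
          have hzy : z = (t₀ - s) • τ + (y : Eucl n) := by
            rw [sub_smul, eq_sub_of_add_eq hzs.symm]
            abel
          have hyG : y ∈ G := by
            refine subset_toMeasurable _ _ ⟨z, hz, ?_⟩
            rw [hzy, hP, orthogonalProjection_smul_add]
          rw [indicator_of_mem hyG, Pi.one_apply]
          have hsub : {t : ℝ | t • τ + (y : Eucl n) ∈ T} ⊆ Ioo (t₀ - s) (t₀ - s + 1) := by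
            intro t ht
            obtain ⟨z', hz', s', hs', hzs'⟩ := hTE _ ht
            have hzy' : z' = (t - s') • τ + (y : Eucl n) := by
              rw [sub_smul, eq_sub_of_add_eq hzs'.symm]
              abel
            have heq : z' = z := hinj _ hz' _ hz (t - s' - (t₀ - s)) (by
              rw [hzy, hzy', sub_smul (t - s')]
              abel)
            have h0 : (t - s' - (t₀ - s)) • τ = 0 := by
              rw [hzy, hzy'] at heq
              rw [sub_smul (t - s'), add_right_cancel heq, sub_self]
            have hτ0 : τ ≠ 0 := fun h => by simp [h] at hτ
            have h1 := (smul_eq_zero.1 h0).resolve_right hτ0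
            have h2 := hs'.1
            have h3 := hs'.2
            constructor <;> linarith
          refine (measure_mono hsub).trans ?_
          rw [Real.volume_Ioo]
          simp
        · have : {t : ℝ | t • τ + (y : Eucl n) ∈ T} = ∅ :=
            eq_empty_of_forall_notMem fun t ht => hne ⟨t, ht⟩
          simp [this]
    _ = volume (P '' E) := by
        rw [lintegral_indicator_one (measurableSet_toMeasurable _ _), measure_toMeasurable]
    _ = Measure.euclideanHausdorffMeasure (n - 1) (P '' E) := by
        rw [euclideanHausdorffMeasure_orthogonal_span_unit hτ]
    _ ≤ Measure.euclideanHausdorffMeasure (n - 1) E := by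
        have hL : LipschitzWith 1 P := LipschitzWith.of_dist_le_mul fun x y => by
          rw [dist_eq_norm, dist_eq_norm, ← map_sub, NNReal.coe_one, one_mul]
          exact Submodule.norm_orthogonalProjectionOnto_apply_le _ _
        simpa using euclideanHausdorffMeasure_image_le hL (n - 1) E

/-- The Hausdorff measure of a set is controlled by the volume of the cylinder over it when the
projection along the axis is nearly isometric on the set. -/
theorem euclideanHausdorffMeasure_le_volume_cylinder {τ : Eucl n} (hτ : ‖τ‖ = 1)
    {T E : Set (Eucl n)} (hT : MeasurableSet T)
    (hTE : ∀ y ∈ E, ∀ t ∈ Ioo (0 : ℝ) 1, y + t • τ ∈ T) {C : NNReal}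
    (hC : ∀ y ∈ E, ∀ y' ∈ E, dist y y'
      ≤ C * dist (((ℝ ∙ τ)ᗮ : Submodule ℝ (Eucl n)).orthogonalProjectionOnto y)
        (((ℝ ∙ τ)ᗮ : Submodule ℝ (Eucl n)).orthogonalProjectionOnto y')) :
    Measure.euclideanHausdorffMeasure (n - 1) E ≤ (C : ℝ≥0∞) ^ (n - 1) * volume T := by
  set P := ((ℝ ∙ τ)ᗮ : Submodule ℝ (Eucl n)).orthogonalProjectionOnto with hP
  obtain ⟨hmeas, hvol⟩ := volume_eq_lintegral_lines hτ hT
  have h1 : volume (P '' E) ≤ volume T := by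
    rw [hvol]
    have h2 := mul_meas_ge_le_lintegral (μ := volume) hmeas 1
    rw [one_mul] at h2
    refine (measure_mono ?_).trans h2
    rintro _ ⟨z, hz, rfl⟩
    have h3 := exists_eq_smul_add_orthogonalProjection hτ z
    have hsub : Ioo (inner ℝ τ z : ℝ) (inner ℝ τ z + 1)
        ⊆ {t : ℝ | t • τ + ((P z : ((ℝ ∙ τ)ᗮ : Submodule ℝ (Eucl n))) : Eucl n) ∈ T} := by
      intro t ht
      have h4 := hTE z hz (t - inner ℝ τ z) ⟨by linarith [ht.1], by linarith [ht.2]⟩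
      have h5 : z + (t - inner ℝ τ z) • τ = t • τ + (P z : Eucl n) := by
        have h3' : (P z : Eucl n) = z - (inner ℝ τ z : ℝ) • τ :=
          eq_sub_of_add_eq' h3.symm
        rw [h3', sub_smul]
        abel
      rw [h5] at h4
      exact h4
    refine le_trans ?_ (measure_mono hsub)
    rw [Real.volume_Ioo]
    simp
  have hanti : AntilipschitzWith C fun y : E => P y :=
    AntilipschitzWith.of_le_mul_dist fun y y' => hC y y.2 y' y'.2
  have h6 := le_euclideanHausdorffMeasure_image hanti (n - 1) univ
  rw [← isometry_subtype_coe.euclideanHausdorffMeasure_image, image_univ, Subtype.range_coe,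
    euclideanHausdorffMeasure_orthogonal_span_unit hτ] at h6
  refine h6.trans ?_
  gcongr
  refine (measure_mono ?_).trans h1
  rintro _ ⟨y, _, rfl⟩
  exact ⟨y, y.2, rfl⟩

end Cylinder

/-! ### The area of a radial graph -/

section RadialGraph

variable {n : ℕ}

/-- The point of the radial graph of `R` in direction `ξ`. -/
noncomputable def radialGraph (R : USphere n → ℝ) (ξ : USphere n) : Eucl n := R ξ • (ξ : Eucl n)

theorem norm_radialGraph {R : USphere n → ℝ} (hR : ∀ ξ, 0 < R ξ) (ξ : USphere n) :
    ‖radialGraph R ξ‖ = R ξ := norm_smul_sphere_coe (hR ξ).le ξ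

theorem radialGraph_injective {R : USphere n → ℝ} (hR : ∀ ξ, 0 < R ξ) :
    Function.Injective (radialGraph R) := by
  intro ξ η h
  have h1 : R ξ = R η := by rw [← norm_radialGraph hR, h, norm_radialGraph hR]
  simp only [radialGraph, h1] at h
  exact Subtype.ext (smul_right_injective _ (hR η).ne' h)

theorem continuous_radialGraph {R : USphere n → ℝ} (hR : Continuous R) :
    Continuous (radialGraph R) := by unfold radialGraph; fun_prop

theorem measurableEmbedding_radialGraph {R : USphere n → ℝ} (hR : ∀ ξ, 0 < R ξ)
    (hc : Continuous R) : MeasurableEmbedding (radialGraph R) :=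
  (continuous_radialGraph hc).measurableEmbedding (radialGraph_injective hR)

theorem measurable_radialExtension {f : USphere n → ℝ} (hf : Measurable f) :
    Measurable (radialExtension f) := by
  classical
  have h2 : Measurable fun x : ({0}ᶜ : Set (Eucl n)) =>
      f ⟨‖(x : Eucl n)‖⁻¹ • (x : Eucl n), by simp [norm_smul, show (x : Eucl n) ≠ 0 from x.2]⟩ := by
    refine hf.comp (Measurable.subtype_mk ?_)
    fun_prop
  refine measurable_of_restrict_of_restrict_compl (s := {0}) (measurableSet_singleton _) ?_ ?_
  · have : ({0} : Set (Eucl n)).domRestrict (radialExtension f) = fun _ => 0 := by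
      ext x
      have : (x : Eucl n) = 0 := x.2
      simp [radialExtension, this]
    rw [this]
    exact measurable_const
  · convert h2 using 1
    ext x
    have : (x : Eucl n) ≠ 0 := x.2
    simp [radialExtension, this]

/-- Two points of the sphere close to `τ` differ by a vector nearly orthogonal to `τ`. -/
theorem abs_inner_sub_le {τ : Eucl n} {κ : ℝ} {ξ η : USphere n} (hξ : dist (ξ : Eucl n) τ ≤ κ)
    (hη : dist (η : Eucl n) τ ≤ κ) :
    |inner ℝ τ ((ξ : Eucl n) - η)| ≤ κ * ‖(ξ : Eucl n) - η‖ := by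
  -- `ξ - η` is orthogonal to the midpoint of `ξ` and `η`, which is close to `τ`
  have h1 : inner ℝ ((ξ : Eucl n) + η) ((ξ : Eucl n) - η) = 0 := by
    rw [inner_sub_right, inner_add_left, inner_add_left, real_inner_self_eq_norm_sq,
      real_inner_self_eq_norm_sq, norm_sphere_coe, norm_sphere_coe, real_inner_comm]
    ring
  have h2 : inner ℝ τ ((ξ : Eucl n) - η)
      = inner ℝ (τ - (2⁻¹ : ℝ) • ((ξ : Eucl n) + η)) ((ξ : Eucl n) - η) := by
    rw [inner_sub_left, inner_smul_left, h1]
    simp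
  have h3 : τ - (2⁻¹ : ℝ) • ((ξ : Eucl n) + η)
      = (2⁻¹ : ℝ) • ((τ - ξ) + (τ - η)) := by
    module
  rw [h2]
  refine (abs_real_inner_le_norm _ _).trans ?_
  gcongr
  rw [h3, norm_smul]
  have h4 := norm_add_le (τ - (ξ : Eucl n)) (τ - η)
  rw [dist_comm, dist_eq_norm] at hξ hη
  rw [Real.norm_of_nonneg (by norm_num)]
  linarith

/-- Over a small piece of the sphere, a radial graph of small slope meets each line parallel to an
axis near that piece at most once. -/
theorem eq_of_radialGraph_sub_eq_smul {R : USphere n → ℝ} {m : ℝ} {L : NNReal}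
    (hL : LipschitzWith L R) (hm : 0 < m) (hmR : ∀ ξ, m ≤ R ξ) (hLm : (L : ℝ) ≤ m / 32)
    {τ : Eucl n} (hτ : ‖τ‖ = 1) {ξ η : USphere n} (hξ : dist (ξ : Eucl n) τ ≤ 1 / 4)
    (hη : dist (η : Eucl n) τ ≤ 1 / 4) {t : ℝ}
    (h : radialGraph R ξ - radialGraph R η = t • τ) : ξ = η := by
  by_contra hne
  have hd : 0 < ‖(ξ : Eucl n) - η‖ := by
    rw [norm_pos_iff, sub_ne_zero]
    exact fun h' => hne (Subtype.ext h')
  have e1 : t • τ = R ξ • ((ξ : Eucl n) - η) + (R ξ - R η) • (η : Eucl n) := by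
    rw [← h, radialGraph, radialGraph]
    module
  have hRd : |R ξ - R η| ≤ L * ‖(ξ : Eucl n) - η‖ := by
    have := hL.dist_le_mul ξ η
    rwa [Real.dist_eq, Subtype.dist_eq, dist_eq_norm] at this
  have h1 : t = R ξ * inner ℝ τ ((ξ : Eucl n) - η) + (R ξ - R η) * inner ℝ τ (η : Eucl n) := by
    have := congrArg (fun z => inner ℝ τ z) e1
    simp only [inner_add_right, inner_smul_right, real_inner_self_eq_norm_sq, hτ] at this
    simpa using this
  have h2 : |t| = ‖R ξ • ((ξ : Eucl n) - η) + (R ξ - R η) • (η : Eucl n)‖ := by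
    rw [← e1, norm_smul, hτ, mul_one, Real.norm_eq_abs]
  have hRpos : 0 < R ξ := hm.trans_le (hmR ξ)
  have h3 : R ξ * ‖(ξ : Eucl n) - η‖ - |R ξ - R η| ≤ |t| := by
    rw [h2]
    have := norm_sub_le_norm_add (R ξ • ((ξ : Eucl n) - η)) ((R ξ - R η) • (η : Eucl n))
    rwa [norm_smul, norm_smul, norm_sphere_coe, mul_one, Real.norm_eq_abs, Real.norm_eq_abs,
      abs_of_pos hRpos] at this
  have h4 : |t| ≤ R ξ * (1 / 4 * ‖(ξ : Eucl n) - η‖) + |R ξ - R η| := by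
    rw [h1]
    refine (abs_add_le _ _).trans ?_
    rw [abs_mul, abs_mul, abs_of_pos hRpos]
    have h5 := abs_inner_sub_le hξ hη
    have h6 : |inner ℝ τ (η : Eucl n)| ≤ 1 := by
      simpa [hτ] using abs_real_inner_le_norm τ (η : Eucl n)
    have h7 := mul_le_mul_of_nonneg_left h6 (abs_nonneg (R ξ - R η))
    have h8 := mul_le_mul_of_nonneg_left h5 hRpos.le
    linarith
  have h9 := hmR ξ
  have h10 : (L : ℝ) * ‖(ξ : Eucl n) - η‖ ≤ R ξ / 32 * ‖(ξ : Eucl n) - η‖ := by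
    gcongr
    linarith
  nlinarith [mul_pos hRpos hd]

/-- The parametrization, by the sector over a piece of the sphere, of the cylinder with axis `τ`
over the corresponding piece of the radial graph of `R`. -/
noncomputable def cylinderMap (R : USphere n → ℝ) (τ x : Eucl n) : Eucl n :=
  radialExtension R x • (‖x‖⁻¹ • x) + (‖x‖ - 1) • τ

theorem cylinderMap_smul (R : USphere n → ℝ) (τ : Eucl n) (ξ : USphere n) {r : ℝ} (hr : 0 < r) :
    cylinderMap R τ (r • (ξ : Eucl n)) = radialGraph R ξ + (r - 1) • τ := by
  rw [cylinderMap, radialExtension_smul R ξ hr, norm_smul_sphere_coe hr.le, smul_smul r⁻¹,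
    inv_mul_cancel₀ hr.ne', one_smul, radialGraph]

theorem hasFDerivAt_cylinderMap {R : USphere n → ℝ} (τ : Eucl n) (ξ : USphere n) {r : ℝ}
    (hr : 0 < r) (h : DifferentiableAt ℝ (radialExtension R) (r • (ξ : Eucl n))) :
    HasFDerivAt (cylinderMap R τ)
      ((R ξ / r) • ContinuousLinearMap.id ℝ (Eucl n)
        + (fderiv ℝ (radialExtension R) (r • (ξ : Eucl n))).smulRight (ξ : Eucl n)
        + (innerSL ℝ (ξ : Eucl n)).smulRight (τ - (R ξ / r) • (ξ : Eucl n)))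
      (r • (ξ : Eucl n)) := by
  have hx : r • (ξ : Eucl n) ≠ 0 := smul_ne_zero hr.ne' (sphere_coe_ne_zero ξ)
  have hnx := norm_smul_sphere_coe hr.le ξ
  have h1 := hasFDerivAt_norm_of_ne hx
  have h2 := (hasDerivAt_inv (x := ‖r • (ξ : Eucl n)‖) (by simpa using hx)).comp_hasFDerivAt _ h1
  have h3 := h.hasFDerivAt.smul (h2.smul (hasFDerivAt_id (r • (ξ : Eucl n))))
  have h4 := h3.add ((h1.sub_const 1).smul_const τ)
  refine h4.congr_fderiv ?_
  ext1 w
  have hsm : radialExtension R (r • (ξ : Eucl n)) = R ξ := radialExtension_smul R ξ hr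
  simp only [Pi.smul_apply', Function.comp_apply, hnx, hsm, id, add_apply,
    smul_apply, ContinuousLinearMap.smulRight_apply,
    ContinuousLinearMap.id_apply, innerSL_apply_apply, smul_eq_mul, inner_smul_left,
    smul_add, smul_sub, smul_smul, conj_trivial]
  match_scalars <;> field_simp
  ring

/-- A rank-two perturbation of a multiple of the identity, as a product of two transvections. -/
theorem det_cylinder {c : ℝ} (hc : c ≠ 0) (ξ : USphere n) (τ : Eucl n)
    (hξτ : inner ℝ (ξ : Eucl n) τ ≠ 0) (D : Eucl n →L[ℝ] ℝ) (hD : D (ξ : Eucl n) = 0)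
    (hn : 0 < n) :
    (c • ContinuousLinearMap.id ℝ (Eucl n) + D.smulRight (ξ : Eucl n)
        + (innerSL ℝ (ξ : Eucl n)).smulRight (τ - c • (ξ : Eucl n))).det
      = c ^ (n - 1) * (inner ℝ (ξ : Eucl n) τ - D τ / c) := by
  set l : Eucl n →ₗ[ℝ] ℝ := (innerSL ℝ (ξ : Eucl n)).toLinearMap with hl
  set f : Eucl n →ₗ[ℝ] ℝ := D.toLinearMap - (D τ / inner ℝ (ξ : Eucl n) τ) • l with hf
  have hll : ∀ w, l w = inner ℝ (ξ : Eucl n) w := fun w => rfl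
  have hlξ : l (ξ : Eucl n) = 1 := by
    rw [hll, real_inner_self_eq_norm_sq, norm_sphere_coe, one_pow]
  have hff : ∀ w, f w = D w - (D τ / inner ℝ (ξ : Eucl n) τ) * l w := fun w => rfl
  have hM : ((c • ContinuousLinearMap.id ℝ (Eucl n) + D.smulRight (ξ : Eucl n)
        + (innerSL ℝ (ξ : Eucl n)).smulRight (τ - c • (ξ : Eucl n)) : Eucl n →L[ℝ] Eucl n)
          : Eucl n →ₗ[ℝ] Eucl n)
      = c • (LinearMap.transvection f (c⁻¹ • (ξ : Eucl n)) ∘ₗ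
          LinearMap.transvection l (c⁻¹ • τ - (ξ : Eucl n))) := by
    refine LinearMap.ext fun w => ?_
    have h1 : f (w + l w • (c⁻¹ • τ - (ξ : Eucl n))) = D w := by
      rw [hff, map_add, map_smul, map_sub, map_smul, map_add, map_smul, map_sub, map_smul, hD, hlξ,
        hll τ]
      simp only [smul_eq_mul]
      field_simp
      ring
    simp only [LinearMap.smul_apply, LinearMap.comp_apply, LinearMap.transvection.apply, h1]
    change c • w + D w • (ξ : Eucl n) + l w • (τ - c • (ξ : Eucl n)) = _
    match_scalars <;> field_simp
    ring
  rw [ContinuousLinearMap.det, hM, LinearMap.det_smul, LinearMap.det_comp,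
    LinearMap.transvection.det, LinearMap.transvection.det, finrank_euclideanSpace_fin, map_smul,
    map_sub, map_smul, hff, hD, hlξ, hll]
  obtain ⟨k, rfl⟩ := Nat.exists_eq_succ_of_ne_zero hn.ne'
  simp only [smul_eq_mul, Nat.succ_eq_add_one, Nat.add_sub_cancel, pow_succ]
  field_simp
  ring

theorem inner_pos_of_dist_le {τ : Eucl n} (hτ : ‖τ‖ = 1) {ξ : USphere n}
    (h : dist (ξ : Eucl n) τ ≤ 1 / 4) : 0 < inner ℝ (ξ : Eucl n) τ := by
  have h1 := norm_sub_sq_real (ξ : Eucl n) τ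
  rw [← dist_eq_norm, hτ, norm_sphere_coe] at h1
  have : dist (ξ : Eucl n) τ ^ 2 ≤ (1 / 4) ^ 2 := by gcongr
  linarith

/-- The volume of the cylinder of height one over a piece of a radial graph that is nearly
orthogonal to the axis of the cylinder, by a change of variables to the sector `1 < |x| < 2` over
the piece. -/
theorem volume_cylinder_radialGraph (hn : 0 < n) {R : USphere n → ℝ} {m : ℝ} {L : NNReal}
    (hL : LipschitzWith L R) (hm : 0 < m) (hmR : ∀ ξ, m ≤ R ξ) (hLm : (L : ℝ) ≤ m / 32)
    {τ : Eucl n} (hτ : ‖τ‖ = 1) {A : Set (USphere n)} (hA : MeasurableSet A)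
    (hAτ : ∀ ξ ∈ A, dist (ξ : Eucl n) τ ≤ 1 / 4)
    (hAd : ∀ ξ ∈ A, DifferentiableAt ℝ (radialExtension R) (ξ : Eucl n)) :
    MeasurableSet {x | ∃ ξ ∈ A, ∃ t ∈ Ioo (0 : ℝ) 1, x = radialGraph R ξ + t • τ} ∧
    volume {x | ∃ ξ ∈ A, ∃ t ∈ Ioo (0 : ℝ) 1, x = radialGraph R ξ + t • τ}
      = ∫⁻ ξ in A, ENNReal.ofReal (R ξ ^ (n - 1) *
          |inner ℝ ((ξ : Eucl n) - (R ξ)⁻¹ • sphereGrad R ξ) τ|) ∂(sphereMeasure n) := by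
  classical
  have hRpos : ∀ ξ, 0 < R ξ := fun ξ => hm.trans_le (hmR ξ)
  set s : Set (Eucl n) := {x | radialExtension (A.indicator (1 : USphere n → ℝ)) x = 1
    ∧ ‖x‖ ∈ Ioo (1 : ℝ) 2} with hs
  have hsm : MeasurableSet s := by
    refine MeasurableSet.inter ?_ ?_
    · exact measurable_radialExtension (measurable_one.indicator hA) (measurableSet_singleton 1)
    · exact measurable_norm measurableSet_Ioo
  have hmem : ∀ (ξ : USphere n) (r : ℝ), 0 < r →
      (r • (ξ : Eucl n) ∈ s ↔ ξ ∈ A ∧ r ∈ Ioo (1 : ℝ) 2) := by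
    intro ξ r hr
    simp only [hs, mem_ofPred_eq, radialExtension_smul _ ξ hr, norm_smul_sphere_coe hr.le]
    by_cases hξ : ξ ∈ A <;> simp [hξ]
  have hrep : ∀ x ∈ s, ∃ ξ ∈ A, ∃ r ∈ Ioo (1 : ℝ) 2, x = r • (ξ : Eucl n) := by
    intro x hx
    have hx0 : x ≠ 0 := by
      rintro rfl
      have := hx.2.1
      simp at this
      linarith
    have e := norm_smul_sphereDir x hx0
    have h1 := (hmem (sphereDir x hx0) ‖x‖ (norm_pos_iff.2 hx0)).1 (by rwa [e])
    exact ⟨_, h1.1, _, h1.2, e.symm⟩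
  have himg : {x | ∃ ξ ∈ A, ∃ t ∈ Ioo (0 : ℝ) 1, x = radialGraph R ξ + t • τ}
      = cylinderMap R τ '' s := by
    ext x
    constructor
    · rintro ⟨ξ, hξ, t, ht, rfl⟩
      refine ⟨(t + 1) • (ξ : Eucl n), (hmem ξ _ (by linarith [ht.1])).2
        ⟨hξ, by linarith [ht.1], by linarith [ht.2]⟩, ?_⟩
      rw [cylinderMap_smul R τ ξ (by linarith [ht.1]), add_sub_cancel_right]
    · rintro ⟨y, hy, rfl⟩
      obtain ⟨ξ, hξ, r, hr, rfl⟩ := hrep y hy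
      exact ⟨ξ, hξ, r - 1, ⟨by linarith [hr.1], by linarith [hr.2]⟩,
        cylinderMap_smul R τ ξ (by linarith [hr.1])⟩
  have hdiff : ∀ ξ ∈ A, ∀ r : ℝ, 0 < r →
      DifferentiableAt ℝ (radialExtension R) (r • (ξ : Eucl n)) := by
    intro ξ hξ r hr
    have := hasFDerivAt_radialExtension_smul (x := r • (ξ : Eucl n)) (inv_pos.2 hr)
      (by rw [smul_smul, inv_mul_cancel₀ hr.ne', one_smul]; exact (hAd ξ hξ).hasFDerivAt)
    exact this.differentiableAt
  have hderiv : ∀ x ∈ s,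
      HasFDerivWithinAt (cylinderMap R τ) (fderiv ℝ (cylinderMap R τ) x) s x := by
    intro x hx
    obtain ⟨ξ, hξ, r, hr, rfl⟩ := hrep x hx
    have hr0 : 0 < r := by linarith [hr.1]
    exact (hasFDerivAt_cylinderMap τ ξ hr0
      (hdiff ξ hξ r hr0)).differentiableAt.hasFDerivAt.hasFDerivWithinAt
  have hτ0 : τ ≠ 0 := fun h => by simp [h] at hτ
  have hinj : InjOn (cylinderMap R τ) s := by
    intro x hx y hy hxy
    obtain ⟨ξ, hξ, r, hr, rfl⟩ := hrep x hx
    obtain ⟨η, hη, q, hq, rfl⟩ := hrep y hy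
    rw [cylinderMap_smul R τ ξ (by linarith [hr.1]), cylinderMap_smul R τ η (by linarith [hq.1])]
      at hxy
    have h1 : ξ = η := eq_of_radialGraph_sub_eq_smul hL hm hmR hLm hτ (hAτ ξ hξ) (hAτ η hη)
      (t := q - r) (by
        rw [eq_sub_of_add_eq hxy]
        module)
    subst h1
    have h2 := smul_left_injective ℝ hτ0 (add_left_cancel hxy)
    have h3 : r = q := by linarith [h2]
    rw [h3]
  rw [himg]
  refine ⟨measurable_image_of_fderivWithin hsm hderiv hinj, ?_⟩
  rw [← lintegral_abs_det_fderiv_eq_addHaar_image volume hsm hderiv hinj,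
    ← lintegral_indicator hsm, lintegral_polar hn, ← lintegral_indicator hA]
  · refine lintegral_congr fun ξ => ?_
    by_cases hξ : ξ ∈ A
    · rw [indicator_of_mem hξ]
      have h1 : ∀ r ∈ Ioi (0 : ℝ), ENNReal.ofReal (r ^ (n - 1)) *
          s.indicator (fun x => ENNReal.ofReal |(fderiv ℝ (cylinderMap R τ) x).det|)
            (r • (ξ : Eucl n))
          = (Ioo (1 : ℝ) 2).indicator (fun _ => ENNReal.ofReal (R ξ ^ (n - 1) *
          |inner ℝ ((ξ : Eucl n) - (R ξ)⁻¹ • sphereGrad R ξ) τ|)) r := by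
        intro r hr
        have hr0 : 0 < r := hr
        by_cases hr2 : r ∈ Ioo (1 : ℝ) 2
        · rw [indicator_of_mem ((hmem ξ r hr).2 ⟨hξ, hr2⟩), indicator_of_mem hr2,
            (hasFDerivAt_cylinderMap τ ξ hr (hdiff ξ hξ r hr)).fderiv,
            det_cylinder (by have := hRpos ξ; positivity) ξ τ
              (inner_pos_of_dist_le hτ (hAτ ξ hξ)).ne' _
              (by rw [fderiv_radialExtension_smul ξ hr (hdiff ξ hξ r hr), inner_sphereGrad_self,
                mul_zero]) hn,
            fderiv_radialExtension_smul ξ hr (hdiff ξ hξ r hr),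
            ← ENNReal.ofReal_mul (by positivity)]
          have hR := hRpos ξ
          congr 1
          rw [abs_mul, abs_of_pos (by positivity : 0 < (R ξ / r) ^ (n - 1)), div_pow,
            inner_sub_left, inner_smul_left, ← mul_assoc]
          congr 1
          · field_simp
          · congr 2
            simp only [conj_trivial]
            field_simp
        · rw [indicator_of_notMem (fun h => hr2 ((hmem ξ r hr).1 h).2), indicator_of_notMem hr2,
            mul_zero]
      rw [setLIntegral_congr_fun measurableSet_Ioi h1, lintegral_indicator measurableSet_Ioo,
        setLIntegral_const, Measure.restrict_apply measurableSet_Ioo,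
        inter_eq_left.2 (fun x hx => mem_Ioi.2 (by linarith [hx.1])), Real.volume_Ioo]
      norm_num
    · rw [indicator_of_notMem hξ]
      refine (setLIntegral_congr_fun measurableSet_Ioi (g := fun _ => 0) fun r hr => ?_).trans
        (by simp)
      rw [indicator_of_notMem (fun h => hξ ((hmem ξ r hr).1 h).1), mul_zero]
  · exact Measurable.indicator (ENNReal.measurable_ofReal.comp
      ((ContinuousLinearMap.continuous_det.measurable.comp (measurable_fderiv ℝ _)).abs)) hsm

end RadialGraph

/-! ### Hausdorff measure of radial graphs -/

section GraphArea

variable {n : ℕ}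

/-- The Hausdorff measure of a radial graph, as a measure on the sphere of directions. It has this
meaning when `R` is positive and continuous, so that `radialGraph R` is a measurable embedding. -/
noncomputable def graphMeasure (R : USphere n → ℝ) : Measure (USphere n) :=
  (Measure.euclideanHausdorffMeasure (n - 1) : Measure (Eucl n)).comap (radialGraph R)

/-- A piece of the graph projects, along a fixed axis, onto a set of smaller Hausdorff measure. -/
theorem setLIntegral_le_graphMeasure_of_dist_le (hn : 0 < n) {R : USphere n → ℝ} {m : ℝ}
    {L : NNReal} (hL : LipschitzWith L R) (hm : 0 < m) (hmR : ∀ ξ, m ≤ R ξ)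
    (hLm : (L : ℝ) ≤ m / 32) {τ : Eucl n} (hτ : ‖τ‖ = 1) {A : Set (USphere n)}
    (hA : MeasurableSet A) (hAτ : ∀ ξ ∈ A, dist (ξ : Eucl n) τ ≤ 1 / 4) :
    ∫⁻ ξ in A, ENNReal.ofReal (R ξ ^ (n - 1) *
        |inner ℝ ((ξ : Eucl n) - (R ξ)⁻¹ • sphereGrad R ξ) τ|) ∂(sphereMeasure n)
      ≤ graphMeasure R A := by
  have hRpos : ∀ ξ, 0 < R ξ := fun ξ => hm.trans_le (hmR ξ)
  set A' := A ∩ {ξ : USphere n | DifferentiableAt ℝ (radialExtension R) (ξ : Eucl n)} with hA'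
  have hA'm : MeasurableSet A' :=
    hA.inter (measurable_subtype_coe (measurableSet_of_differentiableAt ℝ (radialExtension R)))
  have hae : (A' : Set (USphere n)) =ᵐ[sphereMeasure n] A := by
    refine inter_ae_eq_left_of_ae_eq_univ ?_
    rw [ae_eq_univ]
    exact ae_sphere_differentiableAt hL
  obtain ⟨hT, hvol⟩ := volume_cylinder_radialGraph hn hL hm hmR hLm hτ hA'm
    (fun ξ hξ => hAτ ξ hξ.1) fun ξ hξ => hξ.2
  rw [← setLIntegral_congr hae, ← hvol, graphMeasure,
    (measurableEmbedding_radialGraph hRpos hL.continuous).comap_apply]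
  refine volume_cylinder_le hτ hT ?_ ?_
  · rintro x ⟨ξ, hξ, t, ht, rfl⟩
    exact ⟨_, ⟨ξ, hξ.1, rfl⟩, t, ht, rfl⟩
  · rintro _ ⟨ξ, hξ, rfl⟩ _ ⟨η, hη, rfl⟩ t h
    rw [eq_of_radialGraph_sub_eq_smul hL hm hmR hLm hτ (hAτ ξ hξ) (hAτ η hη) h]

/-- A measure that dominates two densities dominates their supremum. -/
theorem withDensity_sup_le {X : Type*} [MeasurableSpace X] {μ ν : Measure X} {f g : X → ℝ≥0∞}
    (hf : Measurable f) (hg : Measurable g) (hfν : μ.withDensity f ≤ ν)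
    (hgν : μ.withDensity g ≤ ν) : μ.withDensity (f ⊔ g) ≤ ν := by
  refine Measure.le_iff.2 fun A hA => ?_
  have hs : MeasurableSet {x | f x ≤ g x} := measurableSet_le hf hg
  rw [← measure_inter_add_sdiff A hs, ← measure_inter_add_sdiff A hs]
  gcongr ?_ + ?_
  · refine le_trans (le_of_eq ?_) (hgν _)
    rw [withDensity_apply _ (hA.inter hs), withDensity_apply _ (hA.inter hs)]
    refine setLIntegral_congr_fun (hA.inter hs) fun x hx => ?_
    exact sup_eq_right.2 hx.2
  · refine le_trans (le_of_eq ?_) (hfν _)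
    rw [withDensity_apply _ (hA.diff hs), withDensity_apply _ (hA.diff hs)]
    refine setLIntegral_congr_fun (hA.diff hs) fun x hx => ?_
    exact sup_eq_left.2 (le_of_not_ge hx.2)

theorem withDensity_iSup_le {X : Type*} [MeasurableSpace X] {μ ν : Measure X}
    {g : ℕ → X → ℝ≥0∞} (hg : ∀ j, Measurable (g j)) (hgν : ∀ j, μ.withDensity (g j) ≤ ν) :
    μ.withDensity (fun x => ⨆ j, g j x) ≤ ν := by
  have h1 : ∀ k, Measurable (partialSups g k) ∧ μ.withDensity (partialSups g k) ≤ ν := by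
    intro k
    induction k with
    | zero => simpa using ⟨hg 0, hgν 0⟩
    | succ k ih =>
      rw [partialSups_add_one]
      exact ⟨ih.1.sup (hg _), withDensity_sup_le ih.1 (hg _) ih.2 (hgν _)⟩
  refine Measure.le_iff.2 fun A hA => ?_
  have h2 : (fun x => ⨆ j, g j x) = fun x => ⨆ k, partialSups g k x := by
    funext x
    have := congrFun (iSup_partialSups_eq g) x
    simpa only [iSup_apply] using this.symm
  rw [h2, withDensity_apply _ hA, lintegral_iSup (fun k => (h1 k).1) (partialSups_monotone g)]
  refine iSup_le fun k => ?_
  rw [← withDensity_apply _ hA]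
  exact (h1 k).2 A

theorem exists_dense_sphere (hn : 0 < n) : ∃ τ : ℕ → USphere n, DenseRange τ := by
  have := nontrivial_eucl hn
  have : Nonempty (USphere n) := by
    obtain ⟨x, hx⟩ := exists_norm_eq (Eucl n) (zero_le_one' ℝ)
    exact ⟨⟨x, by simpa using hx⟩⟩
  exact ⟨TopologicalSpace.denseSeq _, TopologicalSpace.denseRange_denseSeq _⟩

/-- The vector `ξ - R⁻¹ ∇R` is normal to the radial graph of `R` in direction `ξ`. -/
theorem norm_normal_sq {R : USphere n → ℝ} (ξ : USphere n) :
    ‖(ξ : Eucl n) - (R ξ)⁻¹ • sphereGrad R ξ‖ ^ 2 = 1 + ‖(R ξ)⁻¹ • sphereGrad R ξ‖ ^ 2 := by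
  rw [norm_sub_sq_real, norm_sphere_coe, inner_smul_right, real_inner_comm, inner_sphereGrad_self]
  ring

/-- The area of a radial graph is at least what the area formula predicts. At almost every point
the cylinder bound is used along an axis close to the normal, taken from a countable dense set of
axes. -/
theorem withDensity_le_graphMeasure (hn : 0 < n) {R : USphere n → ℝ} {m : ℝ}
    {L : NNReal} (hL : LipschitzWith L R) (hm : 0 < m) (hmR : ∀ ξ, m ≤ R ξ)
    (hLm : (L : ℝ) ≤ m / 32) :
    (sphereMeasure n).withDensity (fun ξ => ENNReal.ofReal (R ξ ^ (n - 1) *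
        ‖(ξ : Eucl n) - (R ξ)⁻¹ • sphereGrad R ξ‖)) ≤ graphMeasure R := by
  have hRpos : ∀ ξ, 0 < R ξ := fun ξ => hm.trans_le (hmR ξ)
  obtain ⟨τ, hτ⟩ := exists_dense_sphere hn
  set N : USphere n → Eucl n := fun ξ => (ξ : Eucl n) - (R ξ)⁻¹ • sphereGrad R ξ with hN
  have hgm := measurable_sphereGrad R
  have hRm := hL.continuous.measurable
  have hNm : Measurable N := by fun_prop
  set g : ℕ → USphere n → ℝ≥0∞ := fun j => (closedBall (τ j) (1 / 4)).indicator
    fun ξ => ENNReal.ofReal (R ξ ^ (n - 1) * |inner ℝ (N ξ) (τ j : Eucl n)|) with hg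
  have hgmeas : ∀ j, Measurable (g j) := fun j => by
    refine Measurable.indicator ?_ isClosed_closedBall.measurableSet
    have : Measurable fun ξ => inner ℝ (N ξ) (τ j : Eucl n) := hNm.inner_const
    fun_prop
  have h1 : ∀ j, (sphereMeasure n).withDensity (g j) ≤ graphMeasure R := by
    intro j
    refine Measure.le_iff.2 fun A hA => ?_
    rw [withDensity_apply _ hA, setLIntegral_indicator isClosed_closedBall.measurableSet]
    refine (setLIntegral_le_graphMeasure_of_dist_le hn hL hm hmR hLm (norm_sphere_coe (τ j))
      (isClosed_closedBall.measurableSet.inter hA) fun ξ hξ => hξ.1).trans ?_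
    exact measure_mono inter_subset_right
  refine le_trans (withDensity_mono (Eventually.of_forall fun ξ => ?_))
    (withDensity_iSup_le hgmeas h1)
  refine le_of_forall_lt fun c hc => ?_
  have hD : ‖(R ξ)⁻¹ • sphereGrad R ξ‖ ≤ 1 / 16 := by
    have h2 := norm_sphereGrad_le hL ξ
    have h3 := hmR ξ
    have h4 := hRpos ξ
    rw [norm_smul, norm_inv, Real.norm_of_nonneg h4.le, inv_mul_le_iff₀ h4]
    linarith
  have hN1 : ‖N ξ‖ ^ 2 = 1 + ‖(R ξ)⁻¹ • sphereGrad R ξ‖ ^ 2 := norm_normal_sq ξ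
  have hN2 : 1 ≤ ‖N ξ‖ := by nlinarith [norm_nonneg (N ξ), sq_nonneg ‖(R ξ)⁻¹ • sphereGrad R ξ‖]
  have hN3 : ‖N ξ‖ ≤ 17 / 16 := by
    have : ‖N ξ‖ ≤ ‖(ξ : Eucl n)‖ + ‖(R ξ)⁻¹ • sphereGrad R ξ‖ := norm_sub_le _ _
    rw [norm_sphere_coe] at this
    linarith
  have hN0 : N ξ ≠ 0 := norm_pos_iff.1 (by linarith)
  set e := sphereDir (N ξ) hN0 with he
  have heN : ‖N ξ‖ • (e : Eucl n) = N ξ := norm_smul_sphereDir _ _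
  have hie : inner ℝ (N ξ) (e : Eucl n) = ‖N ξ‖ := by
    conv_lhs => rw [← heN]
    rw [inner_smul_left, real_inner_self_eq_norm_sq, norm_sphere_coe]
    simp
  have hdist : dist ξ e < 1 / 4 := by
    rw [Subtype.dist_eq, dist_eq_norm]
    have h5 : (ξ : Eucl n) - e = (ξ - N ξ) + (‖N ξ‖ - 1) • (e : Eucl n) := by
      rw [sub_smul, heN, one_smul]
      abel
    rw [h5]
    refine (norm_add_le _ _).trans_lt ?_
    rw [norm_smul, norm_sphere_coe, mul_one, Real.norm_of_nonneg (by linarith), hN, sub_sub_cancel]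
    linarith
  have hopen : IsOpen {η : USphere n | dist ξ η < 1 / 4 ∧
      c < ENNReal.ofReal (R ξ ^ (n - 1) * |inner ℝ (N ξ) (η : Eucl n)|)} := by
    refine IsOpen.inter ?_ ?_
    · exact isOpen_lt (continuous_const.dist continuous_id) continuous_const
    · exact isOpen_lt continuous_const (ENNReal.continuous_ofReal.comp (by fun_prop))
  obtain ⟨j, hj1, hj2⟩ := hτ.exists_mem_open hopen ⟨e, hdist, by rwa [hie, abs_norm]⟩
  refine hj2.trans_le (le_trans (le_of_eq ?_) (le_iSup (fun j => g j ξ) j))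
  have hj3 : ξ ∈ closedBall (τ j) (1 / 4) := mem_closedBall.2 hj1.le
  simp only [hg, indicator_of_mem hj3]

theorem sphereGrad_const (c : ℝ) (ξ : USphere n) : sphereGrad (fun _ : USphere n => c) ξ = 0 := by
  have h : radialExtension (fun _ : USphere n => c) =ᶠ[𝓝 (ξ : Eucl n)] fun _ => c := by
    filter_upwards [isOpen_ne.mem_nhds (sphere_coe_ne_zero ξ)] with y hy
    exact radialExtension_of_ne _ hy
  rw [sphereGrad, h.gradient_eq]
  simp

/-- An upper bound for the Hausdorff measure of a small piece of the unit sphere, which is nearly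
flat. -/
theorem graphMeasure_one_le_of_dist_le (hn : 0 < n) {τ : USphere n} {κ : ℝ} (hκ : 0 < κ)
    (hκ4 : κ ≤ 1 / 4) {A : Set (USphere n)} (hA : MeasurableSet A) (hAτ : A ⊆ closedBall τ κ) :
    graphMeasure (fun _ : USphere n => (1 : ℝ)) A
      ≤ ENNReal.ofReal ((1 - κ)⁻¹) ^ (n - 1) * sphereMeasure n A := by
  have hL : LipschitzWith 0 (fun _ : USphere n => (1 : ℝ)) := LipschitzWith.const 1
  have hτ := norm_sphere_coe τ
  have hd : ∀ ξ : USphere n, DifferentiableAt ℝ (radialExtension fun _ : USphere n => (1 : ℝ))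
      (ξ : Eucl n) := fun ξ => by
    have h : radialExtension (fun _ : USphere n => (1 : ℝ)) =ᶠ[𝓝 (ξ : Eucl n)] fun _ => 1 := by
      filter_upwards [isOpen_ne.mem_nhds (sphere_coe_ne_zero ξ)] with y hy
      exact radialExtension_of_ne _ hy
    exact (differentiableAt_const (1 : ℝ)).congr_of_eventuallyEq h
  obtain ⟨hT, hvol⟩ := volume_cylinder_radialGraph hn hL one_pos (fun _ => le_rfl) (by simp)
    hτ hA (fun ξ hξ => (mem_closedBall.1 (hAτ hξ)).trans hκ4) fun ξ _ => hd ξ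
  have h1 : graphMeasure (fun _ : USphere n => (1 : ℝ)) A ≤ ENNReal.ofReal ((1 - κ)⁻¹) ^ (n - 1)
      * volume {x | ∃ ξ ∈ A, ∃ t ∈ Ioo (0 : ℝ) 1,
        x = radialGraph (fun _ => (1 : ℝ)) ξ + t • (τ : Eucl n)} := by
    rw [graphMeasure, (measurableEmbedding_radialGraph (fun _ => one_pos)
      hL.continuous).comap_apply]
    refine euclideanHausdorffMeasure_le_volume_cylinder hτ hT ?_ (C := ((1 - κ)⁻¹).toNNReal) ?_
    · rintro _ ⟨ξ, hξ, rfl⟩ t ht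
      exact ⟨ξ, hξ, t, ht, rfl⟩
    · rintro _ ⟨ξ, hξ, rfl⟩ _ ⟨η, hη, rfl⟩
      simp only [radialGraph, one_smul]
      rw [Real.coe_toNNReal _ (inv_nonneg.2 (by linarith)), le_inv_mul_iff₀ (by linarith),
        dist_eq_norm, dist_eq_norm, ← map_sub]
      have h2 := exists_eq_smul_add_orthogonalProjection hτ ((ξ : Eucl n) - η)
      have h3 := norm_add_le ((inner ℝ (τ : Eucl n) ((ξ : Eucl n) - η) : ℝ) • (τ : Eucl n))
        (((ℝ ∙ (τ : Eucl n))ᗮ : Submodule ℝ (Eucl n)).orthogonalProjectionOnto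
          ((ξ : Eucl n) - η) : Eucl n)
      have h5 : ‖((((ℝ ∙ (τ : Eucl n))ᗮ : Submodule ℝ (Eucl n)).orthogonalProjectionOnto
          ((ξ : Eucl n) - η)) : Eucl n)‖ = ‖((ℝ ∙ (τ : Eucl n))ᗮ :
            Submodule ℝ (Eucl n)).orthogonalProjectionOnto ((ξ : Eucl n) - η)‖ := rfl
      rw [← h2, norm_smul, hτ, mul_one, Real.norm_eq_abs, h5] at h3
      have h4 := abs_inner_sub_le (τ := (τ : Eucl n)) (κ := κ) (hAτ hξ) (hAτ hη)
      linarith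
  refine h1.trans ?_
  gcongr
  rw [hvol, ← setLIntegral_one]
  refine setLIntegral_mono measurable_const fun ξ _ => ?_
  rw [sphereGrad_const, smul_zero, sub_zero, one_pow, one_mul]
  have := abs_real_inner_le_norm (ξ : Eucl n) τ
  rw [norm_sphere_coe, norm_sphere_coe, one_mul] at this
  simpa using this

/-- On the unit sphere the Hausdorff measure is the surface measure: the sphere is cut into pieces
of diameter tending to zero. -/
theorem graphMeasure_one (hn : 0 < n) :
    graphMeasure (fun _ : USphere n => (1 : ℝ)) = sphereMeasure n := by
  refine le_antisymm ?_ ?_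
  · refine Measure.le_iff.2 fun A hA => ?_
    have key : ∀ κ : ℝ, 0 < κ → κ ≤ 1 / 4 → graphMeasure (fun _ : USphere n => (1 : ℝ)) A
        ≤ ENNReal.ofReal ((1 - κ)⁻¹) ^ (n - 1) * sphereMeasure n A := by
      intro κ hκ hκ4
      obtain ⟨τ, hτ⟩ := exists_dense_sphere hn
      set D := disjointed fun j => closedBall (τ j) κ with hD
      have hDm : ∀ j, MeasurableSet (D j) :=
        MeasurableSet.disjointed fun j => isClosed_closedBall.measurableSet
      have hU : (⋃ j, A ∩ D j) = A := by
        rw [← inter_iUnion, hD, iUnion_disjointed, inter_eq_left]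
        intro ξ _
        obtain ⟨j, hj⟩ := hτ.exists_dist_lt ξ hκ
        exact mem_iUnion.2 ⟨j, mem_closedBall.2 hj.le⟩
      have hdisj : Pairwise (Function.onFun Disjoint fun j => A ∩ D j) := fun i j hij =>
        (disjoint_disjointed _ hij).mono inter_subset_right inter_subset_right
      rw [← hU, measure_iUnion hdisj fun j => hA.inter (hDm j),
        measure_iUnion hdisj fun j => hA.inter (hDm j), ← ENNReal.tsum_mul_left]
      exact ENNReal.tsum_le_tsum fun j => graphMeasure_one_le_of_dist_le hn hκ hκ4
        (hA.inter (hDm j)) (inter_subset_right.trans (disjointed_subset _ _))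
    have hlim : Tendsto (fun κ : ℝ => ENNReal.ofReal ((1 - κ)⁻¹) ^ (n - 1) * sphereMeasure n A)
        (𝓝[>] 0) (𝓝 (ENNReal.ofReal ((1 - 0)⁻¹) ^ (n - 1) * sphereMeasure n A)) := by
      refine ENNReal.Tendsto.mul_const (ENNReal.Tendsto.pow ?_) (Or.inr (measure_ne_top _ _))
      refine (ENNReal.continuous_ofReal.tendsto _).comp (Tendsto.mono_left ?_ nhdsWithin_le_nhds)
      have : ContinuousAt (fun κ : ℝ => (1 - κ)⁻¹) 0 :=
        ContinuousAt.inv₀ (by fun_prop) (by norm_num)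
      exact this
    simp only [sub_zero, inv_one, ENNReal.ofReal_one, one_pow, one_mul] at hlim
    refine ge_of_tendsto hlim ?_
    filter_upwards [Ioc_mem_nhdsGT (show (0 : ℝ) < 1 / 4 by norm_num)] with κ hκ
    exact key κ hκ.1 hκ.2
  · have h := withDensity_le_graphMeasure hn (R := fun _ : USphere n => (1 : ℝ))
      (LipschitzWith.const 1) one_pos (fun _ => le_rfl) (by simp)
    simpa [sphereGrad_const, norm_sphere_coe] using h

theorem graphMeasure_univ_lt_top (hn : 0 < n) {R : USphere n → ℝ} (hR : ∀ ξ, 0 < R ξ)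
    {L : NNReal} (hL : LipschitzWith L R) : graphMeasure R univ < ∞ := by
  obtain ⟨M, hM⟩ := (isCompact_univ (X := USphere n)).exists_bound_of_continuousOn
    hL.continuous.continuousOn
  have hlip : LipschitzWith (max M 0 + L).toNNReal (radialGraph R) := by
    refine LipschitzWith.of_dist_le_mul fun ξ η => ?_
    rw [Real.coe_toNNReal _ (by positivity), dist_eq_norm, Subtype.dist_eq, dist_eq_norm]
    have h1 : radialGraph R ξ - radialGraph R η
        = R ξ • ((ξ : Eucl n) - η) + (R ξ - R η) • (η : Eucl n) := by
      rw [radialGraph, radialGraph]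
      module
    have h2 := hL.dist_le_mul ξ η
    rw [Real.dist_eq, Subtype.dist_eq, dist_eq_norm] at h2
    have h3 : |R ξ| ≤ max M 0 := (hM ξ trivial).trans (le_max_left _ _)
    rw [h1]
    refine (norm_add_le _ _).trans ?_
    rw [norm_smul, norm_smul, norm_sphere_coe, mul_one, Real.norm_eq_abs, Real.norm_eq_abs, add_mul]
    gcongr
  have h1 : (Measure.euclideanHausdorffMeasure (n - 1) : Measure (USphere n)) univ
      = sphereMeasure n univ := by
    have h2 : radialGraph (fun _ : USphere n => (1 : ℝ)) = Subtype.val := by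
      funext ξ
      simp [radialGraph]
    rw [← graphMeasure_one hn, graphMeasure, (measurableEmbedding_radialGraph (fun _ => one_pos)
      continuous_const).comap_apply, h2, isometry_subtype_coe.euclideanHausdorffMeasure_image]
  have h3 := euclideanHausdorffMeasure_image_le hlip (n - 1) univ
  rw [graphMeasure, (measurableEmbedding_radialGraph hR hL.continuous).comap_apply]
  refine h3.trans_lt ?_
  rw [h1]
  exact ENNReal.mul_lt_top (by simp) (measure_lt_top _ _)

/-- The area of spheres. -/
theorem graphMeasure_const (hn : 0 < n) {ρ : ℝ} (hρ : 0 < ρ) :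
    graphMeasure (fun _ : USphere n => ρ) = ENNReal.ofReal (ρ ^ (n - 1)) • sphereMeasure n := by
  refine le_antisymm ?_ ?_
  · refine Measure.le_iff.2 fun A hA => ?_
    have hlip : LipschitzWith ρ.toNNReal (fun x : Eucl n => ρ • x) :=
      LipschitzWith.of_dist_le_mul fun x y => by
        rw [dist_smul₀, Real.coe_toNNReal _ hρ.le, Real.norm_of_nonneg hρ.le]
    have h1 := euclideanHausdorffMeasure_image_le hlip (n - 1)
      (radialGraph (fun _ : USphere n => (1 : ℝ)) '' A)
    rw [← (measurableEmbedding_radialGraph (fun _ => one_pos) continuous_const).comap_apply,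
      ← graphMeasure, graphMeasure_one hn, ← image_comp] at h1
    have h2 : (fun x : Eucl n => ρ • x) ∘ radialGraph (fun _ : USphere n => (1 : ℝ))
        = radialGraph (fun _ : USphere n => ρ) := by
      funext ξ
      simp [radialGraph]
    rw [h2] at h1
    rw [graphMeasure, (measurableEmbedding_radialGraph (fun _ => hρ) continuous_const).comap_apply]
    refine h1.trans (le_of_eq ?_)
    rw [Measure.smul_apply, smul_eq_mul, ENNReal.ofReal_pow hρ.le]
    rfl
  · have h := withDensity_le_graphMeasure hn (R := fun _ : USphere n => ρ)
      (LipschitzWith.const ρ) hρ (fun _ => le_rfl) (by simp only [NNReal.coe_zero]; positivity)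
    simpa [sphereGrad_const, norm_sphere_coe] using h

end GraphArea

/-! ### Smooth functions in the trace eigenvalue problem -/

section Trace

variable {n : ℕ}

theorem continuous_gradient_of_contDiff {φ : Eucl n → ℝ} (hφ : ContDiff ℝ (⊤ : ℕ∞) φ) :
    Continuous (gradient φ) :=
  (InnerProductSpace.toDual ℝ (Eucl n)).symm.continuous.comp
    (hφ.continuous_fderiv (by simp))

theorem inner_gradient_eq_fderiv (φ : Eucl n → ℝ) (x w : Eucl n) :
    inner ℝ (gradient φ x) w = fderiv ℝ φ x w := inner_gradient_left

theorem memLp_two_of_continuous {F : Type*} [NormedAddCommGroup F] [SecondCountableTopology F]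
    {μ : Measure (Eucl n)} [IsFiniteMeasure μ] {s : Set (Eucl n)} (hs : Bornology.IsBounded s)
    (hμ : ∀ᵐ x ∂μ, x ∈ s) {f : Eucl n → F} (hf : Continuous f) : MemLp f 2 μ := by
  obtain ⟨C, hC⟩ := hs.isCompact_closure.exists_bound_of_continuousOn hf.continuousOn
  refine MemLp.of_bound hf.aestronglyMeasurable C ?_
  filter_upwards [hμ] with x hx
  exact hC x (subset_closure hx)

theorem isFiniteMeasure_restrict_of_isBounded {s : Set (Eucl n)} (hs : Bornology.IsBounded s) :
    IsFiniteMeasure (volume.restrict s) :=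
  ⟨by rw [Measure.restrict_apply_univ]; exact hs.measure_lt_top⟩

theorem memLp_two_restrict_of_continuous {F : Type*} [NormedAddCommGroup F]
    [SecondCountableTopology F] {U : Set (Eucl n)} (hU : Bornology.IsBounded U)
    (hUm : MeasurableSet U) {f : Eucl n → F} (hf : Continuous f) :
    MemLp f 2 (volume.restrict U) := by
  have := isFiniteMeasure_restrict_of_isBounded hU
  exact memLp_two_of_continuous hU (ae_restrict_mem hUm) hf

theorem isBounded_frontier {U : Set (Eucl n)} (hU : Bornology.IsBounded U) :
    Bornology.IsBounded (frontier U) := hU.closure.subset frontier_subset_closure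

theorem memLp_two_boundaryMeasure_of_continuous {F : Type*} [NormedAddCommGroup F]
    [SecondCountableTopology F] {U : Set (Eucl n)} (hU : Bornology.IsBounded U)
    [IsFiniteMeasure (boundaryMeasure U)] {f : Eucl n → F} (hf : Continuous f) :
    MemLp f 2 (boundaryMeasure U) :=
  memLp_two_of_continuous (μ := boundaryMeasure U) (isBounded_frontier hU)
    (ae_restrict_mem isClosed_frontier.measurableSet) hf

theorem hasWeakGradient_of_contDiff {U : Set (Eucl n)} {w : Eucl n → ℝ}
    (hw : ContDiff ℝ (⊤ : ℕ∞) w) : HasWeakGradient U w (gradient w) := by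
  refine ⟨hw.continuous.locallyIntegrable.locallyIntegrableOn _,
    (continuous_gradient_of_contDiff hw).locallyIntegrable.locallyIntegrableOn _, ?_⟩
  intro φ hφ hφc hφU
  have hgφ := continuous_gradient_of_contDiff hφ
  have hgw := continuous_gradient_of_contDiff hw
  have hgc : HasCompactSupport (gradient φ) :=
    (hφc.fderiv (𝕜 := ℝ)).comp_left (map_zero (InnerProductSpace.toDual ℝ (Eucl n)).symm)
  have hz : ∀ x ∉ U, φ x = 0 := fun x hx =>
    image_eq_zero_of_notMem_tsupport fun h => hx (hφU h)
  have hgz : ∀ x ∉ U, gradient φ x = 0 := fun x hx => by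
    have : fderiv ℝ φ x = 0 := by
      by_contra h
      exact hx (hφU (support_fderiv_subset ℝ h))
    simp [gradient, this]
  rw [setIntegral_eq_integral_of_forall_compl_eq_zero fun x hx => by rw [hgz x hx, smul_zero],
    setIntegral_eq_integral_of_forall_compl_eq_zero fun x hx => by rw [hz x hx, zero_smul]]
  have hi1 : Integrable (fun x => w x • gradient φ x) :=
    (hw.continuous.smul hgφ).integrable_of_hasCompactSupport hgc.smul_left
  have hi2 : Integrable (fun x => φ x • gradient w x) :=
    (hφ.continuous.smul hgw).integrable_of_hasCompactSupport hφc.smul_right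
  refine ext_inner_right ℝ fun v => ?_
  rw [inner_neg_left, real_inner_comm, ← integral_inner hi1, real_inner_comm, ← integral_inner hi2]
  have e1 : ∀ x, inner ℝ v (w x • gradient φ x) = w x * fderiv ℝ φ x v := fun x => by
    rw [inner_smul_right, real_inner_comm, inner_gradient_eq_fderiv]
  have e2 : ∀ x, inner ℝ v (φ x • gradient w x) = fderiv ℝ w x v * φ x := fun x => by
    rw [inner_smul_right, real_inner_comm, inner_gradient_eq_fderiv, mul_comm]
  have hi1' : Integrable (fun x => w x * fderiv ℝ φ x v) :=
    (hi1.const_inner v).congr (Eventually.of_forall e1)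
  have hi2' : Integrable (fun x => fderiv ℝ w x v * φ x) :=
    (hi2.const_inner v).congr (Eventually.of_forall e2)
  simp only [e1, e2]
  exact integral_mul_fderiv_eq_neg_fderiv_mul_of_integrable hi2' hi1'
    ((hw.continuous.mul hφ.continuous).integrable_of_hasCompactSupport hφc.mul_left)
    (fun x _ => (hw.differentiable (by simp)) x) fun x _ => (hφ.differentiable (by simp)) x

theorem memH1_of_contDiff {U : Set (Eucl n)} (hU : Bornology.IsBounded U) (hUm : MeasurableSet U)
    {w : Eucl n → ℝ} (hw : ContDiff ℝ (⊤ : ℕ∞) w) : MemH1 U w (gradient w) :=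
  ⟨memLp_two_restrict_of_continuous hU hUm hw.continuous,
    memLp_two_restrict_of_continuous hU hUm (continuous_gradient_of_contDiff hw),
    hasWeakGradient_of_contDiff hw⟩

/-- A smooth function is its own trace. -/
theorem hasTrace_of_contDiff {U : Set (Eucl n)} (hU : Bornology.IsBounded U)
    [IsFiniteMeasure (boundaryMeasure U)] {w : Eucl n → ℝ} (hw : ContDiff ℝ (⊤ : ℕ∞) w) :
    HasTrace U w (gradient w) w := by
  refine ⟨memLp_two_boundaryMeasure_of_continuous hU hw.continuous, fun _ => w, fun _ => hw, ?_⟩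
  simp

/-- Smooth functions are admissible in the variational problem for the trace eigenvalue. -/
theorem traceEigenvalue_le_of_contDiff {U : Set (Eucl n)} (hU : Bornology.IsBounded U)
    (hUm : MeasurableSet U) [IsFiniteMeasure (boundaryMeasure U)] {w : Eucl n → ℝ}
    (hw : ContDiff ℝ (⊤ : ℕ∞) w) (hpos : 0 < ∫ x, w x ^ 2 ∂(boundaryMeasure U)) :
    traceEigenvalue U
      ≤ (∫ x in U, (‖gradient w x‖ ^ 2 + w x ^ 2)) / ∫ x, w x ^ 2 ∂(boundaryMeasure U) := by
  have hi1 := (memLp_two_restrict_of_continuous hU hUm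
    (continuous_gradient_of_contDiff hw)).integrable_norm_pow (by norm_num)
  have hi2 := (memLp_two_restrict_of_continuous hU hUm hw.continuous).integrable_sq
  refine csInf_le ⟨0, ?_⟩ ⟨w, gradient w, w, memH1_of_contDiff hU hUm hw,
    hasTrace_of_contDiff hU hw, hpos, ?_⟩
  · rintro q ⟨w', g', t', -, -, hp, rfl⟩
    exact div_nonneg (add_nonneg (integral_nonneg fun _ => by positivity)
      (integral_nonneg fun _ => by positivity)) hp.le
  · rw [integral_add (by simpa using hi1) hi2]

theorem tendsto_integral_norm_sq {α F : Type*} [MeasurableSpace α] [NormedAddCommGroup F]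
    {μ : Measure α} {f : ℕ → α → F} {g : α → F} (hf : ∀ k, MemLp (f k) 2 μ) (hg : MemLp g 2 μ)
    (h : Tendsto (fun k => eLpNorm (fun x => f k x - g x) 2 μ) atTop (𝓝 0)) :
    Tendsto (fun k => ∫ x, ‖f k x‖ ^ 2 ∂μ) atTop (𝓝 (∫ x, ‖g x‖ ^ 2 ∂μ)) := by
  have h1 : Tendsto (fun k => (hf k).toLp (f k)) atTop (𝓝 (hg.toLp g)) := by
    rw [Lp.tendsto_Lp_iff_tendsto_eLpNorm'']
    exact h
  have h2 : ∀ {u : α → F} (hu : MemLp u 2 μ), ‖hu.toLp u‖ ^ 2 = ∫ x, ‖u x‖ ^ 2 ∂μ := by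
    intro u hu
    have hnn : 0 ≤ ∫ x, ‖u x‖ ^ 2 ∂μ := integral_nonneg fun _ => by positivity
    rw [Lp.norm_toLp, hu.eLpNorm_eq_integral_rpow_norm (by norm_num) (by norm_num),
      ENNReal.toReal_ofReal (by positivity)]
    simp only [ENNReal.toReal_ofNat, Real.rpow_ofNat]
    rw [← Real.rpow_natCast, ← Real.rpow_mul hnn]
    norm_num
  simpa only [h2] using h1.norm.pow 2

/-- For a lower bound of the trace eigenvalue it suffices to test smooth functions, as traces are
defined by smooth approximation. -/
theorem le_traceEigenvalue {U : Set (Eucl n)} (hU : Bornology.IsBounded U) (hUm : MeasurableSet U)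
    [IsFiniteMeasure (boundaryMeasure U)] {h : ℝ}
    (hpos : 0 < boundaryMeasure U univ)
    (H : ∀ φ : Eucl n → ℝ, ContDiff ℝ (⊤ : ℕ∞) φ →
      h * ∫ x, φ x ^ 2 ∂(boundaryMeasure U) ≤ ∫ x in U, (‖gradient φ x‖ ^ 2 + φ x ^ 2)) :
    h ≤ traceEigenvalue U := by
  have h1 : 0 < ∫ x, (1 : ℝ) ^ 2 ∂(boundaryMeasure U) := by
    simpa [measureReal_def, ENNReal.toReal_pos_iff] using hpos
  -- the constant function `1` shows that the infimum is not that of the empty set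
  refine le_csInf ⟨_, fun _ => 1, gradient fun _ => 1, fun _ => 1,
    memH1_of_contDiff hU hUm contDiff_const, hasTrace_of_contDiff hU contDiff_const, h1, rfl⟩ ?_
  rintro q ⟨w, g, t, ⟨hw, hg, -⟩, ⟨ht, φ, hφ, hφw, hφg, hφt⟩, hp, rfl⟩
  have c1 := fun k => memLp_two_restrict_of_continuous hU hUm (hφ k).continuous
  have c2 := fun k => memLp_two_restrict_of_continuous hU hUm
    (continuous_gradient_of_contDiff (hφ k))
  have c3 := fun k => memLp_two_boundaryMeasure_of_continuous hU (hφ k).continuous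
  have l1 := tendsto_integral_norm_sq c1 hw hφw
  have l2 := tendsto_integral_norm_sq c2 hg hφg
  have l3 := tendsto_integral_norm_sq c3 ht hφt
  simp only [Real.norm_eq_abs, sq_abs] at l1 l3
  rw [le_div_iff₀ hp]
  refine le_of_tendsto_of_tendsto' (l3.const_mul h) (l2.add l1) fun k => ?_
  refine (H _ (hφ k)).trans (le_of_eq ?_)
  exact integral_add (by simpa using (c2 k).integrable_norm_pow (by norm_num)) (c1 k).integrable_sq

theorem sub_image_eq_preimage (c : Eucl n) (U : Set (Eucl n)) :
    (fun x => x - c) '' U = (fun x => x + c) ⁻¹' U := by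
  ext x
  constructor
  · rintro ⟨y, hy, rfl⟩
    simpa using hy
  · intro hx
    exact ⟨x + c, hx, by simp⟩

theorem boundaryMeasure_sub_image (c : Eucl n) (U : Set (Eucl n)) :
    boundaryMeasure ((fun x => x - c) '' U) = (boundaryMeasure U).map fun x => x - c := by
  have h1 : frontier ((fun x => x - c) '' U) = (fun x => x - c) '' frontier U :=
    ((Homeomorph.subRight c).image_frontier U).symm
  have h2 : MeasurePreserving (fun x : Eucl n => x - c)
      (Measure.euclideanHausdorffMeasure (n - 1)) (Measure.euclideanHausdorffMeasure (n - 1)) :=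
    (IsometryEquiv.subRight c).measurePreserving_euclideanHausdorffMeasure (n - 1)
  have h3 := h2.restrict_preimage (s := (fun x => x - c) '' frontier U) (by
    rw [← h1]; exact isClosed_frontier.measurableSet)
  rw [preimage_image_eq _ (sub_left_injective (b := c))] at h3
  rw [boundaryMeasure, boundaryMeasure, h1, h3.map_eq]

theorem setIntegral_sub_image (c : Eucl n) (U : Set (Eucl n)) (F : Eucl n → ℝ) :
    ∫ x in (fun x => x - c) '' U, F x = ∫ x in U, F (x - c) := by
  have h := (measurePreserving_sub_right (volume : Measure (Eucl n)) c).setIntegral_preimage_emb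
    (MeasurableEquiv.subRight c).measurableEmbedding F ((fun x => x - c) '' U)
  rw [preimage_image_eq _ (sub_left_injective (b := c))] at h
  exact h.symm

/-- The translate of the Bessel weight is admissible for the trace eigenvalue. -/
theorem traceEigenvalue_le_weighted (hn : 0 < n) {U : Set (Eucl n)} (hU : Bornology.IsBounded U)
    (hUm : MeasurableSet U) [IsFiniteMeasure (boundaryMeasure U)] (c : Eucl n)
    (hpos : 0 < weightedPerimeter ((fun x => x - c) '' U)) :
    traceEigenvalue U ≤ weightedVolume ((fun x => x - c) '' U)
      / weightedPerimeter ((fun x => x - c) '' U) := by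
  have hw : ContDiff ℝ (⊤ : ℕ∞) fun x : Eucl n => besselWeight n (x - c) :=
    (contDiff_besselWeight hn).comp (contDiff_id.sub contDiff_const)
  have h1 : weightedPerimeter ((fun x => x - c) '' U)
      = ∫ x, besselWeight n (x - c) ^ 2 ∂(boundaryMeasure U) := by
    rw [weightedPerimeter, boundaryMeasure_sub_image]
    exact (MeasurableEquiv.subRight c).measurableEmbedding.integral_map _
  have h2 : weightedVolume ((fun x => x - c) '' U)
      = ∫ x in U, (‖gradient (fun x : Eucl n => besselWeight n (x - c)) x‖ ^ 2
          + besselWeight n (x - c) ^ 2) := by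
    rw [weightedVolume, setIntegral_sub_image]
    simp only [gradient, fderiv_comp_sub]
  rw [h1] at hpos ⊢
  rw [h2]
  exact traceEigenvalue_le_of_contDiff hU hUm hw hpos

end Trace

/-! ### Radial domains -/

section RadialDomain

variable {n : ℕ}

/-- `U` is, up to the origin, the star-shaped domain with radial function `R`. -/
def IsRadialDomain (U : Set (Eucl n)) (R : USphere n → ℝ) : Prop :=
  ∀ (ξ : USphere n) (r : ℝ), 0 < r → (r • (ξ : Eucl n) ∈ U ↔ r < R ξ)

theorem setIntegral_radialDomain (hn : 0 < n) {U : Set (Eucl n)} {R : USphere n → ℝ}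
    (hUR : IsRadialDomain U R) (hR : ∀ ξ, 0 < R ξ) (hU : Bornology.IsBounded U)
    (hUm : MeasurableSet U) {F : Eucl n → ℝ} (hF : Continuous F) :
    ∫ x in U, F x
      = ∫ ξ, (∫ r in 0..R ξ, r ^ (n - 1) * F (r • (ξ : Eucl n))) ∂(sphereMeasure n) := by
  have hi : Integrable (U.indicator F) := by
    rw [integrable_indicator_iff hUm]
    have := isFiniteMeasure_restrict_of_isBounded hU
    exact (memLp_two_restrict_of_continuous hU hUm hF).integrable (by norm_num)
  rw [← integral_indicator hUm, integral_polar hn hi]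
  refine integral_congr_ae (Eventually.of_forall fun ξ => ?_)
  simp only
  have h1 : ∀ r ∈ Ioi (0 : ℝ), r ^ (n - 1) * U.indicator F (r • (ξ : Eucl n))
      = (Iio (R ξ)).indicator (fun r => r ^ (n - 1) * F (r • (ξ : Eucl n))) r := by
    intro r hr
    by_cases h : r < R ξ
    · rw [indicator_of_mem ((hUR ξ r hr).2 h), indicator_of_mem (mem_Iio.2 h)]
    · rw [indicator_of_notMem (fun h' => h ((hUR ξ r hr).1 h')),
        indicator_of_notMem (by simpa using h), mul_zero]
  rw [setIntegral_congr_fun measurableSet_Ioi h1, setIntegral_indicator measurableSet_Iio,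
    Ioi_inter_Iio, intervalIntegral.integral_of_le (hR ξ).le, integral_Ioc_eq_integral_Ioo]

theorem norm_gradient_besselWeight (hn : 0 < n) {x : Eucl n} (hx : x ≠ 0) :
    ‖gradient (besselWeight n) x‖ = ‖x‖ * besselSlope n ‖x‖ := by
  have h1 : besselWeight n = besselProfile n ∘ norm := funext besselWeight_eq_besselProfile
  have h2 := (hasDerivAt_besselProfile hn ‖x‖).comp_hasFDerivAt x (hasFDerivAt_norm_of_ne hx)
  rw [← h1] at h2
  have h3 : gradient (besselWeight n) x = besselSlope n ‖x‖ • x := by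
    refine ext_inner_right ℝ fun w => ?_
    rw [inner_gradient_eq_fderiv, h2.fderiv, inner_smul_left]
    simp only [smul_apply, innerSL_apply_apply, smul_eq_mul, conj_trivial]
    field_simp [norm_ne_zero_iff.2 hx]
  rw [h3, norm_smul, Real.norm_of_nonneg (besselSlope_pos _).le, mul_comm]

/-- The weighted volume, per unit solid angle, of the ball of radius `r`. -/
noncomputable def besselFlux (n : ℕ) (r : ℝ) : ℝ := besselProfile n r * besselSlope n r * r ^ n

theorem hasDerivAt_besselFlux (hn : 0 < n) (r : ℝ) :
    HasDerivAt (besselFlux n)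
      (r ^ (n - 1) * ((r * besselSlope n r) ^ 2 + besselProfile n r ^ 2)) r := by
  have hk := hasDerivAt_besselSlope (n := n) r
  have hode := mul_deriv_besselSlope hn r
  have h := ((hasDerivAt_besselProfile hn r).mul hk.differentiableAt.hasDerivAt).mul
    (hasDerivAt_pow n r)
  refine h.congr_deriv ?_
  obtain ⟨k, rfl⟩ := Nat.exists_eq_succ_of_ne_zero hn.ne'
  simp only [Nat.succ_eq_add_one, Nat.add_sub_cancel, Pi.mul_apply] at hode ⊢
  rw [pow_succ]
  linear_combination (besselProfile (k + 1) r * r ^ k) * hode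

/-- The weighted volume as a boundary integral: `|∇z|² + z²` is the divergence of `z ∇z`. -/
theorem weightedVolume_radialDomain (hn : 0 < n) {U : Set (Eucl n)} {R : USphere n → ℝ}
    (hUR : IsRadialDomain U R) (hR : ∀ ξ, 0 < R ξ) (hU : Bornology.IsBounded U)
    (hUm : MeasurableSet U) : weightedVolume U = ∫ ξ, besselFlux n (R ξ) ∂(sphereMeasure n) := by
  have hz := contDiff_besselWeight hn
  have hcF : Continuous fun x : Eucl n =>
      ‖gradient (besselWeight n) x‖ ^ 2 + besselWeight n x ^ 2 :=
    ((continuous_gradient_of_contDiff hz).norm.pow 2).add (hz.continuous.pow 2)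
  rw [weightedVolume, setIntegral_radialDomain hn hUR hR hU hUm hcF]
  refine integral_congr_ae (Eventually.of_forall fun ξ => ?_)
  simp only
  have h1 : ∫ r in 0..R ξ, r ^ (n - 1) * (‖gradient (besselWeight n) (r • (ξ : Eucl n))‖ ^ 2
        + besselWeight n (r • (ξ : Eucl n)) ^ 2)
      = ∫ r in 0..R ξ, r ^ (n - 1) * ((r * besselSlope n r) ^ 2 + besselProfile n r ^ 2) := by
    refine intervalIntegral.integral_congr_ae (Eventually.of_forall fun r hr => ?_)
    rw [uIoc_of_le (hR ξ).le] at hr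
    rw [norm_gradient_besselWeight hn (smul_ne_zero hr.1.ne' (sphere_coe_ne_zero ξ)),
      besselWeight_eq_besselProfile, norm_smul_sphere_coe hr.1.le]
  have hc : Continuous fun r : ℝ =>
      r ^ (n - 1) * ((r * besselSlope n r) ^ 2 + besselProfile n r ^ 2) := by
    have h2 := (contDiff_besselProfile hn).continuous
    have h3 := (contDiff_besselSlope (n := n)).continuous
    fun_prop
  rw [h1, intervalIntegral.integral_eq_sub_of_hasDerivAt (fun r _ => hasDerivAt_besselFlux hn r)
    (hc.intervalIntegrable _ _)]
  simp [besselFlux, hn.ne']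

theorem volume_radialDomain (hn : 0 < n) {U : Set (Eucl n)} {R : USphere n → ℝ}
    (hUR : IsRadialDomain U R) (hR : ∀ ξ, 0 < R ξ) (hU : Bornology.IsBounded U)
    (hUm : MeasurableSet U) :
    volume.real U = 1 / (n : ℝ) * ∫ ξ, R ξ ^ n ∂(sphereMeasure n) := by
  have h := setIntegral_radialDomain hn hUR hR hU hUm (F := fun _ => 1) continuous_const
  rw [setIntegral_const, smul_eq_mul, mul_one] at h
  rw [h, ← integral_const_mul]
  refine integral_congr_ae (Eventually.of_forall fun ξ => ?_)
  obtain ⟨k, rfl⟩ := Nat.exists_eq_succ_of_ne_zero hn.ne'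
  simp
  ring

theorem boundaryMeasure_eq_map {U : Set (Eucl n)} {R : USphere n → ℝ} (hR : ∀ ξ, 0 < R ξ)
    (hc : Continuous R) (hU : frontier U = range (radialGraph R)) :
    boundaryMeasure U = (graphMeasure R).map (radialGraph R) := by
  rw [boundaryMeasure, graphMeasure, (measurableEmbedding_radialGraph hR hc).map_comap, hU]

theorem isFiniteMeasure_boundaryMeasure (hn : 0 < n) {U : Set (Eucl n)} {R : USphere n → ℝ}
    (hR : ∀ ξ, 0 < R ξ) {L : NNReal} (hL : LipschitzWith L R)
    (hU : frontier U = range (radialGraph R)) : IsFiniteMeasure (boundaryMeasure U) := by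
  have : IsFiniteMeasure (graphMeasure R) := ⟨graphMeasure_univ_lt_top hn hR hL⟩
  rw [boundaryMeasure_eq_map hR hL.continuous hU]
  infer_instance

theorem weightedPerimeter_eq {U : Set (Eucl n)} {R : USphere n → ℝ}
    (hR : ∀ ξ, 0 < R ξ) (hc : Continuous R) (hU : frontier U = range (radialGraph R)) :
    weightedPerimeter U = ∫ ξ, besselProfile n (R ξ) ^ 2 ∂(graphMeasure R) := by
  rw [weightedPerimeter, boundaryMeasure_eq_map hR hc hU,
    (measurableEmbedding_radialGraph hR hc).integral_map]
  simp only [besselWeight_eq_besselProfile, norm_radialGraph hR]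

theorem frontier_ball_eq_range {ρ : ℝ} (hρ : 0 < ρ) :
    frontier (ball (0 : Eucl n) ρ) = range (radialGraph fun _ : USphere n => ρ) := by
  rw [frontier_ball _ hρ.ne']
  ext x
  constructor
  · intro hx
    rw [mem_sphere_zero_iff_norm] at hx
    have hx0 : x ≠ 0 := norm_pos_iff.1 (hx ▸ hρ)
    exact ⟨sphereDir x hx0, by rw [radialGraph, ← hx, norm_smul_sphereDir]⟩
  · rintro ⟨ξ, rfl⟩
    rw [mem_sphere_zero_iff_norm, norm_radialGraph fun _ => hρ]

theorem isRadialDomain_ball (ρ : ℝ) :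
    IsRadialDomain (ball (0 : Eucl n) ρ) fun _ => ρ := by
  intro ξ r hr
  rw [mem_ball_zero_iff, norm_smul_sphere_coe hr.le]

theorem weightedVolume_ball (hn : 0 < n) {ρ : ℝ} (hρ : 0 < ρ) :
    weightedVolume (ball (0 : Eucl n) ρ) = besselFlux n ρ * (sphereMeasure n).real univ := by
  rw [weightedVolume_radialDomain hn (isRadialDomain_ball ρ) (fun _ => hρ) isBounded_ball
    measurableSet_ball, integral_const, smul_eq_mul, mul_comm]

theorem integral_boundaryMeasure_ball (hn : 0 < n) {ρ : ℝ} (hρ : 0 < ρ) (F : Eucl n → ℝ) :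
    ∫ x, F x ∂(boundaryMeasure (ball (0 : Eucl n) ρ))
      = ρ ^ (n - 1) * ∫ ξ : USphere n, F (ρ • (ξ : Eucl n)) ∂(sphereMeasure n) := by
  rw [boundaryMeasure_eq_map (fun _ => hρ) continuous_const (frontier_ball_eq_range hρ),
    (measurableEmbedding_radialGraph (fun _ => hρ) continuous_const).integral_map,
    graphMeasure_const hn hρ, integral_smul_measure, ENNReal.toReal_ofReal (by positivity)]
  rfl

theorem weightedPerimeter_ball (hn : 0 < n) {ρ : ℝ} (hρ : 0 < ρ) :
    weightedPerimeter (ball (0 : Eucl n) ρ)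
      = besselProfile n ρ ^ 2 * ρ ^ (n - 1) * (sphereMeasure n).real univ := by
  rw [weightedPerimeter, integral_boundaryMeasure_ball hn hρ]
  simp only [besselWeight_eq_besselProfile, norm_smul_sphere_coe hρ.le]
  rw [integral_const, smul_eq_mul]
  ring

/-- The trace inequality on a ray: along it, the flux of the field `ψ² ∇z / z` is the integral of
its divergence, which is at most the energy density. -/
theorem integral_ray_ge (hn : 0 < n) {ρ : ℝ} (hρ : 0 < ρ) {ψ ψ' g : ℝ → ℝ}
    (hψ : ∀ r, HasDerivAt ψ (ψ' r) r) (hψ' : Continuous ψ') (hg : Continuous g)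
    (hψg : ∀ r, |ψ' r| ≤ g r) :
    ρ * besselSlope n ρ / besselProfile n ρ * (ρ ^ (n - 1) * ψ ρ ^ 2)
      ≤ ∫ r in 0..ρ, r ^ (n - 1) * (g r ^ 2 + ψ r ^ 2) := by
  have hcf := (contDiff_besselProfile hn).continuous
  have hck := (contDiff_besselSlope (n := n)).continuous
  have hcψ : Continuous ψ := continuous_iff_continuousAt.2 fun r => (hψ r).continuousAt
  have hf0 : ∀ r, besselProfile n r ≠ 0 := fun r => (besselProfile_pos hn r).ne'
  set q : ℝ → ℝ := fun r => r * besselSlope n r / besselProfile n r with hq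
  have hqc : Continuous q := (continuous_id.mul hck).div hcf hf0
  -- the flux of the field `ψ² ∇z / z`
  set D : ℝ → ℝ := fun r => r ^ (n - 1) * ((1 - q r ^ 2) * ψ r ^ 2 + 2 * q r * ψ r * ψ' r) with hD
  have hder : ∀ r, HasDerivAt
      (fun r => r ^ n * (besselSlope n r / besselProfile n r) * ψ r ^ 2) (D r) r := by
    intro r
    have hk := hasDerivAt_besselSlope (n := n) r
    have hode := mul_deriv_besselSlope hn r
    have h := ((hasDerivAt_pow n r).mul (hk.differentiableAt.hasDerivAt.div
      (hasDerivAt_besselProfile hn r) (hf0 r))).mul ((hψ r).pow 2)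
    refine h.congr_deriv ?_
    have hf := hf0 r
    obtain ⟨k, rfl⟩ := Nat.exists_eq_succ_of_ne_zero hn.ne'
    simp only [Nat.succ_eq_add_one, Nat.add_sub_cancel, Pi.mul_apply, Pi.div_apply, Pi.pow_apply,
      hD, hq] at hode ⊢
    rw [pow_succ]
    field_simp
    push_cast at hode ⊢
    linear_combination (r ^ k * besselProfile (k + 1) r * ψ r ^ 2) * hode
  have hDc : Continuous D := by fun_prop
  have hFTC := intervalIntegral.integral_eq_sub_of_hasDerivAt (a := 0) (b := ρ)
    (fun r _ => hder r) (hDc.intervalIntegrable _ _)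
  have hle : ∫ r in 0..ρ, D r ≤ ∫ r in 0..ρ, r ^ (n - 1) * (g r ^ 2 + ψ r ^ 2) := by
    refine intervalIntegral.integral_mono_on hρ.le (hDc.intervalIntegrable _ _)
      (Continuous.intervalIntegrable (by fun_prop) _ _) fun r hr => ?_
    have hr0 : 0 ≤ r := hr.1
    have h1 : ψ' r ^ 2 ≤ g r ^ 2 := by
      rw [← sq_abs]
      exact pow_le_pow_left₀ (abs_nonneg _) (hψg r) 2
    simp only [hD]
    refine mul_le_mul_of_nonneg_left ?_ (by positivity)
    nlinarith [sq_nonneg (q r * ψ r - ψ' r)]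
  refine le_trans (le_of_eq ?_) hle
  rw [hFTC]
  obtain ⟨k, rfl⟩ := Nat.exists_eq_succ_of_ne_zero hn.ne'
  simp [pow_succ]
  ring

/-- The trace inequality in a ball: the Bessel weight is a positive solution of `Δz = z`, and the
field `φ² ∇z / z` calibrates the energy of `φ`. -/
theorem trace_inequality_ball (hn : 0 < n) {ρ : ℝ} (hρ : 0 < ρ) {φ : Eucl n → ℝ}
    (hφ : ContDiff ℝ (⊤ : ℕ∞) φ) :
    ρ * besselSlope n ρ / besselProfile n ρ
        * ∫ x, φ x ^ 2 ∂(boundaryMeasure (ball (0 : Eucl n) ρ))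
      ≤ ∫ x in ball (0 : Eucl n) ρ, (‖gradient φ x‖ ^ 2 + φ x ^ 2) := by
  have hg := continuous_gradient_of_contDiff hφ
  have hcF : Continuous fun x : Eucl n => ‖gradient φ x‖ ^ 2 + φ x ^ 2 :=
    (hg.norm.pow 2).add (hφ.continuous.pow 2)
  rw [integral_boundaryMeasure_ball hn hρ, setIntegral_radialDomain hn (isRadialDomain_ball ρ)
    (fun _ => hρ) isBounded_ball measurableSet_ball hcF, ← integral_const_mul,
    ← integral_const_mul]
  refine integral_mono ?_ ?_ fun ξ => ?_
  · refine integrable_of_continuous_sphere ?_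
    have := hφ.continuous
    fun_prop
  · refine integrable_of_continuous_sphere ?_
    exact intervalIntegral.continuous_parametric_intervalIntegral_of_continuous' (by fun_prop) _ _
  · refine integral_ray_ge hn hρ (ψ := fun r => φ (r • (ξ : Eucl n)))
      (ψ' := fun r => fderiv ℝ φ (r • (ξ : Eucl n)) ξ)
      (g := fun r => ‖gradient φ (r • (ξ : Eucl n))‖) ?_ ?_ ?_ ?_
    · intro r
      have h1 : HasDerivAt (fun t : ℝ => t • (ξ : Eucl n)) (ξ : Eucl n) r := by
        simpa using (hasDerivAt_id r).smul_const (ξ : Eucl n)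
      exact ((hφ.differentiable (by simp)) _).hasFDerivAt.comp_hasDerivAt r h1
    · have := hφ.continuous_fderiv (by simp)
      fun_prop
    · fun_prop
    · intro r
      rw [← inner_gradient_eq_fderiv]
      simpa [norm_sphere_coe] using abs_real_inner_le_norm (gradient φ (r • (ξ : Eucl n))) ξ

/-- The trace eigenvalue of a ball is attained by the Bessel weight. -/
theorem traceEigenvalue_ball (hn : 0 < n) {ρ : ℝ} (hρ : 0 < ρ)
    (hS : 0 < (sphereMeasure n).real univ) :
    traceEigenvalue (ball (0 : Eucl n) ρ) = ρ * besselSlope n ρ / besselProfile n ρ ∧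
    weightedVolume (ball (0 : Eucl n) ρ) / weightedPerimeter (ball (0 : Eucl n) ρ)
      = ρ * besselSlope n ρ / besselProfile n ρ := by
  have hf := besselProfile_pos hn ρ
  have hV : weightedVolume (ball (0 : Eucl n) ρ) / weightedPerimeter (ball (0 : Eucl n) ρ)
      = ρ * besselSlope n ρ / besselProfile n ρ := by
    rw [weightedVolume_ball hn hρ, weightedPerimeter_ball hn hρ, besselFlux]
    obtain ⟨k, rfl⟩ := Nat.exists_eq_succ_of_ne_zero hn.ne'
    simp only [Nat.succ_eq_add_one, Nat.add_sub_cancel, pow_succ]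
    field_simp
  have : IsFiniteMeasure (boundaryMeasure (ball (0 : Eucl n) ρ)) :=
    isFiniteMeasure_boundaryMeasure hn (fun _ => hρ) (LipschitzWith.const ρ)
      (frontier_ball_eq_range hρ)
  refine ⟨le_antisymm ?_ ?_, hV⟩
  · have h := traceEigenvalue_le_weighted hn (isBounded_ball (x := (0 : Eucl n)) (r := ρ))
      measurableSet_ball 0 (by
        simp only [sub_zero, image_id']
        rw [weightedPerimeter_ball hn hρ]
        positivity)
    simp only [sub_zero, image_id'] at h
    rwa [hV] at h
  · refine le_traceEigenvalue isBounded_ball measurableSet_ball ?_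
      fun φ hφ => trace_inequality_ball hn hρ hφ
    have h1 := integral_boundaryMeasure_ball hn hρ (n := n) fun _ => 1
    simp only [integral_const, smul_eq_mul, mul_one] at h1
    have h2 : 0 < (boundaryMeasure (ball (0 : Eucl n) ρ)).real univ := by
      rw [h1]
      positivity
    exact (ENNReal.toReal_pos_iff.1 h2).1

end RadialDomain

/-! ### Lipschitz bounds from weak gradients -/

section WeakLipschitz

variable {n : ℕ}

theorem ae_of_ae_sphere {p : USphere n → Prop} (h : ∀ᵐ ξ ∂(sphereMeasure n), p ξ) :
    ∀ᵐ x : Eucl n, ∀ hx : x ≠ 0, p (sphereDir x hx) := by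
  have h1 : ∀ᵐ z ∂((sphereMeasure n).prod (Measure.volumeIoiPow (n - 1))), p z.1 :=
    Measure.quasiMeasurePreserving_fst.ae h
  have h2 := (measurePreserving_polar n).quasiMeasurePreserving.ae h1
  have h3 : ∀ᵐ x ∂((volume : Measure (Eucl n)).restrict {0}ᶜ),
      ∀ hx : x ≠ 0, p (sphereDir x hx) := by
    rw [ae_restrict_iff_subtype (measurableSet_singleton _).compl]
    filter_upwards [h2] with x hx hx0
    have : ((homeomorphUnitSphereProd (Eucl n)) x).1 = sphereDir (x : Eucl n) hx0 :=
      Subtype.ext (homeomorphUnitSphereProd_apply_fst_coe _ x)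
    rwa [this] at hx
  rw [ae_restrict_iff' (measurableSet_singleton _).compl] at h3
  filter_upwards [h3] with x hx hx0
  exact hx hx0 hx0

/-- A function that is continuous near a point, and whose weak gradient is bounded there, is
Lipschitz there: so are its mollifications, with the same constant. -/
theorem norm_sub_le_of_hasWeakGradient {U : Set (Eucl n)} {u : Eucl n → ℝ} {g : Eucl n → Eucl n}
    (hu : LocallyIntegrable u) (hug : HasWeakGradient U u g) {x₀ : Eucl n} {a b C : ℝ}
    (hab : a < b) (hbU : ball x₀ b ⊆ U) (hcu : ContinuousOn u (ball x₀ b))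
    (hC : 0 ≤ C) (hg : ∀ᵐ x : Eucl n, x ∈ ball x₀ b → ‖g x‖ ≤ C) {x y : Eucl n}
    (hx : x ∈ ball x₀ a) (hy : y ∈ ball x₀ a) : |u y - u x| ≤ C * ‖y - x‖ := by
  -- the bound for mollifications at scale `δ < b - a`
  have key : ∀ φ : ContDiffBump (0 : Eucl n), φ.rOut < b - a →
      |(∫ t, u t * φ.normed volume (y - t)) - ∫ t, u t * φ.normed volume (x - t)|
        ≤ C * ‖y - x‖ := by
    intro φ hφ
    set ψ := φ.normed volume with hψ
    have hψs : ContDiff ℝ (⊤ : ℕ∞) ψ := φ.contDiff_normed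
    have hψc : HasCompactSupport ψ := φ.hasCompactSupport_normed
    have hder := fun z => hψc.hasFDerivAt_convolution_right (μ := volume)
      (ContinuousLinearMap.mul ℝ ℝ) hu (hψs.of_le (by exact_mod_cast le_top)) z
    have hbound : ∀ z ∈ ball x₀ a,
        ‖fderiv ℝ (convolution u ψ (ContinuousLinearMap.mul ℝ ℝ) volume) z‖ ≤ C := by
      intro z hz
      rw [(hder z).fderiv]
      refine ContinuousLinearMap.opNorm_le_bound _ hC fun w => ?_
      rw [convolution_precompR_apply _ hu (hψc.fderiv ℝ) (hψs.continuous_fderiv (by simp))]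
      -- the test function in the definition of the weak gradient is the reflected kernel
      set η : Eucl n → ℝ := fun t => ψ (z - t) with hη
      have hηs : ContDiff ℝ (⊤ : ℕ∞) η := hψs.comp (contDiff_const.sub contDiff_id)
      have hηc : HasCompactSupport η := hψc.comp_homeomorph (Homeomorph.subLeft z)
      have hηsup : tsupport η ⊆ ball x₀ b := by
        have h1 : tsupport η ⊆ closedBall z φ.rOut := by
          refine closure_minimal (fun t ht => ?_) isClosed_closedBall
          have h2 : z - t ∈ Function.support ψ := ht
          rw [hψ, φ.support_normed_eq, mem_ball_zero_iff, ← dist_eq_norm, dist_comm] at h2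
          exact mem_closedBall.2 h2.le
        refine h1.trans fun t ht => ?_
        rw [mem_closedBall] at ht
        rw [mem_ball] at hz ⊢
        linarith [dist_triangle t z x₀]
      have hηd : ∀ t, fderiv ℝ η t w = - fderiv ℝ ψ (z - t) w := by
        intro t
        have h1 := ((hψs.differentiable (by simp)) (z - t)).hasFDerivAt.comp t
          ((hasFDerivAt_id t).const_sub z)
        have h2 : fderiv ℝ η t = _ := h1.fderiv
        rw [h2]
        simp
      have hηz : ∀ t ∉ U, η t = 0 := fun t ht =>
        image_eq_zero_of_notMem_tsupport fun h => ht (hbU (hηsup h))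
      have hηgz : ∀ t ∉ U, gradient η t = 0 := fun t ht => by
        have : fderiv ℝ η t = 0 := by
          by_contra h
          exact ht (hbU (hηsup (support_fderiv_subset ℝ h)))
        simp [gradient, this]
      have hw := hug.2.2 η hηs hηc (hηsup.trans hbU)
      rw [setIntegral_eq_integral_of_forall_compl_eq_zero
        fun t ht => by rw [hηgz t ht, smul_zero]] at hw
      have hgη := continuous_gradient_of_contDiff hηs
      have hgc : HasCompactSupport (gradient η) :=
        (hηc.fderiv (𝕜 := ℝ)).comp_left (map_zero (InnerProductSpace.toDual ℝ (Eucl n)).symm)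
      have hi : Integrable fun t => u t • gradient η t :=
        hu.integrable_smul_right_of_hasCompactSupport hgη hgc
      have h3 : convolution u (fun t => fderiv ℝ ψ t w) (ContinuousLinearMap.mul ℝ ℝ) volume z
          = - inner ℝ w (∫ t, u t • gradient η t) := by
        rw [← integral_inner hi, ← integral_neg, convolution_def]
        refine integral_congr_ae (Eventually.of_forall fun t => ?_)
        simp only [ContinuousLinearMap.mul_apply']
        rw [inner_smul_right, real_inner_comm, inner_gradient_eq_fderiv, hηd]
        ring
      have h4 : ‖∫ t, u t • gradient η t‖ ≤ C := by
        rw [hw, norm_neg]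
        have h5 : ∫ t, C * η t = C := by
          rw [integral_const_mul, hη, integral_sub_left_eq_self ψ volume z, hψ,
            φ.integral_normed, mul_one]
        rw [← h5]
        have hηi : Integrable fun t => C * η t :=
          (hηs.continuous.integrable_of_hasCompactSupport hηc).const_mul C
        have hη0 : ∀ t, 0 ≤ η t := fun t => φ.nonneg_normed _
        refine (norm_integral_le_of_norm_le hηi.integrableOn ?_).trans
          (setIntegral_le_integral hηi (Eventually.of_forall fun t => mul_nonneg hC (hη0 t)))
        filter_upwards [ae_restrict_of_ae hg] with t ht
        rw [norm_smul, Real.norm_of_nonneg (hη0 t), mul_comm]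
        by_cases htb : t ∈ ball x₀ b
        · exact mul_le_mul_of_nonneg_right (ht htb) (hη0 t)
        · rw [show η t = 0 from image_eq_zero_of_notMem_tsupport fun h => htb (hηsup h)]
          simp
      rw [h3, norm_neg, Real.norm_eq_abs]
      refine (abs_real_inner_le_norm _ _).trans ?_
      rw [mul_comm]
      gcongr
    have h6 := (convex_ball x₀ a).norm_image_sub_le_of_norm_fderiv_le
      (fun z _ => (hder z).differentiableAt) hbound hx hy
    simpa [convolution_def] using h6
  -- the mollifications converge
  refine le_of_forall_pos_le_add fun e he => ?_
  have hball : ∀ z ∈ ball x₀ a, ∃ δ > 0, ∀ t ∈ ball z δ, dist (u t) (u z) ≤ e / 2 := by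
    intro z hz
    have hc : ContinuousAt u z :=
      hcu.continuousAt (isOpen_ball.mem_nhds (ball_subset_ball hab.le hz))
    obtain ⟨δ, hδ, h⟩ := Metric.continuousAt_iff.1 hc (e / 2) (by positivity)
    exact ⟨δ, hδ, fun t ht => (h ht).le⟩
  obtain ⟨δ₁, hδ₁, h1⟩ := hball x hx
  obtain ⟨δ₂, hδ₂, h2⟩ := hball y hy
  set δ := min (min δ₁ δ₂) ((b - a) / 2) with hδ
  have hδ0 : 0 < δ := lt_min (lt_min hδ₁ hδ₂) (by linarith)
  let φ : ContDiffBump (0 : Eucl n) := ⟨δ / 2, δ, by positivity, by linarith⟩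
  have hφ : φ.rOut = δ := rfl
  have hum := hu.aestronglyMeasurable
  have e1 := φ.dist_normed_convolution_le (μ := volume) hum (x₀ := x) (ε := e / 2) fun t ht =>
    h1 t (ball_subset_ball ((min_le_left _ _).trans (min_le_left _ _)) ht)
  have e2 := φ.dist_normed_convolution_le (μ := volume) hum (x₀ := y) (ε := e / 2) fun t ht =>
    h2 t (ball_subset_ball ((min_le_left _ _).trans (min_le_right _ _)) ht)
  have e3 := key φ (by rw [hφ]; linarith [min_le_right (min δ₁ δ₂) ((b - a) / 2)])
  rw [convolution_lsmul_swap, Real.dist_eq] at e1 e2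
  simp only [smul_eq_mul, mul_comm (φ.normed volume _)] at e1 e2
  rw [abs_le] at *
  constructor <;> linarith [e1.1, e1.2, e2.1, e2.2, e3.1, e3.2]

theorem continuousAt_radialExtension {v : USphere n → ℝ} (hv : Continuous v) {x : Eucl n}
    (hx : x ≠ 0) : ContinuousAt (radialExtension v) x := by
  have h1 : ContinuousOn (radialExtension v) {0}ᶜ := by
    rw [continuousOn_iff_continuous_domRestrict]
    have h2 : Continuous fun y : ({0}ᶜ : Set (Eucl n)) => v (sphereDir y y.2) := by
      refine hv.comp (Continuous.subtype_mk ?_ _)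
      exact (continuous_subtype_val.norm.inv₀ fun y => norm_ne_zero_iff.2 y.2).smul
        continuous_subtype_val
    exact h2.congr fun y => (radialExtension_of_ne v y.2).symm
  exact h1.continuousAt (isOpen_compl_singleton.mem_nhds hx)

theorem locallyIntegrable_radialExtension {v : USphere n → ℝ} (hv : Continuous v) :
    LocallyIntegrable (radialExtension v) := by
  obtain ⟨M, hM⟩ := (isCompact_univ (X := USphere n)).exists_bound_of_continuousOn hv.continuousOn
  refine (locallyIntegrable_const (max M 0)).mono
    (measurable_radialExtension hv.measurable).aestronglyMeasurable
    (Eventually.of_forall fun x => ?_)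
  rw [Real.norm_of_nonneg (le_max_right M 0)]
  rcases eq_or_ne x 0 with rfl | hx
  · simp [radialExtension]
  · rw [radialExtension_of_ne v hx]
    exact (hM _ trivial).trans (le_max_left _ _)

/-- Membership in `𝒩(n,ε)` yields pointwise bounds on the function and its Lipschitz constant. -/
theorem bounds_of_mem_nearlySphericalFunctions {ε : ℝ} (hε : 0 ≤ ε) {v : USphere n → ℝ}
    (hv : v ∈ nearlySphericalFunctions n ε) :
    (∀ ξ, |v ξ| ≤ ε) ∧ LipschitzWith (8 * ε).toNNReal v := by
  obtain ⟨hc, ⟨G, hG, -, hle⟩, -, -⟩ := hv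
  have hv1 : eLpNorm v ∞ (sphereMeasure n) ≤ ENNReal.ofReal ε := le_self_add.trans hle
  have hG1 : eLpNorm G ∞ (sphereMeasure n) ≤ ENNReal.ofReal ε := le_add_self.trans hle
  rw [eLpNorm_exponent_top] at hv1 hG1
  have hvb : ∀ ξ, |v ξ| ≤ ε := by
    have h1 : ∀ᵐ ξ ∂(sphereMeasure n), |v ξ| ≤ ε := by
      filter_upwards [ae_le_eLpNormEssSup (f := v) (μ := sphereMeasure n)] with ξ hξ
      have := hξ.trans hv1
      rwa [← ofReal_norm, ENNReal.ofReal_le_ofReal_iff hε] at this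
    have h2 : (fun ξ => max |v ξ| ε) =ᵐ[sphereMeasure n] fun _ => ε := by
      filter_upwards [h1] with ξ hξ
      exact max_eq_right hξ
    have h3 := Measure.eq_of_ae_eq h2 (by fun_prop) continuous_const
    exact fun ξ => max_eq_right_iff.1 (congrFun h3 ξ)
  have hGb : ∀ᵐ ξ ∂(sphereMeasure n), ‖G ξ‖ ≤ ε := by
    filter_upwards [ae_le_eLpNormEssSup (f := G) (μ := sphereMeasure n)] with ξ hξ
    have := hξ.trans hG1
    rwa [← ofReal_norm, ENNReal.ofReal_le_ofReal_iff hε] at this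
  refine ⟨hvb, LipschitzWith.of_dist_le_mul fun ξ η => ?_⟩
  rw [Real.coe_toNNReal _ (by positivity), Real.dist_eq, Subtype.dist_eq, dist_eq_norm]
  -- at distance at least `1/4` the supremum bound suffices; closer points lie in a ball that stays
  -- at distance `1/2` from the origin, where the weak gradient of the extension is at most `2ε`
  by_cases hfar : 1 / 4 ≤ ‖(ξ : Eucl n) - η‖
  · have h1 := hvb ξ
    have h2 := hvb η
    have h3 : |v ξ - v η| ≤ |v ξ| + |v η| := abs_sub _ _
    nlinarith
  · push Not at hfar
    have hne : ∀ x ∈ ball (ξ : Eucl n) (1 / 2), 1 / 2 ≤ ‖x‖ := by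
      intro x hx
      rw [mem_ball, dist_eq_norm, norm_sub_rev] at hx
      have := norm_sub_norm_le (ξ : Eucl n) x
      rw [norm_sphere_coe] at this
      linarith
    have hne0 : ∀ x ∈ ball (ξ : Eucl n) (1 / 2), x ≠ 0 := fun x hx => by
      rintro rfl
      have := hne 0 hx
      norm_num at this
    have h := norm_sub_le_of_hasWeakGradient (locallyIntegrable_radialExtension hc) hG
      (x₀ := (ξ : Eucl n)) (a := 1 / 4) (b := 1 / 2) (C := 2 * ε) (by norm_num)
      (fun x hx => hne0 x hx)
      (fun x hx => (continuousAt_radialExtension hc (hne0 x hx)).continuousWithinAt)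
      (by positivity) ?_ (x := (η : Eucl n)) (y := (ξ : Eucl n)) ?_ ?_
    · rw [radialExtension_coe, radialExtension_coe] at h
      nlinarith [norm_nonneg ((ξ : Eucl n) - η)]
    · filter_upwards [ae_of_ae_sphere hGb] with x hx hxb
      have h1 := hx (hne0 x hxb)
      have h2 := hne x hxb
      have h3 : ‖x‖⁻¹ ≤ 2 := by
        rw [inv_le_comm₀ (by linarith) (by norm_num)]
        linarith
      rw [norm_smul, norm_inv, norm_norm, radialExtension_of_ne G (hne0 x hxb)]
      gcongr
    · rw [mem_ball, dist_comm, dist_eq_norm]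
      exact hfar
    · exact mem_ball_self (by norm_num)

end WeakLipschitz

/-! ### Domains bounded by a radial graph -/

section FrontierGraph

variable {n : ℕ}

theorem IsPreconnected.inter_frontier_nonempty_of_isOpen {X : Type*} [TopologicalSpace X]
    {t U : Set X} (ht : IsPreconnected t) (hU : IsOpen U) (h1 : (t ∩ U).Nonempty)
    (h2 : (t ∩ Uᶜ).Nonempty) : (t ∩ frontier U).Nonempty := by
  by_contra hne
  rw [not_nonempty_iff_eq_empty] at hne
  have h3 : ∀ x ∈ t, x ∈ closure U → x ∈ U := by
    intro x hx hxc
    by_contra hxU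
    have : x ∈ t ∩ frontier U := ⟨hx, by rw [hU.frontier_eq]; exact ⟨hxc, hxU⟩⟩
    rw [hne] at this
    exact this
  obtain ⟨y, hy, hyU⟩ := h2
  obtain ⟨z, -, hz, hz2⟩ := ht U (closure U)ᶜ hU isClosed_closure.isOpen_compl
    (fun x hx => by
      by_cases h : x ∈ closure U
      · exact Or.inl (h3 x hx h)
      · exact Or.inr h) h1 ⟨y, hy, fun h => hyU (h3 y hy h)⟩
  exact hz2 (subset_closure hz)

/-- A bounded open set whose boundary is a radial graph is the region enclosed by the graph:
each open ray meets the boundary once, and membership changes only there. -/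
theorem isRadialDomain_of_frontier_eq (hn : 0 < n) {U : Set (Eucl n)} {R : USphere n → ℝ}
    (hR : ∀ ξ, 0 < R ξ) (hUo : IsOpen U) (hUb : Bornology.IsBounded U)
    (hU : frontier U = range (radialGraph R)) : IsRadialDomain U R := by
  have hray : ∀ (ξ : USphere n) (r : ℝ), 0 ≤ r → r • (ξ : Eucl n) ∈ frontier U → r = R ξ := by
    intro ξ r hr h
    rw [hU] at h
    obtain ⟨η, hη⟩ := h
    have h1 : R η = r := by rw [← norm_radialGraph hR, hη, norm_smul_sphere_coe hr]
    have h2 : η = ξ := by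
      rw [radialGraph, h1] at hη
      have hr0 : r ≠ 0 := h1 ▸ (hR η).ne'
      exact Subtype.ext (smul_right_injective _ hr0 hη)
    rw [← h1, h2]
  have hcont : ∀ ξ : USphere n, Continuous fun r : ℝ => r • (ξ : Eucl n) := fun ξ => by fun_prop
  have hout : ∀ (ξ : USphere n) (r : ℝ), 0 < r → r • (ξ : Eucl n) ∈ U → r < R ξ := by
    intro ξ r hr h
    by_contra! hle
    rcases hle.eq_or_lt with heq | hlt
    · have h1 : r • (ξ : Eucl n) ∈ frontier U := by
        rw [hU, ← heq]
        exact ⟨ξ, rfl⟩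
      rw [hUo.frontier_eq] at h1
      exact h1.2 h
    · have hconn : IsPreconnected ((fun r : ℝ => r • (ξ : Eucl n)) '' Ioi (R ξ)) :=
        isPreconnected_Ioi.image _ (hcont ξ).continuousOn
      obtain ⟨M, hM⟩ := hUb.exists_norm_le
      have hM0 : 0 < max M (R ξ) + 1 := by linarith [hR ξ, le_max_right M (R ξ)]
      obtain ⟨_, ⟨s, hs, rfl⟩, hs2⟩ := hconn.inter_frontier_nonempty_of_isOpen hUo
        ⟨_, ⟨r, hlt, rfl⟩, h⟩ ⟨_, ⟨max M (R ξ) + 1, mem_Ioi.2 (by linarith [le_max_right M (R ξ)]),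
          rfl⟩, fun h' => by
            have h3 := hM _ h'
            rw [norm_smul_sphere_coe hM0.le] at h3
            linarith [le_max_left M (R ξ)]⟩
      have hs' : R ξ < s := hs
      exact hs'.ne' (hray ξ s ((hR ξ).le.trans hs'.le) hs2)
  have hseg : ∀ (ξ : USphere n) (r : ℝ), 0 < r → r < R ξ →
      ((0 : Eucl n) ∈ U ↔ r • (ξ : Eucl n) ∈ U) := by
    intro ξ r hr hrR
    have hconn : IsPreconnected ((fun r : ℝ => r • (ξ : Eucl n)) '' Icc 0 r) :=
      isPreconnected_Icc.image _ (hcont ξ).continuousOn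
    have hdisj : ∀ x ∈ (fun r : ℝ => r • (ξ : Eucl n)) '' Icc 0 r, x ∉ frontier U := by
      rintro _ ⟨s, hs, rfl⟩ h
      exact (hs.2.trans_lt hrR).ne (hray ξ s hs.1 h)
    have h0 : (0 : Eucl n) ∈ (fun r : ℝ => r • (ξ : Eucl n)) '' Icc 0 r :=
      ⟨0, ⟨le_rfl, hr.le⟩, zero_smul _ _⟩
    have h1 : r • (ξ : Eucl n) ∈ (fun r : ℝ => r • (ξ : Eucl n)) '' Icc 0 r :=
      ⟨r, ⟨hr.le, le_rfl⟩, rfl⟩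
    by_contra hne
    rw [not_iff] at hne
    obtain ⟨x, hx, hx2⟩ : (((fun r : ℝ => r • (ξ : Eucl n)) '' Icc 0 r) ∩ frontier U).Nonempty := by
      by_cases h : (0 : Eucl n) ∈ U
      · exact hconn.inter_frontier_nonempty_of_isOpen hUo ⟨_, h0, h⟩ ⟨_, h1, fun h' => hne.2 h' h⟩
      · exact hconn.inter_frontier_nonempty_of_isOpen hUo ⟨_, h1, hne.1 h⟩ ⟨_, h0, h⟩
    exact hdisj x hx hx2
  have hzero : (0 : Eucl n) ∈ U := by
    have hne : U.Nonempty := by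
      by_contra hemp
      rw [not_nonempty_iff_eq_empty] at hemp
      obtain ⟨τ, -⟩ := exists_dense_sphere hn
      have h1 : radialGraph R (τ 0) ∈ frontier U := by
        rw [hU]
        exact ⟨_, rfl⟩
      rw [hemp, frontier_empty] at h1
      exact h1
    obtain ⟨x, hx⟩ := hne
    rcases eq_or_ne x 0 with rfl | hx0
    · exact hx
    · rw [← norm_smul_sphereDir x hx0] at hx
      have hpos := norm_pos_iff.2 hx0
      exact (hseg _ _ hpos (hout _ _ hpos hx)).2 hx
  exact fun ξ r hr => ⟨hout ξ r hr, fun h => (hseg ξ r hr h).1 hzero⟩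

theorem sphereGrad_affine {v : USphere n → ℝ} {ρ : ℝ} (hρ : ρ ≠ 0) (ξ : USphere n) :
    sphereGrad (fun ξ => ρ * (1 + v ξ)) ξ = ρ • sphereGrad v ξ := by
  have h : radialExtension (fun ξ : USphere n => ρ * (1 + v ξ)) =ᶠ[𝓝 (ξ : Eucl n)]
      ρ • fun x => 1 + radialExtension v x := by
    filter_upwards [isOpen_ne.mem_nhds (sphere_coe_ne_zero ξ)] with y hy
    rw [radialExtension_of_ne _ hy, Pi.smul_apply, radialExtension_of_ne _ hy, smul_eq_mul]
  have := invertibleOfNonzero hρ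
  refine ext_inner_right ℝ fun w => ?_
  rw [inner_smul_left, inner_sphereGrad, inner_sphereGrad, h.fderiv_eq,
    fderiv_const_smul_of_invertible, fderiv_const_add]
  simp

/-- The weighted perimeter of a radial domain is bounded below by the area formula. -/
theorem le_weightedPerimeter (hn : 0 < n) {U : Set (Eucl n)} {R : USphere n → ℝ} {m : ℝ}
    {L : NNReal} (hL : LipschitzWith L R) (hm : 0 < m) (hmR : ∀ ξ, m ≤ R ξ)
    (hLm : (L : ℝ) ≤ m / 32) (hU : frontier U = range (radialGraph R)) :
    ∫ ξ, besselProfile n (R ξ) ^ 2 * R ξ ^ (n - 1)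
        * ‖(ξ : Eucl n) - (R ξ)⁻¹ • sphereGrad R ξ‖ ∂(sphereMeasure n) ≤ weightedPerimeter U := by
  have hR : ∀ ξ, 0 < R ξ := fun ξ => hm.trans_le (hmR ξ)
  have : IsFiniteMeasure (graphMeasure R) := ⟨graphMeasure_univ_lt_top hn hR hL⟩
  have hcf : Continuous fun ξ => besselProfile n (R ξ) ^ 2 :=
    ((contDiff_besselProfile hn).continuous.comp hL.continuous).pow 2
  obtain ⟨M, hM⟩ := (isCompact_univ (X := USphere n)).exists_bound_of_continuousOn
    hcf.continuousOn
  have hint : Integrable (fun ξ => besselProfile n (R ξ) ^ 2) (graphMeasure R) :=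
    Integrable.of_bound hcf.aestronglyMeasurable M (Eventually.of_forall fun ξ => hM ξ trivial)
  have h := integral_mono_measure (withDensity_le_graphMeasure hn hL hm hmR hLm)
    (Eventually.of_forall fun ξ => by positivity) hint
  have hgm := measurable_sphereGrad R
  have hRm := hL.continuous.measurable
  rw [integral_withDensity_eq_integral_toReal_smul (by fun_prop)
    (Eventually.of_forall fun _ => ENNReal.ofReal_lt_top)] at h
  rw [weightedPerimeter_eq hR hL.continuous hU]
  refine le_trans (le_of_eq ?_) h
  refine integral_congr_ae (Eventually.of_forall fun ξ => ?_)
  have := hR ξ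
  simp only [smul_eq_mul]
  rw [ENNReal.toReal_ofReal (by positivity)]
  ring

end FrontierGraph

/-! ### Second-order expansion at the ball -/

section Expansion

variable {n : ℕ}

/-- The weighted perimeter, per unit solid angle, of the sphere of radius `r`. -/
noncomputable def besselArea (n : ℕ) (r : ℝ) : ℝ := besselProfile n r ^ 2 * r ^ (n - 1)

/-- The trace eigenvalue of the ball of radius `r`. -/
noncomputable def besselRatio (n : ℕ) (r : ℝ) : ℝ := r * besselSlope n r / besselProfile n r

/-- The gap in the second variation at the ball of radius `r`, relative to `z²`: a radial
displacement `s` contributes `-(n - gap) s²` to leading order, and its gradient `|∇s|² / 2`, whose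
integral is at least that of `n s²` when `s` is orthogonal to the affine functions. -/
noncomputable def besselGap (n : ℕ) (r : ℝ) : ℝ :=
  (r ^ 4 * besselSlope n r ^ 2 + (n - 1) * r ^ 2 * besselSlope n r * besselProfile n r
    - r ^ 2 * besselProfile n r ^ 2 + (n + 1) / 2 * besselProfile n r ^ 2) / besselProfile n r ^ 2

theorem besselGap_pos (hn : 2 ≤ n) {r : ℝ} (hr : 0 < r) : 0 < besselGap n r :=
  div_pos (besselProfile_second_variation_pos hn hr)
    (pow_pos (besselProfile_pos (by omega) r) 2)

theorem besselArea_pos (hn : 0 < n) {r : ℝ} (hr : 0 < r) : 0 < besselArea n r := by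
  have := besselProfile_pos hn r
  unfold besselArea
  positivity

theorem besselFlux_pos (hn : 0 < n) {r : ℝ} (hr : 0 < r) : 0 < besselFlux n r := by
  have := besselProfile_pos hn r
  have := besselSlope_pos (n := n) r
  unfold besselFlux
  positivity

theorem besselRatio_pos (hn : 0 < n) {r : ℝ} (hr : 0 < r) : 0 < besselRatio n r := by
  have := besselProfile_pos hn r
  have := besselSlope_pos (n := n) r
  unfold besselRatio
  positivity

theorem continuous_besselArea (hn : 0 < n) : Continuous (besselArea n) := by
  have := (contDiff_besselProfile hn).continuous
  unfold besselArea
  fun_prop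

theorem continuous_besselFlux (hn : 0 < n) : Continuous (besselFlux n) :=
  continuous_iff_continuousAt.2 fun r => (hasDerivAt_besselFlux hn r).continuousAt

/-- Second-order expansion, at the ball of radius `ρ`, of the weighted perimeter minus the weighted
volume, with Lagrange multiplier `μ` for the volume constraint. -/
theorem exists_multiplier_second_order (hn : 2 ≤ n) {ρ θ : ℝ} (hρ : 0 < ρ) (hθ : 0 < θ) :
    ∃ μ : ℝ, ∀ᶠ s in 𝓝 (0 : ℝ),
      -(besselArea n ρ * (n - besselGap n ρ + θ)) * s ^ 2
        ≤ besselArea n (ρ * (1 + s)) - besselFlux n (ρ * (1 + s)) / besselRatio n ρ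
          - μ * ((ρ * (1 + s)) ^ n - ρ ^ n) := by
  have hn0 : 0 < n := by omega
  obtain ⟨N, rfl⟩ : ∃ N, n = N + 2 := ⟨n - 2, by omega⟩
  have hf := besselProfile_pos hn0 ρ
  have hk := besselSlope_pos (n := N + 2) ρ
  set h := besselRatio (N + 2) ρ with hh
  have hhpos : 0 < h := besselRatio_pos hn0 hρ
  set f := besselProfile (N + 2) with hfdef
  set k := besselSlope (N + 2) with hkdef
  set c := besselArea (N + 2) ρ * ((N + 2 : ℕ) - besselGap (N + 2) ρ + θ) with hc
  -- the multiplier that makes the ball stationary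
  set μ := ((2 * f ρ * k ρ * ρ ^ 2 + (N + 1) * f ρ ^ 2) / ρ
    - (ρ ^ 2 * k ρ ^ 2 + f ρ ^ 2) / h) / (N + 2) with hμ
  set Q : ℝ → ℝ := fun r => 2 * f r * k r * r ^ 2 + (N + 1) * f r ^ 2
    - r / h * (r ^ 2 * k r ^ 2 + f r ^ 2) - μ * (N + 2) * r with hQ
  set G : ℝ → ℝ := fun r => besselArea (N + 2) r - besselFlux (N + 2) r / h
    - μ * (r ^ (N + 2) - ρ ^ (N + 2)) + c * ((r - ρ) / ρ) ^ 2 with hG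
  have hf' : ∀ r, HasDerivAt f (r * k r) r := fun r => hasDerivAt_besselProfile hn0 r
  have hk' : ∀ r, HasDerivAt k (deriv k r) r := fun r =>
    (hasDerivAt_besselSlope (n := N + 2) r).differentiableAt.hasDerivAt
  have hode : ∀ r, r * deriv k r = f r - (N + 2 : ℕ) * k r := fun r => mul_deriv_besselSlope hn0 r
  have hGd : ∀ r, HasDerivAt G (r ^ N * Q r + 2 * c * (r - ρ) / ρ ^ 2) r := by
    intro r
    have h1 : HasDerivAt (besselArea (N + 2)) _ r := ((hf' r).pow 2).mul (hasDerivAt_pow (N + 1) r)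
    have h2 := (hasDerivAt_besselFlux hn0 r).div_const h
    have h3 := (((hasDerivAt_pow (N + 2) r).sub_const (ρ ^ (N + 2))).const_mul μ)
    have h4 := ((((hasDerivAt_id r).sub_const ρ).div_const ρ).pow 2).const_mul c
    refine (((h1.sub h2).sub h3).add h4).congr_deriv ?_
    simp only [hQ, ← hfdef, ← hkdef, Nat.add_sub_cancel, show N + 2 - 1 = N + 1 by omega,
      Pi.pow_apply, id]
    push_cast
    rw [pow_succ]
    field_simp
    ring
  have hQρ : Q ρ = 0 := by
    simp only [hQ, hμ]
    field_simp
    ring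
  have hQd : HasDerivAt Q ((2 * besselGap (N + 2) ρ * f ρ ^ 2 - 2 * (N + 2) * f ρ ^ 2) / ρ) ρ := by
    have h1 := ((((hf' ρ).const_mul 2).mul (hk' ρ)).mul (hasDerivAt_pow 2 ρ))
    have h2 := ((hf' ρ).pow 2).const_mul ((N : ℝ) + 1)
    have h3 := ((hasDerivAt_id ρ).div_const h).mul
      (((hasDerivAt_pow 2 ρ).mul ((hk' ρ).pow 2)).add ((hf' ρ).pow 2))
    have h4 := (hasDerivAt_id ρ).const_mul (μ * (N + 2))
    refine (((h1.add h2).sub h3).sub h4).congr_deriv ?_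
    have hd : deriv k ρ = (f ρ - (N + 2 : ℕ) * k ρ) / ρ := by
      rw [← hode ρ]
      field_simp
    simp only [Pi.pow_apply, Pi.mul_apply, Pi.add_apply, id, hd, hμ, besselGap, ← hfdef, ← hkdef]
    have hhe : h = ρ * k ρ / f ρ := rfl
    rw [hhe]
    push_cast
    field_simp
    ring
  have hmin : IsLocalMin G ρ := by
    refine isLocalMin_of_deriv_deriv_pos ?_ ?_ (hGd ρ).continuousAt
    · have h1 : deriv G = fun r => r ^ N * Q r + 2 * c * (r - ρ) / ρ ^ 2 :=
        funext fun r => (hGd r).deriv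
      have h2 := ((hasDerivAt_pow N ρ).mul hQd).add
        ((((hasDerivAt_id ρ).sub_const ρ).const_mul (2 * c)).div_const (ρ ^ 2))
      have h3 : deriv (deriv G) ρ = N * ρ ^ (N - 1) * Q ρ
          + ρ ^ N * ((2 * besselGap (N + 2) ρ * f ρ ^ 2 - 2 * (N + 2) * f ρ ^ 2) / ρ)
          + 2 * c * 1 / ρ ^ 2 := by
        rw [h1]
        exact h2.deriv
      rw [h3, hQρ, mul_zero, zero_add]
      have h4 : ρ ^ N * ((2 * besselGap (N + 2) ρ * f ρ ^ 2 - 2 * (N + 2) * f ρ ^ 2) / ρ)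
          + 2 * c * 1 / ρ ^ 2 = 2 * θ * f ρ ^ 2 * ρ ^ N / ρ := by
        simp only [hc, besselArea, ← hfdef, show N + 2 - 1 = N + 1 by omega]
        push_cast
        rw [pow_succ]
        field_simp
        ring
      rw [h4]
      positivity
    · rw [(hGd ρ).deriv, hQρ]
      simp
  have hGρ : G ρ = 0 := by
    simp only [hG, besselArea, besselFlux, ← hfdef, ← hkdef, show N + 2 - 1 = N + 1 by omega]
    have hhe : h = ρ * k ρ / f ρ := rfl
    rw [hhe]
    field_simp
    ring
  refine ⟨μ, ?_⟩
  have ht : Tendsto (fun s : ℝ => ρ * (1 + s)) (𝓝 0) (𝓝 ρ) := by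
    have : Continuous fun s : ℝ => ρ * (1 + s) := by fun_prop
    simpa using this.tendsto 0
  filter_upwards [ht.eventually hmin] with s hs
  rw [hGρ] at hs
  have h5 : (ρ * (1 + s) - ρ) / ρ = s := by field_simp; ring
  simp only [hG, h5] at hs
  linarith

theorem one_add_half_sub_le_sqrt {x : ℝ} (hx : 0 ≤ x) : 1 + x / 2 * (1 - x / 4) ≤ √(1 + x) := by
  rcases le_total (1 + x / 2 * (1 - x / 4)) 0 with h | h
  · exact h.trans (Real.sqrt_nonneg _)
  · refine Real.le_sqrt_of_sq_le ?_
    by_cases h8 : x ≤ 8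
    · nlinarith [mul_nonneg hx hx, mul_nonneg (mul_nonneg hx hx) hx,
        mul_nonneg (mul_nonneg (mul_nonneg hx hx) hx) (sub_nonneg.2 h8)]
    · push Not at h8
      nlinarith

/-- Lower bound for the area element in terms of the tangential gradient. -/
theorem exists_area_element_bound (hn : 0 < n) {ρ θ : ℝ} (hρ : 0 < ρ) (hθ : 0 < θ) :
    ∃ δ > 0, δ < 1 ∧ ∀ s d : ℝ, |s| ≤ δ → |d| ≤ δ →
      besselArea n (ρ * (1 + s)) + (1 - θ) / 2 * besselArea n ρ * d ^ 2
        ≤ besselArea n (ρ * (1 + s)) * √(1 + (d / (1 + s)) ^ 2) := by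
  have hA := besselArea_pos hn hρ
  have hcA := continuous_besselArea hn
  set Φ : ℝ × ℝ → ℝ := fun q => besselArea n (ρ * (1 + q.1)) * (1 - (q.2 / (1 + q.1)) ^ 2 / 4)
    / (1 + q.1) ^ 2 with hΦ
  have hΦc : ContinuousAt Φ (0, 0) := by
    have h1 : ContinuousAt (fun q : ℝ × ℝ => 1 + q.1) (0, 0) := by fun_prop
    refine ContinuousAt.div (ContinuousAt.mul (by fun_prop) ?_) (by fun_prop) (by simp)
    exact continuousAt_const.sub (((ContinuousAt.div (by fun_prop) h1 (by simp)).pow 2).div_const 4)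
  have hev : ∀ᶠ q in 𝓝 ((0 : ℝ), (0 : ℝ)), (1 - θ) * besselArea n ρ < Φ q := by
    refine hΦc.eventually (lt_mem_nhds ?_)
    simp only [hΦ]
    norm_num
    nlinarith
  obtain ⟨δ, hδ, H⟩ := Metric.eventually_nhds_iff.1 hev
  refine ⟨min δ 1 / 2, by positivity, by linarith [min_le_right δ 1], fun s d hs hd => ?_⟩
  have hlt : min δ 1 / 2 < δ := by linarith [min_le_left δ 1, lt_min hδ one_pos]
  have h1 := H (y := (s, d)) (by
    rw [Prod.dist_eq, Real.dist_eq, Real.dist_eq, sub_zero, sub_zero]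
    exact max_lt (hs.trans_lt hlt) (hd.trans_lt hlt))
  have hs1 : 0 < 1 + s := by
    have := abs_le.1 hs
    linarith [min_le_right δ 1]
  simp only [hΦ] at h1
  have hAs := besselArea_pos hn (mul_pos hρ hs1)
  have h2 := one_add_half_sub_le_sqrt (sq_nonneg (d / (1 + s)))
  have h3 := mul_le_mul_of_nonneg_left h2 hAs.le
  have h4 : besselArea n (ρ * (1 + s)) * (1 + (d / (1 + s)) ^ 2 / 2 * (1 - (d / (1 + s)) ^ 2 / 4))
      = besselArea n (ρ * (1 + s)) + d ^ 2 / 2 * (besselArea n (ρ * (1 + s))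
        * (1 - (d / (1 + s)) ^ 2 / 4) / (1 + s) ^ 2) := by
    rw [div_pow]
    field_simp
  rw [h4] at h3
  have h5 := mul_le_mul_of_nonneg_left h1.le (by positivity : 0 ≤ d ^ 2 / 2)
  linarith

theorem exists_pow_expansion_bound (m : ℕ) :
    ∃ C : ℝ, 0 ≤ C ∧ ∀ s : ℝ, |s| ≤ 1 → |(1 + s) ^ m - 1 - m * s| ≤ C * s ^ 2 := by
  induction m with
  | zero => exact ⟨0, le_rfl, fun s _ => by simp⟩
  | succ m ih =>
    obtain ⟨C, hC, h⟩ := ih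
    refine ⟨2 * C + m, by positivity, fun s hs => ?_⟩
    have e : (1 + s) ^ (m + 1) - 1 - ((m + 1 : ℕ) : ℝ) * s
        = (1 + s) * ((1 + s) ^ m - 1 - m * s) + m * s ^ 2 := by
      push_cast
      ring
    have h1 : |1 + s| ≤ 2 := by
      rw [abs_le] at hs ⊢
      constructor <;> linarith
    rw [e]
    refine (abs_add_le _ _).trans ?_
    rw [abs_mul, abs_of_nonneg (by positivity : 0 ≤ (m : ℝ) * s ^ 2)]
    have := mul_le_mul h1 (h s hs) (abs_nonneg _) (by norm_num)
    linarith

end Expansion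

/-! ### Stability of the ball among nearly spherical sets -/

section Stability

variable {n : ℕ}

theorem unitBallVolume_pos (hn : 0 < n) : 0 < unitBallVolume n := by
  have h := sphereMeasure_univ_real_pos hn
  rw [sphereMeasure_univ_real] at h
  have hn' : (0 : ℝ) < n := by exact_mod_cast hn
  exact pos_of_mul_pos_right h hn'.le

theorem radiusOfVolume_pos (hn : 0 < n) {ω : ℝ} (hω : 0 < ω) : 0 < radiusOfVolume n ω :=
  Real.rpow_pos_of_pos (div_pos hω (unitBallVolume_pos hn)) _

theorem radiusOfVolume_pow (hn : 0 < n) {ω : ℝ} (hω : 0 < ω) :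
    radiusOfVolume n ω ^ n * unitBallVolume n = ω := by
  have h := unitBallVolume_pos hn
  rw [radiusOfVolume, one_div, Real.rpow_inv_natCast_pow (by positivity) hn.ne',
    div_mul_cancel₀ _ h.ne']

/-- The volume constraint removes the linear term of the volume. -/
theorem abs_integral_le_of_volume_constraint {C : ℝ}
    (hC : ∀ s : ℝ, |s| ≤ 1 → |(1 + s) ^ n - 1 - n * s| ≤ C * s ^ 2) {v : USphere n → ℝ}
    (hc : Continuous v) (hv : ∀ ξ, |v ξ| ≤ 1) (hn : 0 < n)
    (hvol : (1 / (n : ℝ)) * (∫ ξ, (1 + v ξ) ^ n ∂(sphereMeasure n)) = unitBallVolume n) :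
    |n * ∫ ξ, v ξ ∂(sphereMeasure n)| ≤ C * ∫ ξ, v ξ ^ 2 ∂(sphereMeasure n) := by
  have hn' : (0 : ℝ) < n := by exact_mod_cast hn
  have i1 : Integrable (fun ξ => (1 + v ξ) ^ n) (sphereMeasure n) :=
    integrable_of_continuous_sphere (by fun_prop)
  have i2 : Integrable (fun ξ => (n : ℝ) * v ξ) (sphereMeasure n) :=
    integrable_of_continuous_sphere (by fun_prop)
  have i3 : Integrable (fun ξ => C * v ξ ^ 2) (sphereMeasure n) :=
    integrable_of_continuous_sphere (by fun_prop)
  have h1 : ∫ ξ, ((1 + v ξ) ^ n - 1 - n * v ξ) ∂(sphereMeasure n)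
      = - (n * ∫ ξ, v ξ ∂(sphereMeasure n)) := by
    have i4 : Integrable (fun ξ => (1 + v ξ) ^ n - 1) (sphereMeasure n) :=
      i1.sub (integrable_const _)
    rw [integral_sub i4 i2, integral_sub i1 (integrable_const _),
      integral_const, integral_const_mul, sphereMeasure_univ_real, ← hvol]
    simp only [smul_eq_mul]
    field_simp
    ring
  rw [← abs_neg, ← h1, ← integral_const_mul, ← Real.norm_eq_abs]
  exact norm_integral_le_of_norm_le i3 (Eventually.of_forall fun ξ => hC _ (hv ξ))

/-- The barycenter constraint removes the linear terms of the first moments. -/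
theorem abs_integral_coord_le_of_barycenter_constraint {C : ℝ}
    (hC : ∀ s : ℝ, |s| ≤ 1 → |(1 + s) ^ (n + 1) - 1 - ((n + 1 : ℕ) : ℝ) * s| ≤ C * s ^ 2)
    {v : USphere n → ℝ} (hc : Continuous v) (hv : ∀ ξ, |v ξ| ≤ 1) (hn : 2 ≤ n)
    (hbar : ∫ ξ, (1 + v ξ) ^ (n + 1) • (ξ : Eucl n) ∂(sphereMeasure n) = 0) (i : Fin n) :
    |((n + 1 : ℕ) : ℝ) * ∫ ξ, v ξ * (ξ : Eucl n) i ∂(sphereMeasure n)|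
      ≤ C * ∫ ξ, v ξ ^ 2 ∂(sphereMeasure n) := by
  have i0 : Integrable (fun ξ : USphere n => (1 + v ξ) ^ (n + 1) • (ξ : Eucl n))
      (sphereMeasure n) := integrable_of_continuous_sphere (by fun_prop)
  have i1 : Integrable (fun ξ : USphere n => (1 + v ξ) ^ (n + 1) * (ξ : Eucl n) i)
      (sphereMeasure n) := integrable_of_continuous_sphere (by fun_prop)
  have i2 : Integrable (fun ξ : USphere n => ((n + 1 : ℕ) : ℝ) * (v ξ * (ξ : Eucl n) i))
      (sphereMeasure n) := integrable_of_continuous_sphere (by fun_prop)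
  have i3 : Integrable (fun ξ => C * v ξ ^ 2) (sphereMeasure n) :=
    integrable_of_continuous_sphere (by fun_prop)
  have i4 : Integrable (fun ξ : USphere n => (ξ : Eucl n) i) (sphereMeasure n) :=
    integrable_of_continuous_sphere (by fun_prop)
  have h0 : ∫ ξ : USphere n, (1 + v ξ) ^ (n + 1) * (ξ : Eucl n) i ∂(sphereMeasure n) = 0 := by
    have h := (EuclideanSpace.proj (𝕜 := ℝ) i).integral_comp_comm i0
    rw [hbar, map_zero] at h
    simpa using h
  have h1 : ∫ ξ : USphere n, ((1 + v ξ) ^ (n + 1) * (ξ : Eucl n) i - (ξ : Eucl n) i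
        - ((n + 1 : ℕ) : ℝ) * (v ξ * (ξ : Eucl n) i)) ∂(sphereMeasure n)
      = - (((n + 1 : ℕ) : ℝ) * ∫ ξ, v ξ * (ξ : Eucl n) i ∂(sphereMeasure n)) := by
    have i5 : Integrable (fun ξ : USphere n => (1 + v ξ) ^ (n + 1) * (ξ : Eucl n) i
        - (ξ : Eucl n) i) (sphereMeasure n) := i1.sub i4
    rw [integral_sub i5 i2, integral_sub i1 i4, h0, integral_coord_sphere hn,
      integral_const_mul]
    ring
  rw [← abs_neg, ← h1, ← integral_const_mul, ← Real.norm_eq_abs]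
  refine norm_integral_le_of_norm_le i3 (Eventually.of_forall fun ξ => ?_)
  have e : (1 + v ξ) ^ (n + 1) * (ξ : Eucl n) i - (ξ : Eucl n) i
        - ((n + 1 : ℕ) : ℝ) * (v ξ * (ξ : Eucl n) i)
      = ((1 + v ξ) ^ (n + 1) - 1 - ((n + 1 : ℕ) : ℝ) * v ξ) * (ξ : Eucl n) i := by ring
  rw [e, Real.norm_eq_abs, abs_mul]
  have h2 : |(ξ : Eucl n) i| ≤ 1 := by
    have := PiLp.norm_apply_le (ξ : Eucl n) i
    rwa [norm_sphere_coe] at this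
  exact (mul_le_of_le_one_right (abs_nonneg _) h2).trans (hC _ (hv ξ))

/-- For functions that obey the constraints, the spectral gap holds up to a quadratic error. -/
theorem exists_constrained_poincare (hn : 2 ≤ n) :
    ∃ D : ℝ, 0 ≤ D ∧ ∀ (v : USphere n → ℝ) (L : NNReal), LipschitzWith L v → (∀ ξ, |v ξ| ≤ 1) →
      (1 / (n : ℝ)) * (∫ ξ, (1 + v ξ) ^ n ∂(sphereMeasure n)) = unitBallVolume n →
      ∫ ξ, (1 + v ξ) ^ (n + 1) • (ξ : Eucl n) ∂(sphereMeasure n) = 0 →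
      2 * n * ((∫ ξ, v ξ ^ 2 ∂(sphereMeasure n))
          - D * (∫ ξ, v ξ ^ 2 ∂(sphereMeasure n)) ^ 2)
        ≤ ∫ ξ, ‖sphereGrad v ξ‖ ^ 2 ∂(sphereMeasure n) := by
  have hn0 : 0 < n := by omega
  have hn' : (1 : ℝ) ≤ n := by exact_mod_cast hn0
  have hS := sphereMeasure_univ_real_pos hn0
  obtain ⟨C₁, hC₁, h₁⟩ := exists_pow_expansion_bound n
  obtain ⟨C₂, hC₂, h₂⟩ := exists_pow_expansion_bound (n + 1)
  refine ⟨C₁ ^ 2 / (sphereMeasure n).real univ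
    + n / (sphereMeasure n).real univ * (n * C₂ ^ 2), by positivity,
    fun v L hL hv hvol hbar => ?_⟩
  have hI : 0 ≤ ∫ ξ, v ξ ^ 2 ∂(sphereMeasure n) := integral_nonneg fun _ => sq_nonneg _
  have a1 := abs_integral_le_of_volume_constraint h₁ hL.continuous hv hn0 hvol
  have a2 := abs_integral_coord_le_of_barycenter_constraint h₂ hL.continuous hv hn hbar
  refine le_trans ?_ (sphere_poincare hn hL)
  set I := ∫ ξ, v ξ ^ 2 ∂(sphereMeasure n)
  set S := (sphereMeasure n).real univ
  have scale : ∀ c x B : ℝ, 1 ≤ c → |c * x| ≤ B → x ^ 2 ≤ B ^ 2 := by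
    intro c x B hc hB
    rw [abs_mul, abs_of_pos (by linarith)] at hB
    rw [← sq_abs]
    refine pow_le_pow_left₀ (abs_nonneg _) (le_trans ?_ hB) 2
    exact le_mul_of_one_le_left (abs_nonneg _) hc
  have b1 : (∫ ξ, v ξ ∂(sphereMeasure n)) ^ 2 ≤ (C₁ * I) ^ 2 := scale _ _ _ hn' a1
  have b2 : ∑ i, (∫ ξ, v ξ * (ξ : Eucl n) i ∂(sphereMeasure n)) ^ 2 ≤ n * (C₂ * I) ^ 2 := by
    refine (Finset.sum_le_card_nsmul _ _ _ fun i _ => scale _ _ _ ?_ (a2 i)).trans (by simp)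
    push_cast
    linarith
  refine mul_le_mul_of_nonneg_left ?_ (by positivity)
  have c1 : (∫ ξ, v ξ ∂(sphereMeasure n)) ^ 2 / S ≤ (C₁ * I) ^ 2 / S := by gcongr
  have c2 : n / S * ∑ i, (∫ ξ, v ξ * (ξ : Eucl n) i ∂(sphereMeasure n)) ^ 2
      ≤ n / S * (n * (C₂ * I) ^ 2) := by gcongr
  have e : (C₁ ^ 2 / S + n / S * (n * C₂ ^ 2)) * I ^ 2
      = (C₁ * I) ^ 2 / S + n / S * (n * (C₂ * I) ^ 2) := by ring
  rw [e]
  linarith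

/-- With a loss `θ` small against the gap `g`, half of the gap is left. -/
theorem stability_constant_le {N A I g θ : ℝ} (hN : 0 ≤ N) (hA : 0 ≤ A) (hI : 0 ≤ I)
    (hθ : (2 * N + 1) * θ ≤ g / 2) :
    A * g / 2 * I ≤ (1 - θ) / 2 * A * (2 * N * ((1 - θ) * I)) - A * (N - g + θ) * I := by
  have h1 : 0 ≤ N * (1 - θ) ^ 2 - (N - g + θ) - g / 2 := by
    have := mul_nonneg hN (sq_nonneg θ)
    linarith [show N * (1 - θ) ^ 2 = N - 2 * (N * θ) + N * θ ^ 2 by ring]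
  have h2 := mul_nonneg (mul_nonneg hA hI) h1
  linarith [show (1 - θ) / 2 * A * (2 * N * ((1 - θ) * I)) - A * (N - g + θ) * I - A * g / 2 * I
    = A * I * (N * (1 - θ) ^ 2 - (N - g + θ) - g / 2) by ring]

/-- The quantitative inequality, in terms of the radial function `ρ (1 + v)`. -/
theorem exists_radial_stability (hn : 2 ≤ n) {ρ : ℝ} (hρ : 0 < ρ) :
    ∃ ε K : ℝ, 0 < ε ∧ ε ≤ 1 / 512 ∧ 0 < K ∧ ∀ v : USphere n → ℝ,
      v ∈ nearlySphericalFunctions n ε →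
      K * ∫ ξ, v ξ ^ 2 ∂(sphereMeasure n)
        ≤ (∫ ξ, besselProfile n (ρ * (1 + v ξ)) ^ 2 * (ρ * (1 + v ξ)) ^ (n - 1)
            * ‖(ξ : Eucl n) - (ρ * (1 + v ξ))⁻¹ • sphereGrad (fun ξ => ρ * (1 + v ξ)) ξ‖
              ∂(sphereMeasure n))
          - (∫ ξ, besselFlux n (ρ * (1 + v ξ)) ∂(sphereMeasure n)) / besselRatio n ρ := by
  have hn0 : 0 < n := by omega
  have hn' : (2 : ℝ) ≤ n := by exact_mod_cast hn
  have hg := besselGap_pos hn hρ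
  have hA := besselArea_pos hn0 hρ
  have hS := sphereMeasure_univ_real_pos hn0
  set g := besselGap n ρ with hgdef
  set A := besselArea n ρ with hAdef
  set S := (sphereMeasure n).real univ with hSdef
  -- the relative loss allowed in each estimate; half of the gap survives
  set θ := min 1 (g / (2 * (2 * n + 1))) with hθdef
  have hθ : 0 < θ := lt_min one_pos (by positivity)
  have hθ1 : θ ≤ 1 := min_le_left _ _
  have hθg : (2 * n + 1) * θ ≤ g / 2 := by
    have : θ ≤ g / (2 * (2 * n + 1)) := min_le_right _ _
    rw [le_div_iff₀ (by positivity)] at this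
    linarith
  obtain ⟨μ, hμ⟩ := exists_multiplier_second_order hn hρ hθ
  obtain ⟨δ₁, hδ₁, H₁⟩ := Metric.eventually_nhds_iff.1 hμ
  obtain ⟨δ₂, hδ₂, hδ₂1, H₂⟩ := exists_area_element_bound hn0 hρ hθ
  obtain ⟨D, hD, HD⟩ := exists_constrained_poincare hn
  set ε := min (min (1 / 512) (δ₁ / 2)) (min (δ₂ / 16) (θ / (D * S + 1))) with hεdef
  have hDS : 0 < D * S + 1 := by positivity
  have hε : 0 < ε := lt_min (lt_min (by norm_num) (by positivity)) (lt_min (by positivity)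
    (by positivity))
  have hε1 : ε ≤ 1 / 512 := (min_le_left _ _).trans (min_le_left _ _)
  have hε2 : ε ≤ δ₁ / 2 := (min_le_left _ _).trans (min_le_right _ _)
  have hε3 : ε ≤ δ₂ / 16 := (min_le_right _ _).trans (min_le_left _ _)
  have hε4 : D * S * ε ≤ θ := by
    have : ε ≤ θ / (D * S + 1) := (min_le_right _ _).trans (min_le_right _ _)
    rw [le_div_iff₀ hDS] at this
    linarith
  refine ⟨ε, A * g / 2, hε, hε1, by positivity, fun v hv => ?_⟩
  obtain ⟨hvb, hvL⟩ := bounds_of_mem_nearlySphericalFunctions hε.le hv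
  obtain ⟨hvc, -, hvol, hbar⟩ := hv
  have hv1 : ∀ ξ, |v ξ| ≤ 1 := fun ξ => (hvb ξ).trans (by linarith)
  have hpos : ∀ ξ, 0 < 1 + v ξ := fun ξ => by
    have := abs_le.1 (hvb ξ)
    linarith
  have hd : ∀ ξ, ‖sphereGrad v ξ‖ ≤ 16 * ε := fun ξ => by
    have := norm_sphereGrad_le hvL ξ
    rw [Real.coe_toNNReal _ (by positivity)] at this
    linarith
  have hcA : Continuous fun ξ => besselArea n (ρ * (1 + v ξ)) :=
    (continuous_besselArea hn0).comp (by fun_prop)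
  have hcF : Continuous fun ξ => besselFlux n (ρ * (1 + v ξ)) :=
    (continuous_besselFlux hn0).comp (by fun_prop)
  have hgm := measurable_sphereGrad v
  have iA := integrable_of_continuous_sphere hcA
  have iF := (integrable_of_continuous_sphere hcF).div_const (besselRatio n ρ)
  have iv : Integrable (fun ξ => v ξ ^ 2) (sphereMeasure n) :=
    integrable_of_continuous_sphere (by fun_prop)
  have ig : Integrable (fun ξ => ‖sphereGrad v ξ‖ ^ 2) (sphereMeasure n) := by
    simpa only [real_inner_self_eq_norm_sq] using integrable_inner_sphereGrad hvL hvL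
  have hnorm : ∀ ξ : USphere n,
      ‖(ξ : Eucl n) - (ρ * (1 + v ξ))⁻¹ • sphereGrad (fun ξ => ρ * (1 + v ξ)) ξ‖
        = √(1 + (‖sphereGrad v ξ‖ / (1 + v ξ)) ^ 2) := by
    intro ξ
    have h := norm_normal_sq (R := fun ξ => ρ * (1 + v ξ)) ξ
    rw [← Real.sqrt_sq (norm_nonneg ((ξ : Eucl n) - _)), h, sphereGrad_affine hρ.ne', smul_smul,
      norm_smul, mul_inv, mul_comm ρ⁻¹, mul_assoc, inv_mul_cancel₀ hρ.ne', mul_one,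
      norm_inv, Real.norm_of_nonneg (hpos ξ).le, inv_mul_eq_div]
  -- the surface term
  have s1 : (∫ ξ, besselArea n (ρ * (1 + v ξ)) ∂(sphereMeasure n))
        + (1 - θ) / 2 * A * ∫ ξ, ‖sphereGrad v ξ‖ ^ 2 ∂(sphereMeasure n)
      ≤ ∫ ξ, besselProfile n (ρ * (1 + v ξ)) ^ 2 * (ρ * (1 + v ξ)) ^ (n - 1)
            * ‖(ξ : Eucl n) - (ρ * (1 + v ξ))⁻¹ • sphereGrad (fun ξ => ρ * (1 + v ξ)) ξ‖
              ∂(sphereMeasure n) := by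
    rw [← integral_const_mul, ← integral_add iA (ig.const_mul _)]
    refine integral_mono (iA.add (ig.const_mul _)) ?_ fun ξ => ?_
    · simp only [hnorm]
      have hm : Measurable fun ξ => √(1 + (‖sphereGrad v ξ‖ / (1 + v ξ)) ^ 2) := by
        have := hvc.measurable
        fun_prop
      refine Integrable.mul_bdd (c := 2) iA hm.aestronglyMeasurable
        (Eventually.of_forall fun ξ => ?_)
      rw [Real.norm_of_nonneg (Real.sqrt_nonneg _), Real.sqrt_le_left (by norm_num)]
      have h1 : ‖sphereGrad v ξ‖ / (1 + v ξ) ≤ 1 := by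
        rw [div_le_one (hpos ξ)]
        have := abs_le.1 (hvb ξ)
        linarith [hd ξ]
      have h2 : 0 ≤ ‖sphereGrad v ξ‖ / (1 + v ξ) := div_nonneg (norm_nonneg _) (hpos ξ).le
      nlinarith
    · simp only [hnorm]
      refine H₂ (v ξ) ‖sphereGrad v ξ‖ ?_ ?_
      · linarith [hvb ξ]
      · rw [abs_norm]
        linarith [hd ξ]
  -- the radial term; the volume constraint removes the multiplier
  have s2 : -(A * (n - g + θ)) * ∫ ξ, v ξ ^ 2 ∂(sphereMeasure n)
      ≤ (∫ ξ, besselArea n (ρ * (1 + v ξ)) ∂(sphereMeasure n))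
        - (∫ ξ, besselFlux n (ρ * (1 + v ξ)) ∂(sphereMeasure n)) / besselRatio n ρ := by
    have ip : Integrable (fun ξ => μ * ((ρ * (1 + v ξ)) ^ n - ρ ^ n)) (sphereMeasure n) :=
      integrable_of_continuous_sphere (by fun_prop)
    have hp0 : ∫ ξ, μ * ((ρ * (1 + v ξ)) ^ n - ρ ^ n) ∂(sphereMeasure n) = 0 := by
      have i1 : Integrable (fun ξ => (1 + v ξ) ^ n) (sphereMeasure n) :=
        integrable_of_continuous_sphere (by fun_prop)
      have e : ∀ ξ, μ * ((ρ * (1 + v ξ)) ^ n - ρ ^ n) = μ * ρ ^ n * ((1 + v ξ) ^ n - 1) := by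
        intro ξ
        rw [mul_pow]
        ring
      simp only [e]
      rw [integral_const_mul, integral_sub i1 (integrable_const _), integral_const,
        sphereMeasure_univ_real, ← hvol]
      field_simp
      simp
    have iAF : Integrable (fun ξ => besselArea n (ρ * (1 + v ξ))
        - besselFlux n (ρ * (1 + v ξ)) / besselRatio n ρ) (sphereMeasure n) := iA.sub iF
    rw [← integral_div, ← integral_const_mul, ← integral_sub iA iF,
      ← sub_zero (∫ ξ, (besselArea n (ρ * (1 + v ξ))
        - besselFlux n (ρ * (1 + v ξ)) / besselRatio n ρ) ∂(sphereMeasure n)), ← hp0,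
      ← integral_sub iAF ip]
    refine integral_mono (iv.const_mul _) (iAF.sub ip) fun ξ => ?_
    refine H₁ ?_
    rw [Real.dist_eq, sub_zero]
    linarith [hvb ξ]
  -- the spectral gap
  have s3 := HD v _ hvL hv1 hvol hbar
  set I := ∫ ξ, v ξ ^ 2 ∂(sphereMeasure n) with hI
  have hI0 : 0 ≤ I := integral_nonneg fun _ => sq_nonneg _
  have hIS : I ≤ S * ε := by
    have h1 : I ≤ ∫ ξ : USphere n, ε ∂(sphereMeasure n) := by
      refine integral_mono iv (integrable_const _) fun ξ => ?_
      have h2 := hvb ξ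
      have h3 := abs_nonneg (v ξ)
      change v ξ ^ 2 ≤ ε
      rw [← sq_abs]
      nlinarith
    rwa [integral_const, smul_eq_mul] at h1
  have s4 : 2 * n * ((1 - θ) * I) ≤ ∫ ξ, ‖sphereGrad v ξ‖ ^ 2 ∂(sphereMeasure n) := by
    refine le_trans (mul_le_mul_of_nonneg_left ?_ (by positivity)) s3
    have h1 : D * I ≤ θ := le_trans (by
      have := mul_le_mul_of_nonneg_left hIS hD
      linarith) hε4
    nlinarith
  have s5 := mul_le_mul_of_nonneg_left s4
    (mul_nonneg (by linarith : 0 ≤ (1 - θ) / 2) hA.le)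
  have s6 := stability_constant_le (by linarith) hA.le hI0 hθg
  linarith

end Stability

theorem theorem1p4 (n : ℕ) (hn : 2 ≤ n) (ω : ℝ) (hω : 0 < ω) :
    ∃ ε K : ℝ, 0 < ε ∧ ε ≤ 1 ∧ 0 < K ∧
      ∀ (Ω : Set (Eucl n)) (c : Eucl n) (v : USphere n → ℝ),
        IsNearlySphericalWith ω ε Ω c v →
          traceEigenvalue (symmBall Ω)
              = weightedVolume (symmBall Ω) / weightedPerimeter (symmBall Ω) ∧
          weightedVolume (symmBall Ω) / weightedPerimeter (symmBall Ω)
              ≥ weightedVolume ((fun x => x - c) '' Ω) / weightedPerimeter ((fun x => x - c) '' Ω)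
                * (1 + K * ∫ ξ, v ξ ^ 2 ∂(sphereMeasure n)) ∧
          weightedVolume ((fun x => x - c) '' Ω) / weightedPerimeter ((fun x => x - c) '' Ω)
                * (1 + K * ∫ ξ, v ξ ^ 2 ∂(sphereMeasure n))
              ≥ traceEigenvalue Ω * (1 + K * ∫ ξ, v ξ ^ 2 ∂(sphereMeasure n)) := by
  have hn0 : 0 < n := by omega
  set ρ := radiusOfVolume n ω with hρdef
  have hρ : 0 < ρ := radiusOfVolume_pos hn0 hω
  have hS := sphereMeasure_univ_real_pos hn0
  have hh := besselRatio_pos hn0 hρ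
  obtain ⟨ε, K, hε, hε1, hK, H⟩ := exists_radial_stability hn hρ
  -- an upper bound for the weighted flux through the nearly spherical boundaries
  obtain ⟨M, hM⟩ := (isCompact_Icc (a := ρ / 2) (b := 2 * ρ)).exists_bound_of_continuousOn
    (continuous_besselFlux hn0).continuousOn
  have hM0 : 0 < M := by
    have h1 := hM ρ ⟨by linarith, by linarith⟩
    rw [Real.norm_of_nonneg (besselFlux_pos hn0 hρ).le] at h1
    exact (besselFlux_pos hn0 hρ).trans_le h1
  set S := (sphereMeasure n).real univ with hSdef
  -- the weighted volume is at most `M * S`, which turns the additive gap into a relative one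
  refine ⟨ε, besselRatio n ρ * K / (M * S), hε, by linarith, by positivity, fun Ω c v hΩ => ?_⟩
  obtain ⟨hΩo, hΩb, hv, hfr⟩ := hΩ
  set U := (fun x => x - c) '' Ω with hU
  set R : USphere n → ℝ := fun ξ => ρ * (1 + v ξ) with hRdef
  have hfr' : frontier U = range (radialGraph R) := hfr
  have hUo : IsOpen U := (Homeomorph.subRight c).isOpenMap Ω hΩo
  have hUb : Bornology.IsBounded U :=
    (IsometryEquiv.subRight c).isometry.lipschitz.isBounded_image hΩb
  have hstab := H v hv
  obtain ⟨hvb, hvL⟩ := bounds_of_mem_nearlySphericalFunctions hε.le hv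
  have hvhalf : ∀ ξ, |v ξ| ≤ 1 / 2 := fun ξ => (hvb ξ).trans (by linarith)
  have hRm : ∀ ξ, ρ / 2 ≤ R ξ := fun ξ => by
    have := (abs_le.1 (hvhalf ξ)).1
    simp only [hRdef]
    nlinarith
  have hR2 : ∀ ξ, R ξ ≤ 2 * ρ := fun ξ => by
    have := (abs_le.1 (hvhalf ξ)).2
    simp only [hRdef]
    nlinarith
  have hR : ∀ ξ, 0 < R ξ := fun ξ => lt_of_lt_of_le (by linarith) (hRm ξ)
  have hRL : LipschitzWith (ρ * (8 * ε)).toNNReal R := by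
    refine LipschitzWith.of_dist_le_mul fun ξ η => ?_
    have h1 := hvL.dist_le_mul ξ η
    rw [Real.coe_toNNReal _ (by positivity)] at h1 ⊢
    simp only [hRdef, Real.dist_eq] at h1 ⊢
    rw [← mul_sub, abs_mul, abs_of_pos hρ, add_sub_add_left_eq_sub, mul_assoc]
    gcongr
  have hLm : (((ρ * (8 * ε)).toNNReal : NNReal) : ℝ) ≤ ρ / 2 / 32 := by
    rw [Real.coe_toNNReal _ (by positivity)]
    nlinarith
  have hUR := isRadialDomain_of_frontier_eq hn0 hR hUo hUb hfr'
  have hvolU : volume.real U = ω := by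
    rw [volume_radialDomain hn0 hUR hR hUb hUo.measurableSet]
    simp only [hRdef, mul_pow]
    rw [integral_const_mul, mul_left_comm, hv.2.2.1, radiusOfVolume_pow hn0 hω]
  have hvol : volume.real Ω = ω := by
    rw [← hvolU, hU, sub_image_eq_preimage, measureReal_def, measureReal_def,
      measure_preimage_add_right]
  have hball : symmBall Ω = ball 0 ρ := by rw [symmBall, hvol]
  have hV := weightedVolume_radialDomain hn0 hUR hR hUb hUo.measurableSet
  have hP := le_weightedPerimeter hn0 hRL (by positivity) hRm hLm hfr'
  set I := ∫ ξ, v ξ ^ 2 ∂(sphereMeasure n) with hI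
  have hI0 : 0 ≤ I := integral_nonneg fun _ => sq_nonneg _
  have hgap : K * I ≤ weightedPerimeter U - weightedVolume U / besselRatio n ρ := by
    rw [hV]
    exact hstab.trans (sub_le_sub_right hP _)
  have hVi : Integrable (fun ξ => besselFlux n (R ξ)) (sphereMeasure n) :=
    integrable_of_continuous_sphere ((continuous_besselFlux hn0).comp hRL.continuous)
  have hVM : weightedVolume U ≤ M * S := by
    rw [hV]
    have h1 := integral_mono hVi (integrable_const M) fun ξ =>
      (le_abs_self _).trans (hM (R ξ) ⟨hRm ξ, hR2 ξ⟩)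
    rwa [integral_const, smul_eq_mul, mul_comm] at h1
  have hV0 : 0 < weightedVolume U := by
    rw [hV, integral_pos_iff_support_of_nonneg (fun ξ => (besselFlux_pos hn0 (hR ξ)).le) hVi]
    have h1 : Function.support (fun ξ => besselFlux n (R ξ)) = univ :=
      eq_univ_of_forall fun ξ => (besselFlux_pos hn0 (hR ξ)).ne'
    rw [h1]
    exact (ENNReal.toReal_pos_iff.1 hS).1
  have hP0 : 0 < weightedPerimeter U := by
    have h1 : 0 < weightedVolume U / besselRatio n ρ := div_pos hV0 hh
    have h2 : 0 ≤ K * I := by positivity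
    linarith
  obtain ⟨hb1, hb2⟩ := traceEigenvalue_ball hn0 hρ hS
  rw [hball]
  refine ⟨hb1.trans hb2.symm, ?_, ?_⟩
  · rw [hb2, ge_iff_le, div_mul_eq_mul_div, div_le_iff₀ hP0]
    change _ ≤ besselRatio n ρ * _
    have h1 := mul_le_mul_of_nonneg_left hgap hh.le
    rw [mul_sub, mul_div_cancel₀ _ hh.ne'] at h1
    have h2 : weightedVolume U * (besselRatio n ρ * K / (M * S) * I)
        ≤ M * S * (besselRatio n ρ * K / (M * S) * I) := by gcongr
    have h3 : M * S * (besselRatio n ρ * K / (M * S) * I) = besselRatio n ρ * (K * I) := by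
      field_simp
    linarith
  · -- finiteness of the boundary measure makes the translate of `z` an admissible test function
    have hfin : IsFiniteMeasure (boundaryMeasure Ω) := by
      have hfU := isFiniteMeasure_boundaryMeasure hn0 hR hRL hfr'
      have h1 := boundaryMeasure_sub_image c Ω
      refine ⟨?_⟩
      have h2 : boundaryMeasure U univ = boundaryMeasure Ω univ := by
        rw [h1, Measure.map_apply (by fun_prop) MeasurableSet.univ, preimage_univ]
      rw [← h2]
      exact measure_lt_top _ _
    have h3 := traceEigenvalue_le_weighted hn0 hΩb hΩo.measurableSet c hP0
    exact mul_le_mul_of_nonneg_right h3 (by positivity)
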